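/- \textbf{Theorem.} Let $G=(V,E,w)$ be a connected simple undirected graph with $V=\{0,\dots,n-1\}$, $m=|E|$ and positive real edge weights $w$, let $T$ be a spanning tree of $G$, and let $\beta\in\mathbb{R}$. Root $T$ at a vertex $r$. For $e\in E(T)$ let $e^\downarrow$ be the set of vertices of the component of $T-e$ that does not contain $r$, and let $T_e$ be the set of edges of $T$ with both endpoints in $e^\downarrow$. For $S\subseteq V$ let $\Delta(S)$ be the set of edges of $G$ with exactly one endpoint in $S$. For distinct $e,f\in E(T)$ let $\mathrm{cut}_T(e,f)=\Delta(S_{e,f})$, where $S_{e,f}=e^\downarrow\setminus f^\downarrow$ if $f\in T_e$, $S_{e,f}=f^\downarrow\setminus e^\downarrow$ if $e\in T_f$, and $S_{e,f}=e^\downarrow\cup f^\downarrow$ otherwise (this cut does not depend on $r$). The cut is non-trivial if $|S_{e,f}|\ge 2$ and $|V\setminus S_{e,f}|\ge 2$, and $\mathrm{cost}(e,f)$ is its total weight. Let $H$ be the graph with vertex set $E(T)$ in which distinct $e,f$ are adjacent iff $\mathrm{cost}(e,f)\le\beta$ and $\mathrm{cut}_T(e,f)$ is non-trivial. There is a deterministic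 algorithm that, given adjacency list access to $G$ (with its weights) and to $T$, and given $\beta$, outputs a spanning forest of $H$, that is, an acyclic subgraph of $H$ on the vertex set $E(T)$ with the same connected components as $H$, each of its edges being listed once. For $n\ge 2$ its running time is $\mathcal{O}(m\log^4 n)$, with an absolute constant. Here an algorithm is a single fixed program for a random access machine that does unit-cost arithmetic ($+,-,\times$, integer division and remainder) and comparisons on integer words of length at least a suitable constant times $\log n$, and unit-cost additions, subtractions and comparisons on real numbers, with unit-cost access to arrays indexed by words. -/

import Mathlib

/-! ## Graphs, cuts and the graph `H` on the edges of a spanning tree -/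

/-- `Δ_G(S)`: the edges of `G` with exactly one endpoint in `S`. -/
def cutEdges {V : Type*} (G : SimpleGraph V) (S : Set V) : Set (Sym2 V) :=
  {e | e ∈ G.edgeSet ∧ ∃ u ∈ S, ∃ v ∉ S, e = s(u, v)}

open Classical in
/-- `w(Δ_G(S))`. -/
noncomputable def cutWeight {V : Type*} [Fintype V] (G : SimpleGraph V) (w : Sym2 V → ℝ)
    (S : Set V) : ℝ :=
  ∑ e : Sym2 V with e ∈ cutEdges G S, w e

/-- The cut with shores `S` and `Sᶜ` is non-trivial: both shores have at least two vertices. -/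
def NontrivialShore {V : Type*} (S : Set V) : Prop :=
  2 ≤ S.ncard ∧ 2 ≤ Sᶜ.ncard

/-- `e↓` for the tree `T` rooted at `r`: the vertices in the component of `T - e` that does not
contain `r`. -/
def below {V : Type*} (T : SimpleGraph V) (r : V) (e : Sym2 V) : Set V :=
  {v | ¬ (T.deleteEdges {e}).Reachable r v}

/-- `T_e`: the edges of the subgraph of `T` induced by `e↓`. -/
def subtreeEdges {V : Type*} (T : SimpleGraph V) (r : V) (e : Sym2 V) : Set (Sym2 V) :=
  {f | f ∈ T.edgeSet ∧ ∀ v ∈ f, v ∈ below T r e}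

open Classical in
/-- The shore of `cut_T(e, f)`: `e↓ \ f↓` if `f ∈ T_e`, `f↓ \ e↓` if `e ∈ T_f`, and `e↓ ∪ f↓` if
`e` and `f` are independent. -/
noncomputable def pairShore {V : Type*} (T : SimpleGraph V) (r : V) (e f : Sym2 V) : Set V :=
  if f ∈ subtreeEdges T r e then below T r e \ below T r f
  else if e ∈ subtreeEdges T r f then below T r f \ below T r e
  else below T r e ∪ below T r f

/-- The graph `H`: its vertices are the edges of `T`, and distinct `e`, `f` are adjacent iff
`cut_T(e, f)` is non-trivial and has weight at most `β` in `G`. (`fromRel` adds `e ≠ f`, and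
symmetrises a relation that is symmetric already when `T` is a tree.) -/
noncomputable def pairCutGraph {V : Type*} [Fintype V] (G T : SimpleGraph V) (w : Sym2 V → ℝ)
    (β : ℝ) (r : V) : SimpleGraph T.edgeSet :=
  SimpleGraph.fromRel fun e f =>
    cutWeight G w (pairShore T r e f) ≤ β ∧ NontrivialShore (pairShore T r e f)

/-- `F` is a spanning forest of `H`: an acyclic subgraph on the same vertices with the same
connected components. -/
def IsSpanningForest {U : Type*} (H F : SimpleGraph U) : Prop :=
  F ≤ H ∧ F.IsAcyclic ∧ ∀ x y, H.Reachable x y → F.Reachable x y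

/-! ## A random access machine with integer words and real numbers

Integer cells hold machine words, that is, numbers below `W` (`W = 2 ^ (word length)`), and no
arithmetic operation on words leaves this range. Real cells hold real numbers, which can only be added, subtracted,
compared and moved. A program is a finite command; it uses finitely many variables and arrays.
Each operation, test, memory access and assignment costs one step. -/

namespace RealRAM

/-- A memory state: integer variables and arrays, real variables and arrays. -/
structure State where
  intVar : ℕ → ℕ
  intArr : ℕ → ℕ → ℕ
  realVar : ℕ → ℝ
  realArr : ℕ → ℕ → ℝ

/-- Assign to an integer variable. -/
def State.setIntVar (s : State) (x v : ℕ) : State :=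
  { s with intVar := Function.update s.intVar x v }

/-- Assign to the cell with index `i` of an integer array. -/
def State.setIntArr (s : State) (a i v : ℕ) : State :=
  { s with intArr := Function.update s.intArr a (Function.update (s.intArr a) i v) }

/-- Assign to a real variable. -/
def State.setRealVar (s : State) (x : ℕ) (v : ℝ) : State :=
  { s with realVar := Function.update s.realVar x v }

/-- Assign to the cell with index `i` of a real array. -/
def State.setRealArr (s : State) (a i : ℕ) (v : ℝ) : State :=
  { s with realArr := Function.update s.realArr a (Function.update (s.realArr a) i v) }

/-- Integer expressions; `arr a i` reads the cell with index `i` of array number `a`. -/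
inductive IntExp where
  | lit (c : ℕ)
  | var (x : ℕ)
  | arr (a : ℕ) (i : IntExp)
  | add (e f : IntExp)
  | sub (e f : IntExp)
  | mul (e f : IntExp)
  | div (e f : IntExp)
  | mod (e f : IntExp)

/-- Real expressions. -/
inductive RealExp where
  | zero
  | one
  | var (x : ℕ)
  | arr (a : ℕ) (i : IntExp)
  | add (e f : RealExp)
  | sub (e f : RealExp)

/-- Tests. -/
inductive Test where
  | intLt (e f : IntExp)
  | intEq (e f : IntExp)
  | realLt (e f : RealExp)
  | realLe (e f : RealExp)
  | not (b : Test)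
  | and (b c : Test)
  | or (b c : Test)

/-- Commands, that is, programs. -/
inductive Cmd where
  | skip
  | setInt (x : ℕ) (e : IntExp)
  | storeInt (a : ℕ) (i e : IntExp)
  | setReal (x : ℕ) (e : RealExp)
  | storeReal (a : ℕ) (i : IntExp) (e : RealExp)
  | seq (p q : Cmd)
  | cond (b : Test) (p q : Cmd)
  | loop (b : Test) (p : Cmd)

/-- Value of an integer expression for words below `W`: addition and multiplication are modulo `W`,
subtraction is truncated at `0`, division by `0` gives `0`. -/
def IntExp.eval (W : ℕ) (s : State) : IntExp → ℕ
  | .lit c => c % W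
  | .var x => s.intVar x
  | .arr a i => s.intArr a (i.eval W s)
  | .add e f => (e.eval W s + f.eval W s) % W
  | .sub e f => e.eval W s - f.eval W s
  | .mul e f => (e.eval W s * f.eval W s) % W
  | .div e f => e.eval W s / f.eval W s
  | .mod e f => e.eval W s % f.eval W s

/-- Value of a real expression. -/
noncomputable def RealExp.eval (W : ℕ) (s : State) : RealExp → ℝ
  | .zero => 0
  | .one => 1
  | .var x => s.realVar x
  | .arr a i => s.realArr a (i.eval W s)
  | .add e f => e.eval W s + f.eval W s
  | .sub e f => e.eval W s - f.eval W s

/-- Truth of a test. -/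
def Test.Holds (W : ℕ) (s : State) : Test → Prop
  | .intLt e f => e.eval W s < f.eval W s
  | .intEq e f => e.eval W s = f.eval W s
  | .realLt e f => e.eval W s < f.eval W s
  | .realLe e f => e.eval W s ≤ f.eval W s
  | .not b => ¬ b.Holds W s
  | .and b c => b.Holds W s ∧ c.Holds W s
  | .or b c => b.Holds W s ∨ c.Holds W s

/-- Number of steps to evaluate an integer expression. -/
def IntExp.steps : IntExp → ℕ
  | .lit _ => 1
  | .var _ => 1
  | .arr _ i => i.steps + 1
  | .add e f => e.steps + f.steps + 1
  | .sub e f => e.steps + f.steps + 1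
  | .mul e f => e.steps + f.steps + 1
  | .div e f => e.steps + f.steps + 1
  | .mod e f => e.steps + f.steps + 1

/-- Number of steps to evaluate a real expression. -/
def RealExp.steps : RealExp → ℕ
  | .zero => 1
  | .one => 1
  | .var _ => 1
  | .arr _ i => i.steps + 1
  | .add e f => e.steps + f.steps + 1
  | .sub e f => e.steps + f.steps + 1

/-- Number of steps to evaluate a test. -/
def Test.steps : Test → ℕ
  | .intLt e f => e.steps + f.steps + 1
  | .intEq e f => e.steps + f.steps + 1
  | .realLt e f => e.steps + f.steps + 1
  | .realLe e f => e.steps + f.steps + 1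
  | .not b => b.steps + 1
  | .and b c => b.steps + c.steps + 1
  | .or b c => b.steps + c.steps + 1

/-- `Run W p s s' t`: with words below `W`, program `p` started in `s` halts in `s'` after exactly
`t` steps. -/
inductive Run (W : ℕ) : Cmd → State → State → ℕ → Prop
  | skip (s : State) : Run W .skip s s 1
  | setInt (x : ℕ) (e : IntExp) (s : State) :
      Run W (.setInt x e) s (s.setIntVar x (e.eval W s)) (e.steps + 1)
  | storeInt (a : ℕ) (i e : IntExp) (s : State) :
      Run W (.storeInt a i e) s (s.setIntArr a (i.eval W s) (e.eval W s)) (i.steps + e.steps + 1)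
  | setReal (x : ℕ) (e : RealExp) (s : State) :
      Run W (.setReal x e) s (s.setRealVar x (e.eval W s)) (e.steps + 1)
  | storeReal (a : ℕ) (i : IntExp) (e : RealExp) (s : State) :
      Run W (.storeReal a i e) s (s.setRealArr a (i.eval W s) (e.eval W s)) (i.steps + e.steps + 1)
  | seq {p q : Cmd} {s s' s'' : State} {t t' : ℕ} :
      Run W p s s' t → Run W q s' s'' t' → Run W (.seq p q) s s'' (t + t')
  | condTrue {b : Test} {p q : Cmd} {s s' : State} {t : ℕ} :
      b.Holds W s → Run W p s s' t → Run W (.cond b p q) s s' (b.steps + 1 + t)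
  | condFalse {b : Test} {p q : Cmd} {s s' : State} {t : ℕ} :
      ¬ b.Holds W s → Run W q s s' t → Run W (.cond b p q) s s' (b.steps + 1 + t)
  | loopTrue {b : Test} {p : Cmd} {s s' s'' : State} {t t' : ℕ} :
      b.Holds W s → Run W p s s' t → Run W (.loop b p) s' s'' t' →
      Run W (.loop b p) s s'' (b.steps + 1 + t + t')
  | loopFalse {b : Test} {p : Cmd} {s : State} :
      ¬ b.Holds W s → Run W (.loop b p) s s (b.steps + 1)

/-- The machine is deterministic. -/
theorem Run.deterministic {W : ℕ} {p : Cmd} {s s₁ s₂ : State} {t₁ t₂ : ℕ}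
    (h₁ : Run W p s s₁ t₁) (h₂ : Run W p s s₂ t₂) : s₁ = s₂ ∧ t₁ = t₂ := by
  induction h₁ generalizing s₂ t₂ with
  | skip => cases h₂; exact ⟨rfl, rfl⟩
  | setInt => cases h₂; exact ⟨rfl, rfl⟩
  | storeInt => cases h₂; exact ⟨rfl, rfl⟩
  | setReal => cases h₂; exact ⟨rfl, rfl⟩
  | storeReal => cases h₂; exact ⟨rfl, rfl⟩
  | seq _ _ ih ih' =>
    cases h₂ with
    | seq a b =>
      obtain ⟨rfl, rfl⟩ := ih a
      obtain ⟨rfl, rfl⟩ := ih' b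
      exact ⟨rfl, rfl⟩
  | condTrue hb _ ih =>
    cases h₂ with
    | condTrue _ a => obtain ⟨rfl, rfl⟩ := ih a; exact ⟨rfl, rfl⟩
    | condFalse hb' _ => exact absurd hb hb'
  | condFalse hb _ ih =>
    cases h₂ with
    | condTrue hb' _ => exact absurd hb' hb
    | condFalse _ a => obtain ⟨rfl, rfl⟩ := ih a; exact ⟨rfl, rfl⟩
  | loopTrue hb _ _ ih ih' =>
    cases h₂ with
    | loopTrue _ a b =>
      obtain ⟨rfl, rfl⟩ := ih a
      obtain ⟨rfl, rfl⟩ := ih' b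
      exact ⟨rfl, rfl⟩
    | loopFalse hb' => exact absurd hb hb'
  | loopFalse hb =>
    cases h₂ with
    | loopTrue hb' _ _ => exact absurd hb' hb
    | loopFalse _ => exact ⟨rfl, rfl⟩

/-! ### Input and output -/

/-- `A` is an adjacency list representation of `G`: `A v` lists the neighbours of `v`, each once,
in any order. -/
def IsAdjList {n : ℕ} (G : SimpleGraph (Fin n)) (A : Fin n → List (Fin n)) : Prop :=
  ∀ v, (A v).Nodup ∧ ∀ u, u ∈ A v ↔ G.Adj v u

/-- The adjacency lists `A 0, A 1, …` one after the other, as a list of arcs `(v, u)`, `u ∈ A v`. -/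
def arcs {n : ℕ} (A : Fin n → List (Fin n)) : List (Fin n × Fin n) :=
  (List.finRange n).flatMap fun v => (A v).map fun u => (v, u)

/-- The position in `arcs A` at which the list of vertex `v` begins, `v ≤ n`; position `v + 1` ends
the list of `v`. Cells beyond `n` hold `0`. -/
def offset {n : ℕ} (A : Fin n → List (Fin n)) (v : ℕ) : ℕ :=
  if v ≤ n then (arcs A).countP (fun a => a.1.val < v) else 0

/-- The array of the second endpoints of the arcs. -/
def target {n : ℕ} (A : Fin n → List (Fin n)) (j : ℕ) : ℕ :=
  ((arcs A)[j]?.map fun a => a.2.val).getD 0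

/-- The array of the weights of the arcs. -/
noncomputable def arcWeight {n : ℕ} (A : Fin n → List (Fin n)) (w : Sym2 (Fin n) → ℝ) (j : ℕ) : ℝ :=
  ((arcs A)[j]?.map fun a => w s(a.1, a.2)).getD 0

/-- The initial state for the weighted graph with adjacency lists `A` and weights `w`, the tree with
adjacency lists `B`, and the threshold `β`. Integer variable `0` holds `n`, real variable `0`
holds `β`. Integer arrays `0`, `1` and real array `0` hold the offsets, the neighbours and the edge
weights of the graph; integer arrays `2`, `3` hold the offsets and neighbours of the tree.
Everything else is `0`. -/
noncomputable def inputState {n : ℕ} (A : Fin n → List (Fin n)) (w : Sym2 (Fin n) → ℝ)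
    (B : Fin n → List (Fin n)) (β : ℝ) : State where
  intVar x := if x = 0 then n else 0
  intArr a :=
    match a with
    | 0 => offset A
    | 1 => target A
    | 2 => offset B
    | 3 => target B
    | _ => fun _ => 0
  realVar x := if x = 0 then β else 0
  realArr a :=
    match a with
    | 0 => arcWeight A w
    | _ => fun _ => 0

/-- The `i`-th output item: the unordered pair of the two vertex pairs that are stored at index `i`
of the integer arrays `4`, `5` and `6`, `7`. -/
def outputPair (s : State) (i : ℕ) : Sym2 (Sym2 ℕ) :=
  s(s(s.intArr 4 i, s.intArr 5 i), s(s.intArr 6 i, s.intArr 7 i))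

/-- The final state `s` outputs the graph `F` on the edges of `T`: integer variable `1` holds the
number of edges of `F`, and the items with smaller index list the edges of `F`, each once. -/
def Outputs {n : ℕ} {T : SimpleGraph (Fin n)} (s : State) (F : SimpleGraph T.edgeSet) : Prop :=
  Set.BijOn (outputPair s) (Set.Iio (s.intVar 1))
    (Sym2.map (fun e : T.edgeSet => Sym2.map Fin.val e.1) '' F.edgeSet)

end RealRAM

/-! An edge `xy` of `G` crosses the cut of two tree edges `e`, `f` iff exactly one of `e`, `f` lies
on the tree path between `x` and `y`. Put `σ_e(xy) = -1` if `e` lies on this path and `σ_e(xy) = 1`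
otherwise. Then the sum of `-w(xy) σ_e(xy) σ_f(xy)` over all arcs, two for each edge, is `4 cost(e,
f)` minus the total arc weight. So the pairs of cost at most `β` are the entries of a matrix that
are at most a fixed threshold, and no root enters. As `T` is connected, the cut is trivial iff `e`
and `f` are precisely the tree edges at some vertex. A penalty above `4β` on these entries excludes
them, because cut weights are non-negative. This is `TreeLayout.costMatrix_le_iff`.

The matrix is never written down. The tree is rooted at vertex 0 and its vertices get positions such
that parents precede children and every heavy path is an interval; a tree edge has the position of
its lower endpoint. Every tree path is then a union of `O(log n)` intervals (`walk_spec`). Hence `e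
↦ σ_e(xy)` is an alternating sum of `O(log n)` step functions, and its tensor square is the
two-dimensional prefix sum of `O(log² n)` point masses, the events (`pushProd_spec`). The penalty
takes 16 events for each vertex of degree two.

A sweep keeps the current row as the prefix sums of a sequence of differences in a segment tree. A
node stores the total of its interval, the smallest prefix sum, and the smallest one at a position
of another colour; this suffices to combine two children (`Best.union`, `recompute_spec`), and an
event affects one leaf and its ancestors (`climb_spec`). The colours are the components of the
forest built so far. As long as the row of `e` has an entry within the threshold at a colour other
than that of `e`, the pair joins the forest and the smaller class is relabelled (`queryRow_spec`). A
new edge joins different classes, so the graph stays a forest (`Forest.add`). After its row, `e` has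
the colour of all its neighbours in `H`, and this persists because classes only merge
(`sweep_spec`). So the final classes are the components of `H` (`exists_spanningForest`).

There are `O(m log² n)` events and, by the potential `colourPot`, `O(n log n)` relabellings, each of
cost `O(log n)`. The resulting `O(m log³ n)` is within the claimed bound. -/

namespace RealRAM

/-! ## Program logic with running time -/

/-- Program `p` started in `s` halts, in a state and after a number of steps that satisfy `Q`. -/
def WP (W : ℕ) (p : Cmd) (Q : State → ℕ → Prop) (s : State) : Prop :=
  ∃ s' t, Run W p s s' t ∧ Q s' t

/-- Program `p` started in `s` halts after at most `T` steps in a state that satisfies `Q`. -/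
def Spec (W : ℕ) (p : Cmd) (s : State) (T : ℕ) (Q : State → Prop) : Prop :=
  WP W p (fun s' t => t ≤ T ∧ Q s') s

infixr:60 " ;; " => Cmd.seq

section Projections

variable (s : State) (x y a b i v : ℕ) (r : ℝ)

@[simp] theorem setIntVar_intVar :
    (s.setIntVar x v).intVar y = if y = x then v else s.intVar y := by
  simp [State.setIntVar, Function.update_apply]
@[simp] theorem setIntVar_intArr : (s.setIntVar x v).intArr = s.intArr := rfl
@[simp] theorem setIntVar_realVar : (s.setIntVar x v).realVar = s.realVar := rfl
@[simp] theorem setIntVar_realArr : (s.setIntVar x v).realArr = s.realArr := rfl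
@[simp] theorem setIntArr_intArr : (s.setIntArr a i v).intArr b =
    if b = a then Function.update (s.intArr a) i v else s.intArr b := by
  simp [State.setIntArr, Function.update_apply]
@[simp] theorem setIntArr_intVar : (s.setIntArr a i v).intVar = s.intVar := rfl
@[simp] theorem setIntArr_realVar : (s.setIntArr a i v).realVar = s.realVar := rfl
@[simp] theorem setIntArr_realArr : (s.setIntArr a i v).realArr = s.realArr := rfl
@[simp] theorem setRealVar_realVar :
    (s.setRealVar x r).realVar y = if y = x then r else s.realVar y := by
  simp [State.setRealVar, Function.update_apply]
@[simp] theorem setRealVar_intVar : (s.setRealVar x r).intVar = s.intVar := rfl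
@[simp] theorem setRealVar_intArr : (s.setRealVar x r).intArr = s.intArr := rfl
@[simp] theorem setRealVar_realArr : (s.setRealVar x r).realArr = s.realArr := rfl
@[simp] theorem setRealArr_realArr : (s.setRealArr a i r).realArr b =
    if b = a then Function.update (s.realArr a) i r else s.realArr b := by
  simp [State.setRealArr, Function.update_apply]
@[simp] theorem setRealArr_intVar : (s.setRealArr a i r).intVar = s.intVar := rfl
@[simp] theorem setRealArr_realVar : (s.setRealArr a i r).realVar = s.realVar := rfl
@[simp] theorem setRealArr_intArr : (s.setRealArr a i r).intArr = s.intArr := rfl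

end Projections

section Rules

variable {W : ℕ} {Q R : State → ℕ → Prop} {s : State}

@[simp] theorem wp_skip : WP W .skip Q s ↔ Q s 1 :=
  ⟨fun ⟨_, _, h, hq⟩ => by cases h; exact hq, fun h => ⟨_, _, .skip s, h⟩⟩

@[simp] theorem wp_setInt {x : ℕ} {e : IntExp} :
    WP W (.setInt x e) Q s ↔ Q (s.setIntVar x (e.eval W s)) (e.steps + 1) :=
  ⟨fun ⟨_, _, h, hq⟩ => by cases h; exact hq, fun h => ⟨_, _, .setInt x e s, h⟩⟩

@[simp] theorem wp_storeInt {a : ℕ} {i e : IntExp} :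
    WP W (.storeInt a i e) Q s ↔
      Q (s.setIntArr a (i.eval W s) (e.eval W s)) (i.steps + e.steps + 1) :=
  ⟨fun ⟨_, _, h, hq⟩ => by cases h; exact hq, fun h => ⟨_, _, .storeInt a i e s, h⟩⟩

@[simp] theorem wp_setReal {x : ℕ} {e : RealExp} :
    WP W (.setReal x e) Q s ↔ Q (s.setRealVar x (e.eval W s)) (e.steps + 1) :=
  ⟨fun ⟨_, _, h, hq⟩ => by cases h; exact hq, fun h => ⟨_, _, .setReal x e s, h⟩⟩

@[simp] theorem wp_storeReal {a : ℕ} {i : IntExp} {e : RealExp} :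
    WP W (.storeReal a i e) Q s ↔
      Q (s.setRealArr a (i.eval W s) (e.eval W s)) (i.steps + e.steps + 1) :=
  ⟨fun ⟨_, _, h, hq⟩ => by cases h; exact hq, fun h => ⟨_, _, .storeReal a i e s, h⟩⟩

@[simp] theorem wp_seq {p q : Cmd} : WP W (p ;; q) Q s ↔
    WP W p (fun s' t => WP W q (fun s'' t' => Q s'' (t + t')) s') s := by
  constructor
  · rintro ⟨_, _, h, hq⟩
    cases h with
    | seq h1 h2 => exact ⟨_, _, h1, _, _, h2, hq⟩
  · rintro ⟨_, _, h1, _, _, h2, hq⟩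
    exact ⟨_, _, .seq h1 h2, hq⟩

@[simp] theorem wp_cond {b : Test} {p q : Cmd} : WP W (.cond b p q) Q s ↔
    (b.Holds W s → WP W p (fun s' t => Q s' (b.steps + 1 + t)) s) ∧
    (¬ b.Holds W s → WP W q (fun s' t => Q s' (b.steps + 1 + t)) s) := by
  constructor
  · rintro ⟨_, _, h, hq⟩
    cases h with
    | condTrue hb h => exact ⟨fun _ => ⟨_, _, h, hq⟩, fun hn => absurd hb hn⟩
    | condFalse hb h => exact ⟨fun hn => absurd hn hb, fun _ => ⟨_, _, h, hq⟩⟩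
  · rintro ⟨h1, h2⟩
    by_cases hb : b.Holds W s
    · obtain ⟨_, _, h, hq⟩ := h1 hb
      exact ⟨_, _, .condTrue hb h, hq⟩
    · obtain ⟨_, _, h, hq⟩ := h2 hb
      exact ⟨_, _, .condFalse hb h, hq⟩

theorem WP.mono {p : Cmd} (h : WP W p Q s) (hQ : ∀ s' t, Q s' t → R s' t) : WP W p R s := by
  obtain ⟨s', t, hr, hq⟩ := h
  exact ⟨s', t, hr, hQ _ _ hq⟩

end Rules

/-! ### Frames -/

/-- The command may assign to the integer variable `x`. -/
def Cmd.wIntVar (x : ℕ) : Cmd → Bool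
  | .setInt y _ => x == y
  | .seq p q => p.wIntVar x || q.wIntVar x
  | .cond _ p q => p.wIntVar x || q.wIntVar x
  | .loop _ p => p.wIntVar x
  | _ => false

/-- The command may assign to cells of the integer array `x`. -/
def Cmd.wIntArr (x : ℕ) : Cmd → Bool
  | .storeInt y _ _ => x == y
  | .seq p q => p.wIntArr x || q.wIntArr x
  | .cond _ p q => p.wIntArr x || q.wIntArr x
  | .loop _ p => p.wIntArr x
  | _ => false

/-- The command may assign to the real variable `x`. -/
def Cmd.wRealVar (x : ℕ) : Cmd → Bool
  | .setReal y _ => x == y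
  | .seq p q => p.wRealVar x || q.wRealVar x
  | .cond _ p q => p.wRealVar x || q.wRealVar x
  | .loop _ p => p.wRealVar x
  | _ => false

/-- The command may assign to cells of the real array `x`. -/
def Cmd.wRealArr (x : ℕ) : Cmd → Bool
  | .storeReal y _ _ => x == y
  | .seq p q => p.wRealArr x || q.wRealArr x
  | .cond _ p q => p.wRealArr x || q.wRealArr x
  | .loop _ p => p.wRealArr x
  | _ => false

/-- `s'` agrees with `s` on everything that `p` does not assign to. -/
structure Frame (p : Cmd) (s s' : State) : Prop where
  iv : ∀ x, p.wIntVar x = false → s'.intVar x = s.intVar x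
  ia : ∀ x, p.wIntArr x = false → s'.intArr x = s.intArr x
  rv : ∀ x, p.wRealVar x = false → s'.realVar x = s.realVar x
  ra : ∀ x, p.wRealArr x = false → s'.realArr x = s.realArr x

theorem Frame.refl (p : Cmd) (s : State) : Frame p s s :=
  ⟨fun _ _ => rfl, fun _ _ => rfl, fun _ _ => rfl, fun _ _ => rfl⟩

theorem Frame.trans {p : Cmd} {s s' s'' : State} (h : Frame p s s') (h' : Frame p s' s'') :
    Frame p s s'' :=
  ⟨fun x hx => (h'.iv x hx).trans (h.iv x hx), fun x hx => (h'.ia x hx).trans (h.ia x hx),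
    fun x hx => (h'.rv x hx).trans (h.rv x hx), fun x hx => (h'.ra x hx).trans (h.ra x hx)⟩

theorem Frame.of_le {p q : Cmd} {s s' : State} (h : Frame p s s')
    (h1 : ∀ x, q.wIntVar x = false → p.wIntVar x = false)
    (h2 : ∀ x, q.wIntArr x = false → p.wIntArr x = false)
    (h3 : ∀ x, q.wRealVar x = false → p.wRealVar x = false)
    (h4 : ∀ x, q.wRealArr x = false → p.wRealArr x = false) : Frame q s s' :=
  ⟨fun x hx => h.iv x (h1 x hx), fun x hx => h.ia x (h2 x hx),
    fun x hx => h.rv x (h3 x hx), fun x hx => h.ra x (h4 x hx)⟩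

/-- Which cells may be written is computed from the program text alone. In the correctness proofs
below, `rfl` therefore shows that a part of the program leaves a variable or an array untouched. -/
theorem Run.frame {W : ℕ} {p : Cmd} {s s' : State} {t : ℕ} (h : Run W p s s' t) :
    Frame p s s' := by
  induction h with
  | skip => exact Frame.refl _ _
  | setInt x e s =>
    refine ⟨fun y hy => ?_, fun _ _ => rfl, fun _ _ => rfl, fun _ _ => rfl⟩
    simp_all [Cmd.wIntVar]
  | storeInt a i e s =>
    refine ⟨fun _ _ => rfl, fun y hy => ?_, fun _ _ => rfl, fun _ _ => rfl⟩
    simp_all [Cmd.wIntArr]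
  | setReal x e s =>
    refine ⟨fun _ _ => rfl, fun _ _ => rfl, fun y hy => ?_, fun _ _ => rfl⟩
    simp_all [Cmd.wRealVar]
  | storeReal a i e s =>
    refine ⟨fun _ _ => rfl, fun _ _ => rfl, fun _ _ => rfl, fun y hy => ?_⟩
    simp_all [Cmd.wRealArr]
  | seq _ _ h1 h2 =>
    refine (h1.of_le ?_ ?_ ?_ ?_).trans (h2.of_le ?_ ?_ ?_ ?_) <;>
      simp +contextual [Cmd.wIntVar, Cmd.wIntArr, Cmd.wRealVar, Cmd.wRealArr]
  | condTrue _ _ h =>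
    refine h.of_le ?_ ?_ ?_ ?_ <;>
      simp +contextual [Cmd.wIntVar, Cmd.wIntArr, Cmd.wRealVar, Cmd.wRealArr]
  | condFalse _ _ h =>
    refine h.of_le ?_ ?_ ?_ ?_ <;>
      simp +contextual [Cmd.wIntVar, Cmd.wIntArr, Cmd.wRealVar, Cmd.wRealArr]
  | loopTrue _ _ _ h1 h2 =>
    refine (h1.of_le ?_ ?_ ?_ ?_).trans h2 <;>
      simp +contextual [Cmd.wIntVar, Cmd.wIntArr, Cmd.wRealVar, Cmd.wRealArr]
  | loopFalse => exact Frame.refl _ _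

section Compose

variable {W : ℕ} {s : State}

theorem WP.frame {p : Cmd} {Q : State → ℕ → Prop} (h : WP W p Q s) :
    WP W p (fun s' t => Frame p s s' ∧ Q s' t) s := by
  obtain ⟨s', t, hr, hq⟩ := h
  exact ⟨s', t, hr, hr.frame, hq⟩

theorem Spec.mono {p : Cmd} {T T' : ℕ} {Q Q' : State → Prop} (h : Spec W p s T Q)
    (hT : T ≤ T') (hQ : ∀ s', Frame p s s' → Q s' → Q' s') : Spec W p s T' Q' := by
  obtain ⟨s', t, hr, ht, hq⟩ := h
  exact ⟨s', t, hr, ht.trans hT, hQ _ hr.frame hq⟩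

/-- Use the specification of a part of a program inside a `WP` goal. -/
theorem Spec.wp {p : Cmd} {T : ℕ} {Q : State → Prop} {R : State → ℕ → Prop} (h : Spec W p s T Q)
    (hQ : ∀ s' t, Frame p s s' → t ≤ T → Q s' → R s' t) : WP W p R s := by
  obtain ⟨s', t, hr, ht, hq⟩ := h
  exact ⟨s', t, hr, hQ _ _ hr.frame ht hq⟩

/-- The loop rule: `Φ` bounds the time that is left. -/
theorem Spec.loop {b : Test} {p : Cmd} (Inv : State → Prop) (Φ : State → ℕ)
    (h0 : Inv s)
    (h : ∀ s', Frame p s s' → Inv s' → b.Holds W s' →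
      WP W p (fun s'' t => Inv s'' ∧ t + b.steps + 1 + Φ s'' ≤ Φ s') s') :
    Spec W (.loop b p) s (Φ s + b.steps + 1) (fun s' => Inv s' ∧ ¬ b.Holds W s') := by
  -- Induction on a bound for the potential, which drops strictly because the test alone costs a
  -- step.
  have key : ∀ N s', Φ s' ≤ N → Frame p s s' → Inv s' →
      Spec W (.loop b p) s' (Φ s' + b.steps + 1) (fun s' => Inv s' ∧ ¬ b.Holds W s') := by
    intro N
    induction N with
    | zero =>
      intro s' hN hf hi
      by_cases hb : b.Holds W s'
      · obtain ⟨s'', t, hr, hi', ht⟩ := h s' hf hi hb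
        omega
      · exact ⟨s', _, .loopFalse hb, by omega, hi, hb⟩
    | succ N ih =>
      intro s' hN hf hi
      by_cases hb : b.Holds W s'
      · obtain ⟨s'', t, hr, hi', ht⟩ := h s' hf hi hb
        obtain ⟨s3, t', hr', ht', hq⟩ := ih s'' (by omega) (hf.trans hr.frame) hi'
        exact ⟨s3, _, .loopTrue hb hr hr', by omega, hq⟩
      · exact ⟨s', _, .loopFalse hb, by omega, hi, hb⟩
  exact key _ s le_rfl (Frame.refl _ _) h0

end Compose

attribute [simp] IntExp.eval RealExp.eval Test.Holds IntExp.steps RealExp.steps Test.steps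

end RealRAM

namespace RealRAM

/-! ## A segment tree for prefix sums with coloured minima -/

/-- `a₁` is a minimiser of `val` on `S` with value `m₁`, and `a₂` is a minimiser, with value `m₂`,
on the elements of `S` whose colour differs from that of `a₁`; `0` stands for "none". -/
structure Best (S : Set ℕ) (val : ℕ → ℝ) (col : ℕ → ℕ) (a₁ a₂ : ℕ) (m₁ m₂ : ℝ) : Prop where
  fst : a₁ ≠ 0 → a₁ ∈ S ∧ m₁ = val a₁
  snd : a₂ ≠ 0 → a₂ ∈ S ∧ m₂ = val a₂ ∧ a₁ ≠ 0 ∧ col a₂ ≠ col a₁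
  le_fst : ∀ x ∈ S, a₁ ≠ 0 ∧ m₁ ≤ val x
  le_snd : ∀ x ∈ S, col x ≠ col a₁ → a₂ ≠ 0 ∧ m₂ ≤ val x

/-- Candidates other than 0 are elements of `S`, so values and colours outside `S` play no role. -/
theorem Best.congr {S S' : Set ℕ} {val val' : ℕ → ℝ} {col col' : ℕ → ℕ} {a₁ a₂ : ℕ} {m₁ m₂ : ℝ}
    (h : Best S val col a₁ a₂ m₁ m₂) (hS : S' = S) (hv : ∀ x ∈ S, val' x = val x)
    (hc : ∀ x ∈ S, col' x = col x) : Best S' val' col' a₁ a₂ m₁ m₂ := by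
  subst hS
  refine ⟨fun h1 => ?_, fun h2 => ?_, fun x hx => ?_, fun x hx hcx => ?_⟩
  · rw [hv _ (h.fst h1).1]; exact h.fst h1
  · obtain ⟨h3, h4, h5, h6⟩ := h.snd h2
    rw [hv _ h3, hc _ h3, hc _ (h.fst h5).1]; exact h.snd h2
  · rw [hv _ hx]; exact h.le_fst x hx
  · rw [hv _ hx]
    rw [hc _ hx, hc _ (h.fst (h.le_fst x hx).1).1] at hcx
    exact h.le_snd x hx hcx

/-- Two candidates can stand for all of `S'`: the first is below every value on `S'`, and if it has
the colour of `a₁`, then the elements of `S'` of other colours are bounded below by the second. -/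
theorem Best.union {S S' : Set ℕ} {val : ℕ → ℝ} {col : ℕ → ℕ} {a₁ a₂ b₁ b₂ : ℕ}
    {m₁ m₂ k₁ k₂ : ℝ} (h' : Best S' val col b₁ b₂ k₁ k₂)
    (h : Best {x | (x ∈ S ∨ (x = b₁ ∧ b₁ ≠ 0)) ∨ (x = b₂ ∧ b₂ ≠ 0)} val col a₁ a₂ m₁ m₂) :
    Best {x | x ∈ S ∨ x ∈ S'} val col a₁ a₂ m₁ m₂ := by
  obtain ⟨f1, s1, lf1, ls1⟩ := h
  obtain ⟨f2, s2, lf2, ls2⟩ := h'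
  simp only [Set.mem_ofPred_eq] at f1 s1 lf1 ls1
  have e1 : ∀ x ∈ S', a₁ ≠ 0 ∧ m₁ ≤ val x := fun x hx => by
    have h1 := lf2 x hx
    have h2 := lf1 b₁ (Or.inl (Or.inr ⟨rfl, h1.1⟩))
    have h3 := f2 h1.1
    exact ⟨h2.1, by linarith [h2.2, h1.2]⟩
  refine ⟨fun h => ?_, fun h => ?_, fun x hx => ?_, fun x hx hc => ?_⟩
  · obtain ⟨h1, h2⟩ := f1 h
    refine ⟨?_, h2⟩
    rcases h1 with (h1 | ⟨rfl, h1⟩) | ⟨rfl, h1⟩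
    · exact Or.inl h1
    · exact Or.inr (f2 h1).1
    · exact Or.inr (s2 h1).1
  · obtain ⟨h1, h2⟩ := s1 h
    refine ⟨?_, h2⟩
    rcases h1 with (h1 | ⟨rfl, h1⟩) | ⟨rfl, h1⟩
    · exact Or.inl h1
    · exact Or.inr (f2 h1).1
    · exact Or.inr (s2 h1).1
  · rcases hx with hx | hx
    · exact lf1 x (Or.inl (Or.inl hx))
    · exact e1 x hx
  · rcases hx with hx | hx
    · exact ls1 x (Or.inl (Or.inl hx)) hc
    · have h1 := lf2 x hx
      have h3 := f2 h1.1
      by_cases hb : col b₁ = col a₁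
      · have h4 := ls2 x hx (by rw [hb]; exact hc)
        have h5 := s2 h4.1
        have h6 := ls1 b₂ (Or.inr ⟨rfl, h4.1⟩) (by rw [← hb]; exact h5.2.2.2)
        exact ⟨h6.1, by linarith [h6.2, h4.2, h5.2.1]⟩
      · have h6 := ls1 b₁ (Or.inl (Or.inr ⟨rfl, h1.1⟩)) hb
        exact ⟨h6.1, by linarith [h6.2, h1.2, h3.2]⟩

/-- Insert the candidate in integer variable 15 with value in real variable 12 into the best two
candidates in integer variables 13, 14 with values in real variables 10, 11. -/
def insertCand : Cmd :=
  .cond (.intEq (.var 15) (.lit 0)) .skip <|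
  .cond (.intEq (.var 13) (.lit 0)) (.setInt 13 (.var 15) ;; .setReal 10 (.var 12)) <|
  .cond (.intEq (.arr 22 (.var 15)) (.arr 22 (.var 13)))
    (.cond (.realLt (.var 12) (.var 10)) (.setInt 13 (.var 15) ;; .setReal 10 (.var 12)) .skip) <|
  .cond (.realLt (.var 12) (.var 10))
    (.setInt 14 (.var 13) ;; .setReal 11 (.var 10) ;; .setInt 13 (.var 15) ;; .setReal 10 (.var 12))
    (.cond (.or (.intEq (.var 14) (.lit 0)) (.realLt (.var 12) (.var 11)))
      (.setInt 14 (.var 15) ;; .setReal 11 (.var 12)) .skip)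

/-- A displaced first candidate becomes the second one only if the newcomer has a different colour;
being minimal on `S`, it is then minimal also among the elements that avoid the colour of the
newcomer. A newcomer of the same colour can only replace the first candidate and leaves the second
as it is. -/
theorem insertCand_spec {W : ℕ} (s : State) (S : Set ℕ) (val : ℕ → ℝ)
    (h : Best S val (s.intArr 22) (s.intVar 13) (s.intVar 14) (s.realVar 10) (s.realVar 11))
    (hc : s.intVar 15 ≠ 0 → s.realVar 12 = val (s.intVar 15)) :
    Spec W insertCand s 60 fun s' =>
      Best {x | x ∈ S ∨ (x = s.intVar 15 ∧ s.intVar 15 ≠ 0)} val (s.intArr 22)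
        (s'.intVar 13) (s'.intVar 14) (s'.realVar 10) (s'.realVar 11) := by
  generalize hcol : s.intArr 22 = col at *
  generalize h13 : s.intVar 13 = a₁ at *
  generalize h14 : s.intVar 14 = a₂ at *
  generalize h15 : s.intVar 15 = c at *
  generalize h10 : s.realVar 10 = m₁ at *
  generalize h11 : s.realVar 11 = m₂ at *
  generalize h12 : s.realVar 12 = cv at *
  obtain ⟨f1, s1, lf1, ls1⟩ := h
  simp only [Spec, insertCand, wp_cond, wp_skip, wp_seq, wp_setInt, wp_setReal, Test.Holds,
    IntExp.eval, RealExp.eval, IntExp.steps, RealExp.steps, Test.steps, setIntVar_intVar,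
    setIntVar_realVar, setRealVar_intVar, setRealVar_realVar,
    hcol, h13, h14, h15, h10, h11, h12, Nat.zero_mod, reduceIte, Nat.reduceEqDiff]
  refine ⟨fun h => ⟨by omega, ?_⟩, fun h1 => ⟨fun h2 => ⟨by omega, ?_⟩, fun h2 =>
    ⟨fun h3 => ⟨fun h4 => ⟨by omega, ?_⟩, fun h4 => ⟨by omega, ?_⟩⟩, fun h3 =>
    ⟨fun h4 => ⟨by omega, ?_⟩, fun h4 => ⟨fun h5 => ⟨by omega, ?_⟩, fun h5 => ⟨by omega, ?_⟩⟩⟩⟩⟩⟩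
  all_goals
    constructor <;> simp only [Set.mem_ofPred_eq] <;> grind

/-- Recompute node `i` (integer variable 10) from its children. -/
def recompute : Cmd :=
  .setInt 11 (.mul (.lit 2) (.var 10)) ;; .setInt 12 (.add (.var 11) (.lit 1)) ;;
  .storeReal 2 (.var 10) (.add (.arr 2 (.var 11)) (.arr 2 (.var 12))) ;;
  .setInt 13 (.arr 20 (.var 11)) ;; .setInt 14 (.arr 21 (.var 11)) ;;
  .setReal 10 (.arr 3 (.var 11)) ;; .setReal 11 (.arr 4 (.var 11)) ;;
  .setInt 15 (.arr 20 (.var 12)) ;;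
  .setReal 12 (.add (.arr 2 (.var 11)) (.arr 3 (.var 12))) ;;
  insertCand ;;
  .setInt 15 (.arr 21 (.var 12)) ;;
  .setReal 12 (.add (.arr 2 (.var 11)) (.arr 4 (.var 12))) ;;
  insertCand ;;
  .storeInt 20 (.var 10) (.var 13) ;; .storeInt 21 (.var 10) (.var 14) ;;
  .storeReal 3 (.var 10) (.var 10) ;; .storeReal 4 (.var 10) (.var 11)

/-- Recompute all proper ancestors of the node in integer variable 10. -/
def climb : Cmd :=
  .setInt 10 (.div (.var 10) (.lit 2)) ;;
  .loop (.intLt (.lit 0) (.var 10)) (recompute ;; .setInt 10 (.div (.var 10) (.lit 2)))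

/-- The data stored at node `i` describe the positions `p` with `lo ≤ p < hi`. -/
structure NodeOK (δ : ℕ → ℝ) (act : ℕ → Prop) (col : ℕ → ℕ) (s : State) (i lo hi : ℕ) : Prop where
  sum : s.realArr 2 i = ∑ p ∈ Finset.Ico lo hi, δ p
  best : Best {p | act p ∧ lo ≤ p ∧ p < hi} (fun p => ∑ q ∈ Finset.Ico lo (p + 1), δ q) col
    (s.intArr 20 i) (s.intArr 21 i) (s.realArr 3 i) (s.realArr 4 i)

theorem NodeOK.congr {δ δ' : ℕ → ℝ} {act act' : ℕ → Prop} {col col' : ℕ → ℕ} {s s' : State}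
    {i lo hi : ℕ} (h : NodeOK δ act col s i lo hi)
    (hδ : ∀ p, lo ≤ p → p < hi → δ' p = δ p) (ha : ∀ p, lo ≤ p → p < hi → (act' p ↔ act p))
    (hc : ∀ p, lo ≤ p → p < hi → col' p = col p)
    (h1 : s'.realArr 2 i = s.realArr 2 i) (h2 : s'.intArr 20 i = s.intArr 20 i)
    (h3 : s'.intArr 21 i = s.intArr 21 i) (h4 : s'.realArr 3 i = s.realArr 3 i)
    (h5 : s'.realArr 4 i = s.realArr 4 i) : NodeOK δ' act' col' s' i lo hi := by
  refine ⟨?_, ?_⟩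
  · rw [h1, h.sum]
    refine Finset.sum_congr rfl fun p hp => ?_
    rw [Finset.mem_Ico] at hp
    exact (hδ p hp.1 hp.2).symm
  · rw [h2, h3, h4, h5]
    refine h.best.congr ?_ (fun p hp => Finset.sum_congr rfl fun q hq => ?_)
      (fun p hp => hc p hp.2.1 hp.2.2)
    · ext p
      simp only [Set.mem_ofPred_eq]
      constructor
      · rintro ⟨a, b, c⟩; exact ⟨(ha p b c).1 a, b, c⟩
      · rintro ⟨a, b, c⟩; exact ⟨(ha p b c).2 a, b, c⟩
    · rw [Finset.mem_Ico] at hq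
      have := hp.2
      exact hδ q (by omega) (by omega)

/-- The right child measures its prefix sums from `mid`. Measured from `lo` they all increase by the
total of the left child, a shift that preserves the minimisers, so the shifted candidates of the
right child can be inserted into those of the left child. -/
theorem recompute_spec {W : ℕ} (s : State) (δ : ℕ → ℝ) (act : ℕ → Prop) (lo mid hi : ℕ)
    (hlm : lo ≤ mid) (hmh : mid ≤ hi) (hi0 : 0 < s.intVar 10) (hW : 2 * s.intVar 10 + 3 ≤ W)
    (hl : NodeOK δ act (s.intArr 22) s (2 * s.intVar 10) lo mid)
    (hr : NodeOK δ act (s.intArr 22) s (2 * s.intVar 10 + 1) mid hi) :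
    Spec W recompute s 200 fun s' =>
      NodeOK δ act (s.intArr 22) s' (s.intVar 10) lo hi ∧
      ∀ j, j ≠ s.intVar 10 → s'.realArr 2 j = s.realArr 2 j ∧ s'.intArr 20 j = s.intArr 20 j ∧
        s'.intArr 21 j = s.intArr 21 j ∧ s'.realArr 3 j = s.realArr 3 j ∧
        s'.realArr 4 j = s.realArr 4 j := by
  generalize hi' : s.intVar 10 = i at *
  have e1 : 2 % W * i % W = 2 * i := by
    rw [Nat.mod_eq_of_lt (by omega : 2 < W), Nat.mod_eq_of_lt (by omega)]
  have e2 : (2 * i + 1 % W) % W = 2 * i + 1 := by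
    rw [Nat.mod_eq_of_lt (by omega : 1 < W), Nat.mod_eq_of_lt (by omega)]
  have e3 : 2 * i ≠ i := by omega
  have e4 : 2 * i + 1 ≠ i := by omega
  have hval : ∀ p, mid ≤ p → ∑ q ∈ Finset.Ico lo (p + 1), δ q =
      s.realArr 2 (2 * i) + ∑ q ∈ Finset.Ico mid (p + 1), δ q := fun p hp => by
    rw [hl.sum, Finset.sum_Ico_consecutive _ hlm (by omega)]
  have hrb : Best {p | act p ∧ mid ≤ p ∧ p < hi} (fun p => ∑ q ∈ Finset.Ico lo (p + 1), δ q)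
      (s.intArr 22) (s.intArr 20 (2 * i + 1)) (s.intArr 21 (2 * i + 1))
      (s.realArr 2 (2 * i) + s.realArr 3 (2 * i + 1))
      (s.realArr 2 (2 * i) + s.realArr 4 (2 * i + 1)) := by
    obtain ⟨f1, s1, lf1, ls1⟩ := hr.best
    simp only [Set.mem_ofPred_eq] at f1 s1 lf1 ls1
    refine ⟨fun h => ?_, fun h => ?_, fun x hx => ?_, fun x hx hc => ?_⟩
    · have := f1 h
      exact ⟨this.1, by rw [hval _ this.1.2.1, this.2]⟩
    · have := s1 h
      exact ⟨this.1, by rw [hval _ this.1.2.1, this.2.1], this.2.2⟩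
    · have := lf1 x hx
      exact ⟨this.1, by rw [hval _ hx.2.1]; linarith [this.2]⟩
    · have := ls1 x hx hc
      exact ⟨this.1, by rw [hval _ hx.2.1]; linarith [this.2]⟩
  have hlb := hl.best
  simp only [Spec, recompute, wp_seq, wp_setInt, wp_setReal, wp_storeReal, wp_storeInt,
    IntExp.eval, RealExp.eval, setIntVar_intVar,
    setRealVar_intVar, setIntVar_intArr, setRealVar_intArr,
    setIntVar_realArr, setRealVar_realArr, setRealArr_intVar, setRealArr_intArr,
    setRealArr_realArr, setRealArr_realVar,
    hi', e1, e2, reduceIte, Nat.reduceEqDiff, Function.update_of_ne e3]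
  refine (insertCand_spec _ _ _ (by simpa using hlb) (by simpa using fun h => (hrb.fst h).2)).wp
    fun s1 t1 f1 ht1 hb1 => ?_
  have c1 := f1.ia 22 rfl
  have c2 := f1.ia 21 rfl
  have c3 := f1.ra 4 rfl
  have c4 := f1.ra 2 rfl
  have c5 := f1.iv 12 rfl
  have c6 := f1.iv 11 rfl
  have c7 := f1.iv 10 rfl
  have c8 := f1.ra 3 rfl
  have c9 := f1.ia 20 rfl
  simp at c1 c2 c3 c4 c5 c6 c7 c8 c9 hb1
  refine (insertCand_spec _ _ _ (by rw [setRealVar_intArr, setIntVar_intArr, c1]; simpa using hb1)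
    (by simpa [c2, c3, c4, c5, c6, Function.update_of_ne e3] using
      fun h => (hrb.snd h).2.1)).wp fun s2 t2 f2 ht2 hb2 => ?_
  have d1 := f2.ia 22 rfl
  have d2 := f2.ia 21 rfl
  have d3 := f2.ra 4 rfl
  have d4 := f2.ra 2 rfl
  have d7 := f2.iv 10 rfl
  have d8 := f2.ra 3 rfl
  have d9 := f2.ia 20 rfl
  simp [c1, c2, c3, c4, c5, c7, c8, c9] at d1 d2 d3 d4 d7 d8 d9 hb2
  have hb3 := hrb.union (S := {p | act p ∧ lo ≤ p ∧ p < mid}) (by simpa using hb2)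
  refine ⟨by simp; omega, ⟨?_, ?_⟩, fun j hj => ?_⟩
  · simp [d4, hl.sum, hr.sum, Finset.sum_Ico_consecutive _ hlm hmh]
  · simp only [setIntArr_intArr, setIntArr_intVar, setIntArr_realVar,
      setRealArr_intArr, setRealArr_realArr, setIntArr_realArr, reduceIte,
      Nat.reduceEqDiff, d7, hi', Function.update_self]
    refine hb3.congr ?_ (fun _ _ => rfl) (fun _ _ => rfl)
    ext p
    simp only [Set.mem_ofPred_eq]
    constructor
    · rintro ⟨a, b, c⟩
      by_cases hp : p < mid
      · exact Or.inl ⟨a, b, hp⟩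
      · exact Or.inr ⟨a, by omega, c⟩
    · rintro (⟨a, b, c⟩ | ⟨a, b, c⟩)
      · exact ⟨a, b, by omega⟩
      · exact ⟨a, by omega, c⟩
  · simp [Function.update_of_ne hj, d2, d3, d4, d7, d8, d9, hi']

end RealRAM

/-! ### Correctness of the segment tree, and its repair along the path from a leaf to the root. -/

namespace RealRAM

/-- Node `i` at height `h` of the segment tree with `2 ^ D` leaves is correct. -/
def SegAt (D : ℕ) (δ : ℕ → ℝ) (act : ℕ → Prop) (col : ℕ → ℕ) (s : State) (h i : ℕ) : Prop :=
  NodeOK δ act col s i (i * 2 ^ h - 2 ^ D) ((i + 1) * 2 ^ h - 2 ^ D)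

/-- Node number `i` is at height `h` of the segment tree with `2 ^ D` leaves. -/
def InTree (D h i : ℕ) : Prop := 2 ^ D ≤ i * 2 ^ h ∧ (i + 1) * 2 ^ h ≤ 2 ^ (D + 1)

/-- All nodes of the segment tree are correct. -/
def SegTree (D : ℕ) (δ : ℕ → ℝ) (act : ℕ → Prop) (col : ℕ → ℕ) (s : State) : Prop :=
  ∀ h i, InTree D h i → SegAt D δ act col s h i

/-- The numbers of the nodes at height `h` fill the interval from `2 ^ (D - h)` up to, but
excluding, `2 ^ (D - h + 1)`, and these intervals are disjoint. So a write to one cell of a node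
array concerns one node only. -/
theorem InTree.height_unique {D h h' i : ℕ} (a : InTree D h i) (b : InTree D h' i) : h = h' := by
  have key : ∀ h h', InTree D h i → InTree D h' i → ¬ h < h' := by
    intro h h' a b hlt
    have h1 : i * 2 ^ (h + 1) ≤ i * 2 ^ h' :=
      Nat.mul_le_mul_left _ (Nat.pow_le_pow_right (by norm_num) hlt)
    have h2 := a.1
    have h3 := b.2
    have h4 : 0 < 2 ^ h' := by positivity
    have h5 : (i + 1) * 2 ^ h' = i * 2 ^ h' + 2 ^ h' := by ring
    have h6 : i * 2 ^ (h + 1) = 2 * (i * 2 ^ h) := by ring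
    have h7 : 2 ^ (D + 1) = 2 * 2 ^ D := by ring
    omega
  have := key h h' a b
  have := key h' h b a
  omega

/-- Halving a node number leads to the parent, so this quotient is the ancestor at height `h` of the
leaf of `x`. Its positivity excludes heights above `D`. -/
theorem inTree_ancestor {D h x : ℕ} (hx : x < 2 ^ D) (hpos : 0 < (2 ^ D + x) / 2 ^ h) :
    InTree D h ((2 ^ D + x) / 2 ^ h) := by
  have h1 : 0 < 2 ^ h := by positivity
  have h2 : 2 ^ h ≤ 2 ^ D + x := (Nat.div_pos_iff.1 hpos).2
  have h3 : h ≤ D := by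
    by_contra hc
    have : 2 ^ (D + 1) ≤ 2 ^ h := Nat.pow_le_pow_right (by norm_num) (by omega)
    have h7 : 2 ^ (D + 1) = 2 * 2 ^ D := by ring
    omega
  obtain ⟨k, rfl⟩ := Nat.exists_eq_add_of_le h3
  have e1 : 2 ^ (h + k) = 2 ^ k * 2 ^ h := by ring
  have e2 : 2 ^ (h + k + 1) = 2 * 2 ^ k * 2 ^ h := by ring
  refine ⟨?_, ?_⟩
  · rw [e1]
    refine Nat.mul_le_mul_right _ ?_
    rw [Nat.le_div_iff_mul_le h1]
    omega
  · rw [e2]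
    refine Nat.mul_le_mul_right _ ?_
    rw [Nat.add_one_le_iff, Nat.div_lt_iff_lt_mul h1]
    have : 2 * 2 ^ k * 2 ^ h = 2 * (2 ^ k * 2 ^ h) := by ring
    omega

theorem InTree.lt {D h i : ℕ} (a : InTree D h i) : 0 < i ∧ i < 2 ^ (D + 1) := by
  obtain ⟨a1, a2⟩ := a
  have h1 : 0 < 2 ^ h := by positivity
  have h2 : 0 < 2 ^ D := by positivity
  constructor
  · rcases Nat.eq_zero_or_pos i with rfl | h
    · omega
    · exact h
  · nlinarith

/-- A change at position `x` spoils only the proper ancestors of its leaf. On the way up all nodes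
are correct except possibly the ancestors at height `k` and above, so both children of the next node
are correct when it is recomputed. -/
theorem climb_spec {W : ℕ} (s : State) (D : ℕ) (δ : ℕ → ℝ) (act : ℕ → Prop) (x : ℕ)
    (hx : x < 2 ^ D) (hv : s.intVar 10 = 2 ^ D + x) (hW : 4 * 2 ^ D + 3 ≤ W)
    (h : ∀ h i, InTree D h i → (i = (2 ^ D + x) / 2 ^ h → h = 0) →
      SegAt D δ act (s.intArr 22) s h i) :
    Spec W climb s (300 * (D + 1)) (SegTree D δ act (s.intArr 22)) := by
  have h2W : 2 % W = 2 := by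
    rw [Nat.mod_eq_of_lt]; have : 0 < 2 ^ D := by positivity
    omega
  have hD2 : 2 ^ (D + 1) = 2 * 2 ^ D := by ring
  generalize hcol : s.intArr 22 = col at *
  simp only [Spec, climb, wp_seq, wp_setInt, IntExp.eval, h2W, hv]
  refine (Spec.loop (Inv := fun s' => s'.intArr 22 = col ∧ ∃ k, 1 ≤ k ∧
      s'.intVar 10 = (2 ^ D + x) / 2 ^ k ∧
      ∀ h i, InTree D h i → (i = (2 ^ D + x) / 2 ^ h → h < k) → SegAt D δ act col s' h i)
    -- The factor 2 inside the logarithm makes the root count as one remaining iteration and the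
    -- final value 0 as none.
    (Φ := fun s' => 220 * Nat.log 2 (2 * s'.intVar 10)) ?_ ?_).wp ?_
  · refine ⟨by simpa using hcol, 1, le_rfl, by simp, fun h' i hi hh => ?_⟩
    exact (h h' i hi (fun he => by have := hh he; omega)).congr (fun _ _ _ => rfl)
      (fun _ _ _ => Iff.rfl) (fun _ _ _ => rfl) rfl rfl rfl rfl rfl
  · rintro s1 - ⟨hc1, k, hk, hvk, hok⟩ hb
    obtain ⟨k, rfl⟩ : ∃ j, k = j + 1 := ⟨k - 1, by omega⟩
    simp only [Test.Holds, IntExp.eval, Nat.zero_mod] at hb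
    rw [hvk] at hb
    have hin := inTree_ancestor hx hb
    have hlt := hin.lt
    generalize hj : (2 ^ D + x) / 2 ^ (k + 1) = j at *
    have i1 : InTree D k (2 * j) := by
      refine ⟨?_, ?_⟩
      · have := hin.1; rw [pow_succ] at this; linarith
      · have := hin.2; rw [pow_succ 2 k] at this; have : 0 < 2 ^ k := by positivity
        nlinarith
    have i2 : InTree D k (2 * j + 1) := by
      refine ⟨?_, ?_⟩
      · have := hin.1; rw [pow_succ] at this; nlinarith
      · have := hin.2; rw [pow_succ 2 k] at this; linarith
    have hkp : 0 < 2 ^ k := by positivity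
    rw [wp_seq]
    refine (recompute_spec s1 δ act (j * 2 ^ (k + 1) - 2 ^ D) ((2 * j + 1) * 2 ^ k - 2 ^ D)
      ((j + 1) * 2 ^ (k + 1) - 2 ^ D) (Nat.sub_le_sub_right (by rw [pow_succ]; nlinarith) _)
      (Nat.sub_le_sub_right (by rw [pow_succ]; nlinarith) _) (by omega) (by omega) ?_ ?_).wp
      fun s2 t2 f2 ht2 h2 => ?_
    · rw [hc1, hvk]
      have := hok k (2 * j) i1 (by omega)
      unfold SegAt at this
      rwa [show 2 * j * 2 ^ k = j * 2 ^ (k + 1) by ring] at this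
    · rw [hc1, hvk]
      have := hok k (2 * j + 1) i2 (by omega)
      unfold SegAt at this
      rwa [show (2 * j + 1 + 1) * 2 ^ k = (j + 1) * 2 ^ (k + 1) by ring] at this
    · have e10 := f2.iv 10 rfl
      have e22 := f2.ia 22 rfl
      rw [hvk] at e10 h2
      rw [hc1] at e22 h2
      simp only [wp_setInt, IntExp.eval, h2W, setIntVar_intArr, setIntVar_intVar, reduceIte, e10,
        IntExp.steps, Test.steps]
      refine ⟨⟨e22, k + 2, by omega, ?_, fun h' i hi hh => ?_⟩, ?_⟩
      · rw [← hj, Nat.div_div_eq_div_mul, ← pow_succ]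
      · by_cases hij : i = j
        · subst hij
          obtain rfl := hin.height_unique hi
          exact h2.1.congr (fun _ _ _ => rfl) (fun _ _ _ => Iff.rfl) (fun _ _ _ => rfl)
            rfl rfl rfl rfl rfl
        · obtain ⟨a1, a2, a3, a4, a5⟩ := h2.2 i hij
          refine (hok h' i hi fun he => ?_).congr (fun _ _ _ => rfl) (fun _ _ _ => Iff.rfl)
            (fun _ _ _ => rfl) a1 a2 a3 a4 a5
          have := hh he
          by_contra hcon
          obtain rfl : h' = k + 1 := by omega
          exact hij (he.trans hj)
      · rw [hvk]
        have l1 : Nat.log 2 (2 * j) = Nat.log 2 j + 1 := by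
          rw [mul_comm, Nat.log_mul_base (by norm_num) (by omega)]
        have l2 : Nat.log 2 (2 * (j / 2)) ≤ Nat.log 2 j := Nat.log_mono_right (by omega)
        omega
  · rintro s2 t2 - ht2 ⟨⟨hc2, k, hk, hvk, hok⟩, hb⟩
    simp only [Test.Holds, IntExp.eval, Nat.zero_mod] at hb
    refine ⟨?_, fun h' i hi => hok h' i hi fun he => ?_⟩
    · simp only [setIntVar_intVar, reduceIte] at ht2
      have : Nat.log 2 (2 * ((2 ^ D + x) / 2)) ≤ D := by
        rcases Nat.eq_zero_or_pos ((2 ^ D + x) / 2) with h0 | h0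
        · simp [h0]
        · have : Nat.log 2 (2 * ((2 ^ D + x) / 2)) < D + 1 :=
            Nat.log_lt_of_lt_pow (by omega) (by omega)
          omega
      simp only [Test.steps, IntExp.steps] at ht2 ⊢
      omega
    · by_contra hcon
      have : (2 ^ D + x) / 2 ^ h' ≤ (2 ^ D + x) / 2 ^ k :=
        Nat.div_le_div_left (Nat.pow_le_pow_right (by norm_num) (by omega)) (by positivity)
      have := hi.lt
      omega

end RealRAM

namespace RealRAM

/-! ## Linked lists -/

/-- Following `nxt` from `h` until `0` is reached runs through `l`. -/
def Linked (nxt : ℕ → ℕ) : ℕ → List ℕ → Prop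
  | h, [] => h = 0
  | h, a :: l => h = a ∧ a ≠ 0 ∧ Linked nxt (nxt a) l

theorem Linked.update {nxt : ℕ → ℕ} {q v : ℕ} : ∀ {l : List ℕ} {h : ℕ}, Linked nxt h l → q ∉ l →
    Linked (Function.update nxt q v) h l
  | [], _, hl, _ => hl
  | a :: l, _, ⟨h1, h2, h3⟩, hq => by
    simp only [List.mem_cons, not_or] at hq
    refine ⟨h1, h2, ?_⟩
    rw [Function.update_of_ne (Ne.symm hq.1)]
    exact h3.update hq.2

theorem Linked.push {nxt : ℕ → ℕ} {q h : ℕ} {l : List ℕ} (hl : Linked nxt h l) (hq : q ∉ l)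
    (h0 : q ≠ 0) : Linked (Function.update nxt q h) q (q :: l) :=
  ⟨rfl, h0, by rw [Function.update_self]; exact hl.update hq⟩

theorem Linked.nil_of_zero {nxt : ℕ → ℕ} {l : List ℕ} (hl : Linked nxt 0 l) : l = [] := by
  cases l with
  | nil => rfl
  | cons a l => exact absurd hl.1.symm hl.2.1

theorem Linked.cons_of_ne {nxt : ℕ → ℕ} {h : ℕ} {l : List ℕ} (hl : Linked nxt h l) (h0 : h ≠ 0) :
    ∃ l', l = h :: l' ∧ Linked nxt (nxt h) l' := by
  cases l with
  | nil => exact absurd hl h0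
  | cons a l => obtain ⟨rfl, _, h3⟩ := hl; exact ⟨l, rfl, h3⟩

/-! ## Colour classes -/

/-- On at most one element there is no second candidate and no comparison of colours. A leaf thus
stays correct when its position is recoloured, and only its ancestors need repair. -/
theorem Best.recolour {S : Set ℕ} {val : ℕ → ℝ} {col col' : ℕ → ℕ} {a₁ a₂ : ℕ} {m₁ m₂ : ℝ}
    (h : Best S val col a₁ a₂ m₁ m₂) (hS : ∀ p q, p ∈ S → q ∈ S → p = q) :
    Best S val col' a₁ a₂ m₁ m₂ := by
  refine ⟨h.fst, fun h2 => ?_, h.le_fst, fun x hx hc => ?_⟩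
  · have h3 := h.snd h2
    rw [hS _ _ h3.1 (h.fst h3.2.2.1).1] at h3
    exact absurd rfl h3.2.2.2
  · rw [hS _ _ hx (h.fst (h.le_fst x hx).1).1] at hc
    exact absurd rfl hc

/-- At each height a single node covers `x`, namely the ancestor of its leaf. All other nodes are
therefore unaffected by a change at `x`. -/
theorem InTree.ne_of_mem {D h i x p : ℕ} (hi : InTree D h i) (hx : i ≠ (2 ^ D + x) / 2 ^ h)
    (h1 : i * 2 ^ h - 2 ^ D ≤ p) (h2 : p < (i + 1) * 2 ^ h - 2 ^ D) : p ≠ x := by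
  rintro rfl
  refine hx ?_
  symm
  rw [Nat.div_eq_iff (by positivity)]
  have := hi.1
  have e : (i + 1) * 2 ^ h = i * 2 ^ h + 2 ^ h := by ring
  omega

/-- The number of positions of colour `c`. -/
def classSize (n : ℕ) (col : ℕ → ℕ) (c : ℕ) : ℕ := {p ∈ Finset.Ico 1 n | col p = c}.card

/-- The potential that pays for relabelling the smaller of two classes. -/
def colourPot (n : ℕ) (col : ℕ → ℕ) : ℕ :=
  ∑ p ∈ Finset.Ico 1 n, (Nat.log 2 n - Nat.log 2 (classSize n col (col p)))

/-- The colouring after the class `a` has been merged into the class `b`. -/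
def mergeCol (col : ℕ → ℕ) (a b : ℕ) (p : ℕ) : ℕ := if col p = a then b else col p

theorem classSize_le (n : ℕ) (col : ℕ → ℕ) (c : ℕ) : classSize n col c ≤ n := by
  refine (Finset.card_filter_le _ _).trans ?_
  simp

theorem colourPot_le (n : ℕ) (col : ℕ → ℕ) : colourPot n col ≤ n * Nat.log 2 n := by
  refine (Finset.sum_le_card_nsmul _ _ (Nat.log 2 n) fun p _ => by omega).trans ?_
  simp only [Nat.card_Ico, smul_eq_mul]
  exact Nat.mul_le_mul_right _ (by omega)

theorem classSize_mergeCol {n : ℕ} {col : ℕ → ℕ} {a b : ℕ} (hab : a ≠ b) :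
    classSize n (mergeCol col a b) b = classSize n col a + classSize n col b := by
  unfold classSize mergeCol
  rw [← Finset.card_union_of_disjoint]
  · congr 1
    ext p
    simp only [Finset.mem_filter, Finset.mem_union]
    split_ifs with h
    · simp [h, hab]
    · simp [h]
  · rw [Finset.disjoint_filter]
    intro p _ h1 h2
    exact hab (h1.symm.trans h2)

/-- Each member of the smaller class `a` ends in a class at least twice as large, so its logarithm
rises by at least one. No other position sees its class shrink. -/
theorem colourPot_mergeCol {n : ℕ} {col : ℕ → ℕ} {a b : ℕ} (hab : a ≠ b)
    (hle : classSize n col a ≤ classSize n col b) :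
    colourPot n (mergeCol col a b) + classSize n col a ≤ colourPot n col := by
  have e : classSize n col a = ∑ p ∈ Finset.Ico 1 n, if col p = a then 1 else 0 := by
    rw [classSize, Finset.card_filter]
  rw [e, colourPot, colourPot, ← Finset.sum_add_distrib]
  refine Finset.sum_le_sum fun p hp => ?_
  have hs := classSize_mergeCol (n := n) (col := col) hab
  by_cases h1 : col p = a
  · have e1 : mergeCol col a b p = b := by simp [mergeCol, h1]
    rw [e1, hs, h1, if_pos rfl]
    have hpos : classSize n col a ≠ 0 := by
      rw [classSize, Finset.card_ne_zero]
      exact ⟨p, by simp [h1, Finset.mem_Ico.1 hp]⟩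
    have h2 : Nat.log 2 (classSize n col a) + 1 ≤
        Nat.log 2 (classSize n col a + classSize n col b) := by
      rw [← Nat.log_mul_base (by norm_num) hpos]
      exact Nat.log_mono_right (by omega)
    have h3 : Nat.log 2 (classSize n col a + classSize n col b) ≤ Nat.log 2 n := by
      rw [← hs]; exact Nat.log_mono_right (classSize_le _ _ _)
    omega
  · have e1 : mergeCol col a b p = col p := by simp [mergeCol, h1]
    rw [e1, if_neg h1, add_zero]
    refine Nat.sub_le_sub_left (Nat.log_mono_right (Finset.card_le_card fun q hq => ?_)) _
    simp only [Finset.mem_filter] at hq ⊢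
    refine ⟨hq.1, ?_⟩
    unfold mergeCol
    split_ifs with h2
    · exact absurd (hq.2.symm.trans h2) h1
    · exact hq.2

/-- The colour classes of `col` are stored as linked lists with heads in array 23, links in array
24 and lengths in array 25. -/
structure Classes (n : ℕ) (col : ℕ → ℕ) (s : State) : Prop where
  arr : s.intArr 22 = col
  supp : ∀ p, (1 ≤ p ∧ p < n ∧ 1 ≤ col p ∧ col p < n) ∨ ((p = 0 ∨ n ≤ p) ∧ col p = 0)
  list : ∀ c, 1 ≤ c → c < n → ∃ l : List ℕ, Linked (s.intArr 24) (s.intArr 23 c) l ∧ l.Nodup ∧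
    ∀ p, p ∈ l ↔ col p = c
  size : ∀ c, 1 ≤ c → c < n → s.intArr 25 c = classSize n col c

/-- Merge the class in integer variable 23 into the class in integer variable 24. -/
def relabel : Cmd :=
  .loop (.not (.intEq (.arr 23 (.var 23)) (.lit 0)))
   (.setInt 25 (.arr 23 (.var 23)) ;;
    .storeInt 23 (.var 23) (.arr 24 (.var 25)) ;;
    .storeInt 24 (.var 25) (.arr 23 (.var 24)) ;;
    .storeInt 23 (.var 24) (.var 25) ;;
    .storeInt 22 (.var 25) (.var 24) ;;
    .storeInt 25 (.var 23) (.sub (.arr 25 (.var 23)) (.lit 1)) ;;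
    .storeInt 25 (.var 24) (.add (.arr 25 (.var 24)) (.lit 1)) ;;
    .setInt 10 (.add (.var 2) (.var 25)) ;; climb)

/-- Positions move one at a time from the list of `a` to that of `b`, and the tree is repaired after
every move, so lists and tree always fit a common intermediate colouring. It differs from `col` only
by having sent part of the class `a` to `b`; once the list of `a` is empty, it is the merged
colouring. -/
theorem relabel_spec {W : ℕ} (s : State) (n D : ℕ) (δ : ℕ → ℝ) (act : ℕ → Prop) (col : ℕ → ℕ)
    (a b : ℕ) (hD : n < 2 ^ D) (hW : 4 * 2 ^ D + 3 ≤ W) (hN : s.intVar 2 = 2 ^ D)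
    (ha : s.intVar 23 = a) (hb : s.intVar 24 = b) (ha1 : 1 ≤ a) (han : a < n) (hb1 : 1 ≤ b)
    (hbn : b < n) (hab : a ≠ b) (hc : Classes n col s) (hT : SegTree D δ act col s) :
    Spec W relabel s (400 * (D + 1) * classSize n col a + 10) fun s' =>
      Classes n (mergeCol col a b) s' ∧ SegTree D δ act (mergeCol col a b) s' := by
  refine (Spec.loop (Inv := fun s' => ∃ col', Classes n col' s' ∧ SegTree D δ act col' s' ∧
      ∀ p, col' p = col p ∨ (col p = a ∧ col' p = b))
    (Φ := fun s' => 400 * (D + 1) * s'.intArr 25 a) ?_ ?_).mono ?_ ?_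
  · exact ⟨col, hc, hT, fun p => Or.inl rfl⟩
  · rintro s1 f1 ⟨col', hc', hT', hcol⟩ hx
    have e23 := (f1.iv 23 rfl).trans ha
    have e24 := (f1.iv 24 rfl).trans hb
    have e2 := (f1.iv 2 rfl).trans hN
    simp only [Test.Holds, IntExp.eval, e23, Nat.zero_mod] at hx
    obtain ⟨la, ll, lnd, lm⟩ := hc'.list a ha1 han
    obtain ⟨la', rfl, ll'⟩ := ll.cons_of_ne hx
    obtain ⟨lb, lbl, lbnd, lbm⟩ := hc'.list b hb1 hbn
    generalize hxx : s1.intArr 23 a = x at *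
    have hxa : col' x = a := (lm x).1 (by simp)
    have hxn : 1 ≤ x ∧ x < n := by
      rcases hc'.supp x with h | h
      · exact ⟨h.1, h.2.1⟩
      · omega
    have hsz : classSize n (Function.update col' x b) a + 1 = classSize n col' a ∧
        classSize n (Function.update col' x b) b = classSize n col' b + 1 := by
      unfold classSize
      constructor
      · rw [← Finset.card_erase_add_one (a := x) (s := {p ∈ Finset.Ico 1 n | col' p = a})
          (by simp [hxn, hxa])]
        congr 2
        ext p
        by_cases hp : p = x
        · subst hp; simp [hab.symm]
        · simp [hp]
      · rw [← Finset.card_insert_of_notMem (a := x) (s := {p ∈ Finset.Ico 1 n | col' p = b})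
          (by simp [hxa, hab])]
        congr 1
        ext p
        by_cases hp : p = x
        · subst hp; simp [hxn]
        · simp [hp]
    have hxlb : x ∉ lb := fun h => hab (hxa.symm.trans ((lbm x).1 h))
    have hxla : x ∉ la' := (List.nodup_cons.1 lnd).1
    have hsa := hc'.size a ha1 han
    have hsb := hc'.size b hb1 hbn
    have hbs := classSize_le n (Function.update col' x b) b
    have m1 : 1 % W = 1 := Nat.mod_eq_of_lt (by omega)
    have m2 : (s1.intArr 25 b + 1) % W = s1.intArr 25 b + 1 := Nat.mod_eq_of_lt (by omega)
    have m3 : (2 ^ D + x) % W = 2 ^ D + x := Nat.mod_eq_of_lt (by omega)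
    simp only [wp_seq, wp_setInt, wp_storeInt, IntExp.eval, setIntVar_intVar, setIntVar_intArr,
      setIntArr_intVar, setIntArr_intArr, e23, e24, e2, reduceIte, Nat.reduceEqDiff, hxx, m1,
      Function.update_of_ne hab.symm, m2, m3]
    refine (climb_spec _ D δ act x (by omega) (by simp) hW ?_).wp fun s2 t2 f2 ht2 hT2 => ?_
    · intro h i hi hh
      simp only [setIntVar_intArr, setIntArr_intArr, Nat.reduceEqDiff, reduceIte, hc'.arr]
      by_cases hix : i = (2 ^ D + x) / 2 ^ h
      · have hT1 := hT' h i hi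
        obtain rfl := hh hix
        rw [pow_zero, Nat.div_one] at hix
        subst hix
        refine ⟨hT1.sum, hT1.best.recolour fun p q hp hq => ?_⟩
        have h1 := hp.2
        have h2 := hq.2
        simp only [pow_zero, mul_one] at h1 h2
        omega
      · refine (hT' h i hi).congr (fun _ _ _ => rfl) (fun _ _ _ => Iff.rfl) (fun p hp1 hp2 => ?_)
          rfl rfl rfl rfl rfl
        exact Function.update_of_ne (hi.ne_of_mem hix hp1 hp2) _ _
    · have g22 := f2.ia 22 rfl
      have g23 := f2.ia 23 rfl
      have g24 := f2.ia 24 rfl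
      have g25 := f2.ia 25 rfl
      simp [hc'.arr] at g22 g23 g24 g25 hT2
      refine ⟨⟨Function.update col' x b, ⟨g22, fun p => ?_, fun c hc1 hcn => ?_,
        fun c hc1 hcn => ?_⟩, hT2, fun p => ?_⟩, ?_⟩
      · by_cases hp : p = x
        · subst hp; simp; omega
        · simp [hp]; exact hc'.supp p
      · rw [g23, g24]
        by_cases hca : c = a
        · subst hca
          refine ⟨la', ?_, (List.nodup_cons.1 lnd).2, fun p => ?_⟩
          · simp [Function.update_of_ne hab]
            exact ll'.update hxla
          · by_cases hp : p = x
            · subst hp; simp [hxla, hab.symm]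
            · have := lm p
              simp [hp] at this ⊢
              exact this
        · by_cases hcb : c = b
          · subst hcb
            refine ⟨x :: lb, ?_, List.nodup_cons.2 ⟨hxlb, lbnd⟩, fun p => ?_⟩
            · simp
              exact lbl.push hxlb (by omega)
            · by_cases hp : p = x
              · subst hp; simp
              · simp [hp]; exact lbm p
          · obtain ⟨l, h1, h2, h3⟩ := hc'.list c hc1 hcn
            refine ⟨l, ?_, h2, fun p => ?_⟩
            · simp [Function.update_of_ne hcb, Function.update_of_ne hca]
              exact h1.update fun h => hca (((h3 x).1 h).symm.trans hxa)
            · by_cases hp : p = x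
              · subst hp
                simp [Ne.symm hcb]
                intro h
                exact hca (((h3 p).1 h).symm.trans hxa)
              · simp [hp]; exact h3 p
      · rw [g25]
        by_cases hca : c = a
        · subst hca
          rw [Function.update_of_ne hab, Function.update_self]
          omega
        · by_cases hcb : c = b
          · subst hcb
            rw [Function.update_self]
            omega
          · rw [Function.update_of_ne hcb, Function.update_of_ne hca, hc'.size c hc1 hcn]
            unfold classSize
            congr 1
            ext p
            by_cases hp : p = x
            · subst hp
              simp [Ne.symm hcb, hxa, Ne.symm hca]
            · simp [hp]
      · by_cases hp : p = x
        · subst hp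
          right
          simp
          rcases hcol p with h | h
          · rw [← h, hxa]
          · exact h.1
        · simp [hp]; exact hcol p
      · rw [g25, Function.update_of_ne hab, Function.update_self]
        obtain ⟨k, hk⟩ : ∃ k, s1.intArr 25 a = k + 1 := ⟨s1.intArr 25 a - 1, by omega⟩
        have hk2 : 400 * (D + 1) * (k + 1) = 400 * (D + 1) * k + 400 * (D + 1) := by ring
        rw [hk, Nat.add_sub_cancel, hk2]
        generalize 400 * (D + 1) * k = z
        simp only [IntExp.steps, Test.steps]
        omega
  · rw [hc.size a ha1 han]
    simp [IntExp.steps, Test.steps]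
  · rintro s1 f1 ⟨⟨col', hc', hT', hcol⟩, hx⟩
    have e23 := (f1.iv 23 rfl).trans ha
    simp only [Test.Holds, IntExp.eval, e23, Nat.zero_mod, not_not] at hx
    obtain ⟨l, h1, h2, h3⟩ := hc'.list a ha1 han
    rw [hx] at h1
    obtain rfl := h1.nil_of_zero
    have : col' = mergeCol col a b := by
      ext p
      unfold mergeCol
      have := h3 p
      simp at this
      rcases hcol p with h | h
      · rw [← h, if_neg this]
      · rw [if_pos h.1, h.2]
    rw [← this]
    exact ⟨hc', hT'⟩

end RealRAM

/-! ### Loops with a time budget, growth of forests, and the update of one row. -/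

namespace RealRAM

/-- The loop rule with an invariant `Inv s N` in which `N` bounds the time that is left. -/
theorem WP.loop {W : ℕ} {s : State} {b : Test} {p : Cmd} (Inv : State → ℕ → Prop) (N : ℕ)
    (h0 : Inv s N)
    (h : ∀ s' N, Frame p s s' → Inv s' N → b.Holds W s' →
      WP W p (fun s'' t => ∃ N', Inv s'' N' ∧ t + b.steps + 1 + N' ≤ N) s') :
    WP W (.loop b p) (fun s' t => ∃ N', Inv s' N' ∧ t + N' ≤ N + b.steps + 1 ∧ ¬ b.Holds W s') s := by
  have key : ∀ N s', Frame p s s' → Inv s' N → WP W (.loop b p)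
      (fun s' t => ∃ N', Inv s' N' ∧ t + N' ≤ N + b.steps + 1 ∧ ¬ b.Holds W s') s' := by
    intro N
    induction N using Nat.strong_induction_on with
    | _ N ih =>
      intro s' hf hi
      by_cases hb : b.Holds W s'
      · obtain ⟨s'', t, hr, N', hi', ht⟩ := h s' N hf hi hb
        obtain ⟨s3, t', hr', N'', hi'', ht', hq⟩ := ih N' (by omega) s'' (hf.trans hr.frame) hi'
        exact ⟨s3, _, .loopTrue hb hr hr', N'', hi'', by omega, hq⟩
      · exact ⟨s', _, .loopFalse hb, N, hi, by omega, hb⟩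
  exact key N s (Frame.refl _ _) h0

/-! ## Spanning forests that grow by single edges -/

/-- The graph on `ℕ` whose edges are listed in `po`. -/
def listGraph (po : List (Sym2 ℕ)) : SimpleGraph ℕ := SimpleGraph.fromEdgeSet {z | z ∈ po}

/-- `po` lists the edges of a forest on the positions `1, …, n - 1`, the edges are pairs that
satisfy `P`, and its components are the classes of `col`. -/
structure Forest (n : ℕ) (P : ℕ → ℕ → Prop) (po : List (Sym2 ℕ)) (col : ℕ → ℕ) : Prop where
  nodup : po.Nodup
  mem : ∀ z ∈ po, ∃ a b, z = s(a, b) ∧ 1 ≤ a ∧ a < n ∧ 1 ≤ b ∧ b < n ∧ a ≠ b ∧ P a b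
  acyclic : (listGraph po).IsAcyclic
  sound : ∀ p q, (listGraph po).Reachable p q → col p = col q
  complete : ∀ p q, 1 ≤ p → p < n → 1 ≤ q → q < n → col p = col q → (listGraph po).Reachable p q

theorem listGraph_append (po : List (Sym2 ℕ)) (a b : ℕ) :
    listGraph (po ++ [s(a, b)]) = listGraph po ⊔ SimpleGraph.edge a b := by
  unfold listGraph SimpleGraph.edge
  rw [← SimpleGraph.fromEdgeSet_union]
  congr 1
  ext z
  simp [or_comm]

/-- Different colours mean, by soundness, that the endpoints are not yet connected, so the new edge
closes no cycle and is not listed already. Either of the two classes may absorb the other, because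
the sizes decide this at run time. -/
theorem Forest.add {n : ℕ} {P : ℕ → ℕ → Prop} {po : List (Sym2 ℕ)} {col : ℕ → ℕ}
    (h : Forest n P po col) {a b x y : ℕ} (ha1 : 1 ≤ a) (han : a < n) (hb1 : 1 ≤ b) (hbn : b < n)
    (hP : P a b) (hab : col a ≠ col b)
    (hxy : (x = col a ∧ y = col b) ∨ (x = col b ∧ y = col a)) :
    Forest n P (po ++ [s(a, b)]) (mergeCol col x y) := by
  have hne : a ≠ b := fun h => hab (by rw [h])
  have hnr : ¬ (listGraph po).Reachable a b := fun hr => hab (h.sound _ _ hr)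
  have hadj : (listGraph (po ++ [s(a, b)])).Adj a b := by
    simp [listGraph, hne]
  have hle : listGraph po ≤ listGraph (po ++ [s(a, b)]) := by
    rw [listGraph_append]; exact le_sup_left
  refine ⟨?_, fun z hz => ?_, ?_, fun p q hr => ?_, fun p q hp1 hpn hq1 hqn hc => ?_⟩
  · rw [List.nodup_append]
    refine ⟨h.nodup, List.nodup_singleton _, ?_⟩
    rintro z hz w hw rfl
    rw [List.mem_singleton] at hw
    subst hw
    refine hnr (SimpleGraph.Adj.reachable ?_)
    simp [listGraph, hne, hz]
  · rw [List.mem_append, List.mem_singleton] at hz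
    rcases hz with hz | rfl
    · exact h.mem z hz
    · exact ⟨a, b, rfl, ha1, han, hb1, hbn, hne, hP⟩
  · rw [listGraph_append]
    exact h.acyclic.sup_edge_of_not_reachable hnr
  · obtain ⟨w⟩ := hr
    induction w with
    | nil => rfl
    | cons hadj _ ih =>
      rw [← ih]
      rename_i u v _ _
      rw [listGraph_append, SimpleGraph.sup_adj, SimpleGraph.edge_adj] at hadj
      rcases hadj with hadj | ⟨hadj, -⟩
      · unfold mergeCol
        rw [h.sound _ _ hadj.reachable]
      · unfold mergeCol
        grind
  · have hr : ∀ p q, 1 ≤ p → p < n → 1 ≤ q → q < n → col p = col q →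
        (listGraph (po ++ [s(a, b)])).Reachable p q :=
      fun p q h1 h2 h3 h4 h5 => (h.complete p q h1 h2 h3 h4 h5).mono hle
    by_cases hpq : col p = col q
    · exact hr p q hp1 hpn hq1 hqn hpq
    · have : (col p = col a ∧ col q = col b) ∨ (col p = col b ∧ col q = col a) := by
        unfold mergeCol at hc
        grind
      rcases this with ⟨h1, h2⟩ | ⟨h1, h2⟩
      · exact (hr p a hp1 hpn ha1 han h1).trans
          (hadj.reachable.trans (hr b q hb1 hbn hq1 hqn h2.symm))
      · exact (hr p b hp1 hpn hb1 hbn h1).trans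
          (hadj.symm.reachable.trans (hr a q ha1 han hq1 hqn h2.symm))

/-! ## Applying the events of one row -/

/-- Apply the events of the row in integer variable 21 to the segment tree. -/
def applyRow : Cmd :=
  .setInt 22 (.arr 17 (.var 21)) ;;
  .loop (.not (.intEq (.var 22) (.lit 0)))
   (.setInt 10 (.add (.var 2) (.arr 19 (.var 22))) ;;
    .storeReal 2 (.var 10) (.add (.arr 2 (.var 10)) (.arr 1 (.var 22))) ;;
    .storeReal 3 (.var 10) (.add (.arr 3 (.var 10)) (.arr 1 (.var 22))) ;;
    climb ;; .setInt 22 (.arr 18 (.var 22)))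

/-- The total weight of the events in the list `l` at position `y`. -/
noncomputable def rowSum (evY : ℕ → ℕ) (evV : ℕ → ℝ) (l : List ℕ) (y : ℕ) : ℝ :=
  (l.map fun q => if evY q = y then evV q else 0).sum

/-- On a leaf the only prefix sum is the difference itself, so an event adds its weight to the total
and to the stored minimum alike. At an inactive leaf there is no candidate, and the stored minimum
is irrelevant. The invariant splits the list into events already applied and events still to come.
-/
theorem applyRow_spec {W : ℕ} (s : State) (D : ℕ) (δ : ℕ → ℝ) (act : ℕ → Prop) (col : ℕ → ℕ)
    (l : List ℕ) (hW : 4 * 2 ^ D + 3 ≤ W) (hN : s.intVar 2 = 2 ^ D)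
    (hcol : s.intArr 22 = col) (hT : SegTree D δ act col s)
    (hl : Linked (s.intArr 18) (s.intArr 17 (s.intVar 21)) l)
    (hy : ∀ q ∈ l, s.intArr 19 q < 2 ^ D) :
    Spec W applyRow s (400 * (D + 1) * l.length + 20) fun s' =>
      SegTree D (fun y => δ y + rowSum (s.intArr 19) (s.realArr 1) l y) act col s' := by
  rw [Spec, applyRow, wp_seq, wp_setInt]
  refine (WP.loop (Inv := fun s' N => ∃ l₁ l₂, l = l₁ ++ l₂ ∧ N = 400 * (D + 1) * l₂.length ∧
      Linked (s.intArr 18) (s'.intVar 22) l₂ ∧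
      SegTree D (fun y => δ y + rowSum (s.intArr 19) (s.realArr 1) l₁ y) act col s')
    (400 * (D + 1) * l.length) ?_ ?_).mono ?_
  · refine ⟨[], l, rfl, rfl, by simpa using hl, fun h i hi => ?_⟩
    exact (hT h i hi).congr (fun _ _ _ => by simp [rowSum]) (fun _ _ _ => Iff.rfl)
      (fun _ _ _ => rfl) rfl rfl rfl rfl rfl
  · rintro s1 N f1 ⟨l₁, l₂, hl12, rfl, hlk, hT1⟩ hb
    simp only [Test.Holds, IntExp.eval, Nat.zero_mod] at hb
    obtain ⟨l₃, rfl, hlk3⟩ := hlk.cons_of_ne hb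
    have e2 := (f1.iv 2 rfl)
    have e18 := (f1.ia 18 rfl)
    have e19 := (f1.ia 19 rfl)
    have e1 := (f1.ra 1 rfl)
    have e22 := (f1.ia 22 rfl)
    simp only [setIntVar_intVar, setIntVar_intArr, setIntVar_realArr, Nat.reduceEqDiff, reduceIte,
      hN, hcol] at e2 e18 e19 e1 e22
    generalize hq : s1.intVar 22 = q at *
    have hyq := hy q (by rw [hl12]; simp)
    generalize hy' : s.intArr 19 q = y at *
    generalize hv' : s.realArr 1 q = v at *
    have m : (2 ^ D + y) % W = 2 ^ D + y := Nat.mod_eq_of_lt (by omega)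
    simp only [wp_seq, wp_setInt, wp_storeReal, IntExp.eval, RealExp.eval, setIntVar_intVar,
      setIntVar_realArr, setRealArr_intVar, setRealArr_realArr,
      hq, e2, e19, e1, hy', hv', m, reduceIte, Nat.reduceEqDiff]
    refine (climb_spec _ D (fun y => δ y + rowSum (s.intArr 19) (s.realArr 1) (l₁ ++ [q]) y) act y
      hyq (by simp) hW ?_).wp fun s2 t2 f2 ht2 hT2 => ?_
    · intro h i hi hh
      simp only [setIntVar_intArr, setRealArr_intArr, e22]
      have hrow : ∀ p, p ≠ y → rowSum (s.intArr 19) (s.realArr 1) (l₁ ++ [q]) p =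
          rowSum (s.intArr 19) (s.realArr 1) l₁ p := by
        intro p hp
        simp [rowSum, hy', Ne.symm hp]
      have hrow' : rowSum (s.intArr 19) (s.realArr 1) (l₁ ++ [q]) y =
          rowSum (s.intArr 19) (s.realArr 1) l₁ y + v := by
        simp [rowSum, hy', hv']
      by_cases hix : i = (2 ^ D + y) / 2 ^ h
      · have hTi := hT1 h i hi
        obtain rfl := hh hix
        rw [pow_zero, Nat.div_one] at hix
        subst hix
        have hlo : (2 ^ D + y) * 2 ^ 0 - 2 ^ D = y := by simp
        have hhi : (2 ^ D + y + 1) * 2 ^ 0 - 2 ^ D = y + 1 := by simp; omega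
        unfold SegAt at hTi ⊢
        rw [hlo, hhi] at hTi ⊢
        obtain ⟨hs, b1, b2, lf1, ls1⟩ := hTi
        have hmem : ∀ x, x ∈ {p | act p ∧ y ≤ p ∧ p < y + 1} → x = y := by
          intro x hx
          have := hx.2
          omega
        have hz : ∀ a, a ∈ {p | act p ∧ y ≤ p ∧ p < y + 1} →
            ∑ p ∈ Finset.Ico y (a + 1), (δ p + rowSum (s.intArr 19) (s.realArr 1) (l₁ ++ [q]) p) =
            ∑ p ∈ Finset.Ico y (a + 1), (δ p + rowSum (s.intArr 19) (s.realArr 1) l₁ p) + v := by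
          intro a ha
          rw [hmem a ha]
          simp [hrow']
          ring
        refine ⟨?_, ?_⟩
        · simp only [setIntVar_realArr, setRealArr_realArr, Nat.reduceEqDiff, reduceIte,
            Function.update_self, hs]
          simp [hrow']
          ring
        · simp only [setIntVar_realArr, setRealArr_realArr, Nat.reduceEqDiff, reduceIte,
            Function.update_self, setIntVar_intArr, setRealArr_intArr]
          -- A single position has a single colour, so a leaf has no second candidate and its cell
          -- in real array 4 needs no update.
          have hs2 : s1.intArr 21 (2 ^ D + y) = 0 := by
            by_contra hne
            obtain ⟨h1, -, h3, h4⟩ := b2 hne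
            rw [hmem _ h1, hmem _ (b1 h3).1] at h4
            exact h4 rfl
          refine ⟨fun h => ?_, fun h => absurd hs2 h, fun x hx => ?_, fun x hx hc => ?_⟩
          · have := b1 h
            exact ⟨this.1, by rw [hz _ this.1, this.2]⟩
          · have := lf1 x hx
            exact ⟨this.1, by rw [hz _ hx]; linarith [this.2]⟩
          · exact absurd hs2 (ls1 x hx hc).1
      · have hne : i ≠ 2 ^ D + y := by
          rintro rfl
          have h0 : InTree D 0 (2 ^ D + y) := by
            constructor
            · simp
            · rw [pow_succ]; simp; omega
          obtain rfl := hi.height_unique h0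
          simp at hix
        refine (hT1 h i hi).congr (fun p hp1 hp2 => ?_) (fun _ _ _ => Iff.rfl) (fun _ _ _ => rfl)
          ?_ rfl rfl ?_ rfl
        · rw [hrow _ (hi.ne_of_mem hix hp1 hp2)]
        · simp [Function.update_of_ne hne]
        · simp [Function.update_of_ne hne]
    · have g22 := f2.iv 22 rfl
      have g18 := f2.ia 18 rfl
      simp only [setRealArr_intVar, setIntVar_intVar, setRealArr_intArr, setIntVar_intArr,
        Nat.reduceEqDiff, reduceIte, hq, e18, e22] at g22 g18 hT2
      simp only [g22, g18]
      refine ⟨_, ⟨l₁ ++ [q], l₃, by simp [hl12], rfl, by simpa using hlk3, fun h i hi => ?_⟩, ?_⟩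
      · exact (hT2 h i hi).congr (fun _ _ _ => rfl) (fun _ _ _ => Iff.rfl)
          (fun _ _ _ => rfl) rfl rfl rfl rfl rfl
      · rw [List.length_cons, Nat.mul_add (400 * (D + 1))]
        generalize 400 * (D + 1) * l₃.length = z
        simp only [IntExp.steps, RealExp.steps, Test.steps]
        omega
  · rintro s2 t2 ⟨N, ⟨l₁, l₂, hl12, -, hlk, hT2⟩, ht2, hb⟩
    simp only [Test.Holds, IntExp.eval, Nat.zero_mod, not_not] at hb
    rw [hb] at hlk
    obtain rfl := hlk.nil_of_zero
    rw [List.append_nil] at hl12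
    subst hl12
    refine ⟨?_, hT2⟩
    simp only [IntExp.steps, Test.steps] at ht2 ⊢
    omega

end RealRAM

namespace RealRAM

/-! ## The sweep over the rows -/

/-- Put the best candidate whose colour differs from that of the row in integer variable 21 into
integer variable 15, and its value into real variable 12. -/
def pick : Cmd :=
  .setInt 15 (.arr 20 (.lit 1)) ;; .setReal 12 (.arr 3 (.lit 1)) ;;
  .cond (.intEq (.arr 22 (.var 15)) (.arr 22 (.var 21)))
    (.setInt 15 (.arr 21 (.lit 1)) ;; .setReal 12 (.arr 4 (.lit 1))) .skip

/-- Output the pair of the tree edges at the positions in integer variables 21 and 15. -/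
def output : Cmd :=
  .setInt 26 (.arr 15 (.var 21)) ;; .storeInt 4 (.var 1) (.arr 8 (.var 26)) ;;
  .storeInt 5 (.var 1) (.var 26) ;;
  .setInt 26 (.arr 15 (.var 15)) ;; .storeInt 6 (.var 1) (.arr 8 (.var 26)) ;;
  .storeInt 7 (.var 1) (.var 26) ;; .setInt 1 (.add (.var 1) (.lit 1))

/-- Merge the classes of the positions in integer variables 21 and 15. -/
def mergeColours : Cmd :=
  .setInt 23 (.arr 22 (.var 21)) ;; .setInt 24 (.arr 22 (.var 15)) ;;
  .cond (.intLt (.arr 25 (.var 24)) (.arr 25 (.var 23)))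
    (.setInt 26 (.var 23) ;; .setInt 23 (.var 24) ;; .setInt 24 (.var 26)) .skip ;;
  relabel

/-- Connect the position in integer variable 21 to all its neighbours. -/
def queryRow : Cmd :=
  pick ;;
  .loop (.and (.not (.intEq (.var 15) (.lit 0)))
      (.and (.intLt (.lit 0) (.var 21)) (.realLe (.var 12) (.var 1))))
    (output ;; mergeColours ;; pick)

/-- The candidate `c` with value `m` is best possible among those of a colour other than `k`. -/
def Picked (n : ℕ) (val : ℕ → ℝ) (col : ℕ → ℕ) (k c : ℕ) (m : ℝ) : Prop :=
  (c ≠ 0 → 1 ≤ c ∧ c < n ∧ m = val c ∧ col c ≠ k) ∧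
  ∀ x, 1 ≤ x → x < n → col x ≠ k → c ≠ 0 ∧ m ≤ val x

/-- The value of row position `p` in the segment tree. -/
noncomputable def prefixSum (δ : ℕ → ℝ) (p : ℕ) : ℝ := ∑ q ∈ Finset.range (p + 1), δ q

theorem SegTree.root {D : ℕ} {δ : ℕ → ℝ} {act : ℕ → Prop} {col : ℕ → ℕ} {s : State}
    (h : SegTree D δ act col s) : Best {p | act p ∧ p < 2 ^ D} (prefixSum δ) col
      (s.intArr 20 1) (s.intArr 21 1) (s.realArr 3 1) (s.realArr 4 1) := by
  have h1 := (h D 1 ⟨by simp, by rw [pow_succ]; simp [mul_comm]⟩).best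
  have e : (1 + 1) * 2 ^ D - 2 ^ D = 2 ^ D := by omega
  rw [one_mul, Nat.sub_self, e] at h1
  refine h1.congr ?_ (fun x _ => ?_) (fun _ _ => rfl)
  · refine Set.ext fun p => ⟨fun h => ⟨h.1, Nat.zero_le _, h.2⟩, fun h => ⟨h.1, h.2.2⟩⟩
  · rw [prefixSum, Finset.range_eq_Ico]

/-- The positions that carry a tree edge. -/
def EdgePos (n p : ℕ) : Prop := 1 ≤ p ∧ p < n

/-- If the overall minimiser has the colour of the row, the second candidate is by definition the
best one of another colour; if not, the overall minimiser is itself admissible. -/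
theorem pick_spec {W : ℕ} (s : State) (n D : ℕ) (δ : ℕ → ℝ) (col : ℕ → ℕ) (hD : n < 2 ^ D)
    (hW : 4 * 2 ^ D + 3 ≤ W) (hc : Classes n col s) (hT : SegTree D δ (EdgePos n) col s) :
    Spec W pick s 30 fun s' => EdgePos n (s.intVar 21) →
      Picked n (prefixSum δ) col (col (s.intVar 21)) (s'.intVar 15) (s'.realVar 12) := by
  have m1 : 1 % W = 1 := Nat.mod_eq_of_lt (by omega)
  obtain ⟨b1, b2, b3, b4⟩ := hT.root
  have hS : ∀ x, x ∈ {p | EdgePos n p ∧ p < 2 ^ D} ↔ 1 ≤ x ∧ x < n := by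
    intro x
    simp only [Set.mem_ofPred_eq, EdgePos]
    constructor
    · rintro ⟨h, -⟩; exact h
    · intro h; exact ⟨h, by omega⟩
  simp only [hS] at b1 b2 b3 b4
  generalize he : s.intVar 21 = e at *
  simp only [Spec, pick, wp_seq, wp_setInt, wp_setReal, wp_cond, wp_skip, IntExp.eval,
    RealExp.eval, Test.Holds, setIntVar_intVar, setIntVar_intArr, setIntVar_realArr,
    setRealVar_intVar, setRealVar_intArr, setRealVar_realVar, setRealVar_realArr, m1, reduceIte,
    Nat.reduceEqDiff, hc.arr, he]
  refine ⟨fun h => ⟨by simp, fun hp => ⟨fun hne => ?_, fun x hx1 hxn hx => ?_⟩⟩,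
    fun h => ⟨by simp, fun hp => ⟨fun hne => ?_, fun x hx1 hxn hx => ?_⟩⟩⟩
  · obtain ⟨h1, h2, h3, h4⟩ := b2 hne
    exact ⟨h1.1, h1.2, h2, by rwa [← h]⟩
  · rw [← h] at hx
    exact b4 x ⟨hx1, hxn⟩ hx
  · obtain ⟨h1, h2⟩ := b1 hne
    exact ⟨h1.1, h1.2, h2, h⟩
  · exact b3 x ⟨hx1, hxn⟩

/-- The pairs listed in `po` have been output. -/
def OutOK (s : State) (po : List (Sym2 ℕ)) : Prop :=
  s.intVar 1 = po.length ∧ ∀ i (h : i < po.length), outputPair s i =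
    Sym2.map (fun p => s(s.intArr 8 (s.intArr 15 p), s.intArr 15 p)) po[i]

theorem output_spec {W : ℕ} (s : State) (po : List (Sym2 ℕ)) (h : OutOK s po)
    (hW : po.length + 2 ≤ W) :
    Spec W output s 40 fun s' => OutOK s' (po ++ [s(s.intVar 21, s.intVar 15)]) := by
  obtain ⟨h1, h2⟩ := h
  have m1 : 1 % W = 1 := Nat.mod_eq_of_lt (by omega)
  have m2 : (po.length + 1) % W = po.length + 1 := Nat.mod_eq_of_lt (by omega)
  simp only [Spec, output, wp_seq, wp_setInt, wp_storeInt, IntExp.eval,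
    setIntVar_intVar, setIntVar_intArr, setIntArr_intVar, setIntArr_intArr, h1, m1, m2, reduceIte,
    Nat.reduceEqDiff]
  refine ⟨by simp, by simp, fun i hi => ?_⟩
  simp only [List.length_append, List.length_singleton] at hi
  rcases Nat.lt_or_ge i po.length with hlt | hge
  · have := h2 i hlt
    rw [List.getElem_append_left hlt]
    simp only [outputPair, setIntVar_intArr, setIntArr_intArr, Nat.reduceEqDiff, reduceIte,
      Function.update_of_ne hlt.ne] at this ⊢
    exact this
  · obtain rfl : i = po.length := by omega
    simp [outputPair]

/-- The cost is charged to the drop of the potential, which is at least the size of the absorbed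
class. This class contains `e` or `c`, so the drop is strict; that pays for the constant part of an
iteration and bounds the number of outputs. -/
theorem mergeColours_spec {W : ℕ} (s : State) (n D : ℕ) (δ : ℕ → ℝ) (col : ℕ → ℕ)
    (e c : ℕ) (hD : n < 2 ^ D) (hW : 4 * 2 ^ D + 3 ≤ W) (hN : s.intVar 2 = 2 ^ D)
    (he : s.intVar 21 = e) (hcv : s.intVar 15 = c) (hep : EdgePos n e) (hcp : EdgePos n c)
    (hec : col e ≠ col c) (hc : Classes n col s) (hT : SegTree D δ (EdgePos n) col s) :
    ∃ a b, ((a = col e ∧ b = col c) ∨ (a = col c ∧ b = col e)) ∧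
    Spec W mergeColours s (400 * (D + 1) * (colourPot n col - colourPot n (mergeCol col a b)) + 50)
      fun s' => Classes n (mergeCol col a b) s' ∧ SegTree D δ (EdgePos n) (mergeCol col a b) s' ∧
        colourPot n (mergeCol col a b) < colourPot n col := by
  have hcol : ∀ p, EdgePos n p → 1 ≤ col p ∧ col p < n := by
    rintro p ⟨hp1, hpn⟩
    rcases hc.supp p with h | h
    · exact h.2.2
    · omega
  have key : ∀ (a b : ℕ) (s' : State), ((a = col e ∧ b = col c) ∨ (a = col c ∧ b = col e)) →
      classSize n col a ≤ classSize n col b →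
      s'.intVar 2 = 2 ^ D → s'.intVar 23 = a → s'.intVar 24 = b → s'.intArr = s.intArr →
      s'.realArr = s.realArr →
      Spec W relabel s' (400 * (D + 1) * (colourPot n col - colourPot n (mergeCol col a b)) + 10)
      fun s' => Classes n (mergeCol col a b) s' ∧ SegTree D δ (EdgePos n) (mergeCol col a b) s' ∧
        colourPot n (mergeCol col a b) < colourPot n col := by
    intro a b s' hab hle h2 h23 h24 hia hra
    have h1 := hcol e hep
    have h2' := hcol c hcp
    have hne : a ≠ b := by
      rcases hab with ⟨rfl, rfl⟩ | ⟨rfl, rfl⟩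
      · exact hec
      · exact hec.symm
    have hpot := colourPot_mergeCol hne hle
    have hpos : 0 < classSize n col a := by
      rw [classSize, Finset.card_pos]
      rcases hab with ⟨rfl, rfl⟩ | ⟨rfl, rfl⟩
      · exact ⟨e, by simp [hep.1, hep.2]⟩
      · exact ⟨c, by simp [hcp.1, hcp.2]⟩
    refine (relabel_spec s' n D δ (EdgePos n) col a b hD hW h2 h23 h24 ?_ ?_ ?_ ?_ hne ?_ ?_).mono
      (Nat.add_le_add_right (Nat.mul_le_mul_left _ (by omega)) _) fun s'' _ h => ⟨h.1, h.2, by omega⟩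
    · omega
    · omega
    · omega
    · omega
    · exact ⟨by rw [hia]; exact hc.arr, hc.supp, by rw [hia]; exact hc.list,
        by rw [hia]; exact hc.size⟩
    · intro h i hi
      exact (hT h i hi).congr (fun _ _ _ => rfl) (fun _ _ _ => Iff.rfl)
          (fun _ _ _ => rfl) (by rw [hra]) (by rw [hia]) (by rw [hia]) (by rw [hra]) (by rw [hra])
  have se := hc.size (col e) (hcol e hep).1 (hcol e hep).2
  have sc := hc.size (col c) (hcol c hcp).1 (hcol c hcp).2
  by_cases hlt : classSize n col (col c) < classSize n col (col e)
  · refine ⟨col c, col e, Or.inr ⟨rfl, rfl⟩, ?_⟩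
    simp only [Spec, mergeColours, wp_seq, wp_setInt, wp_cond, wp_skip, IntExp.eval, Test.Holds,
      setIntVar_intVar, setIntVar_intArr, he, hcv, hc.arr, reduceIte, Nat.reduceEqDiff, se, sc]
    refine ⟨fun _ => ?_, fun h => absurd hlt h⟩
    refine Spec.wp (key (col c) (col e) _ (Or.inr ⟨rfl, rfl⟩) hlt.le ?_ ?_ ?_ ?_ ?_)
      fun s' t f ht h => ⟨?_, h⟩
    · simpa using hN
    · simp
    · simp
    · rfl
    · rfl
    simp only [IntExp.steps, Test.steps]
    omega
  · refine ⟨col e, col c, Or.inl ⟨rfl, rfl⟩, ?_⟩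
    simp only [Spec, mergeColours, wp_seq, wp_setInt, wp_cond, wp_skip, IntExp.eval, Test.Holds,
      setIntVar_intVar, setIntVar_intArr, he, hcv, hc.arr, reduceIte, Nat.reduceEqDiff, se, sc]
    refine ⟨fun h => absurd h hlt, fun _ => ?_⟩
    refine Spec.wp (key (col e) (col c) _ (Or.inl ⟨rfl, rfl⟩) (by omega) ?_ ?_ ?_ ?_ ?_)
      fun s' t f ht h => ⟨?_, h⟩
    · simpa using hN
    · simp
    · simp
    · rfl
    · rfl
    simp only [IntExp.steps, Test.steps]
    omega

theorem Classes.congr {n : ℕ} {col : ℕ → ℕ} {s s' : State} (h : Classes n col s)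
    (h1 : s'.intArr 22 = s.intArr 22) (h2 : s'.intArr 23 = s.intArr 23)
    (h3 : s'.intArr 24 = s.intArr 24) (h4 : s'.intArr 25 = s.intArr 25) : Classes n col s' :=
  ⟨h1.trans h.arr, h.supp, by rw [h2, h3]; exact h.list, by rw [h4]; exact h.size⟩

theorem SegTree.congr {D : ℕ} {δ δ' : ℕ → ℝ} {act : ℕ → Prop} {col : ℕ → ℕ} {s s' : State}
    (h : SegTree D δ act col s) (hδ : ∀ y, y < 2 ^ D → δ' y = δ y)
    (h1 : s'.intArr 20 = s.intArr 20) (h2 : s'.intArr 21 = s.intArr 21)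
    (h3 : s'.realArr 2 = s.realArr 2) (h4 : s'.realArr 3 = s.realArr 3)
    (h5 : s'.realArr 4 = s.realArr 4) : SegTree D δ' act col s' := fun k i hi =>
  (h k i hi).congr (fun p _ h2 => hδ p (by have := hi.2; rw [pow_succ] at this; omega))
    (fun _ _ _ => Iff.rfl) (fun _ _ _ => rfl)
    (by rw [h3]) (by rw [h1]) (by rw [h2]) (by rw [h4]) (by rw [h5])

theorem OutOK.congr {s s' : State} {po : List (Sym2 ℕ)} (h : OutOK s po)
    (h1 : s'.intVar 1 = s.intVar 1) (h2 : s'.intArr 4 = s.intArr 4) (h3 : s'.intArr 5 = s.intArr 5)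
    (h4 : s'.intArr 6 = s.intArr 6) (h5 : s'.intArr 7 = s.intArr 7)
    (h6 : s'.intArr 8 = s.intArr 8) (h7 : s'.intArr 15 = s.intArr 15) : OutOK s' po := by
  unfold OutOK outputPair at *
  rw [h1, h2, h3, h4, h5, h6, h7]
  exact h

/-- The state of the sweep: colours, segment tree, forest and output. -/
structure Sweep (n D : ℕ) (P : ℕ → ℕ → Prop) (δ : ℕ → ℝ) (s : State) (po : List (Sym2 ℕ))
    (col : ℕ → ℕ) : Prop where
  classes : Classes n col s
  tree : SegTree D δ (EdgePos n) col s
  forest : Forest n P po col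
  out : OutOK s po
  bound : po.length + colourPot n col ≤ n * Nat.log 2 n

/-- The loop stops when the best candidate of a foreign colour is missing or exceeds the threshold;
by minimality no foreign colour then occurs among the positions related to `e`. The diagonal entry
never matters, since it has the colour of the row. Row 0 is not queried, because position 0 carries
no tree edge. Time plus potential is bounded, so that the costs telescope over the rows. -/
theorem queryRow_spec {W : ℕ} (s : State) (n D : ℕ) (P : ℕ → ℕ → Prop) (δ : ℕ → ℝ)
    (po : List (Sym2 ℕ)) (col : ℕ → ℕ) (e : ℕ) (hD : n < 2 ^ D) (hW : 4 * 2 ^ D + 3 ≤ W)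
    (hW2 : n * Nat.log 2 n + 2 ≤ W) (hN : s.intVar 2 = 2 ^ D)
    (he : s.intVar 21 = e) (hen : e < n) (hS : Sweep n D P δ s po col)
    (hP : ∀ x, EdgePos n x → (prefixSum δ x ≤ s.realVar 1 ↔ P e x)) :
    WP W queryRow (fun s' t => ∃ po' col', Sweep n D P δ s' po' col' ∧
      (∀ p q, col p = col q → col' p = col' q) ∧
      (1 ≤ e → ∀ x, EdgePos n x → P e x → col' x = col' e) ∧
      t + 900 * (D + 1) * colourPot n col' ≤ 900 * (D + 1) * colourPot n col + 60) s := by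
  rw [queryRow, wp_seq]
  refine (pick_spec s n D δ col hD hW hS.classes hS.tree).wp fun s1 t1 f1 ht1 hp1 => ?_
  rw [he] at hp1
  refine (WP.loop (Inv := fun s' N => ∃ po' col', Sweep n D P δ s' po' col' ∧
    (∀ p q, col p = col q → col' p = col' q) ∧
    (EdgePos n e → Picked n (prefixSum δ) col' (col' e) (s'.intVar 15) (s'.realVar 12)) ∧
    N = 900 * (D + 1) * colourPot n col') (900 * (D + 1) * colourPot n col) ?_ ?_).frame.mono ?_
  · exact ⟨po, col, ⟨hS.classes.congr (f1.ia _ rfl) (f1.ia _ rfl) (f1.ia _ rfl) (f1.ia _ rfl),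
      hS.tree.congr (fun _ _ => rfl) (f1.ia _ rfl) (f1.ia _ rfl) (f1.ra _ rfl) (f1.ra _ rfl)
        (f1.ra _ rfl), hS.forest, hS.out.congr (f1.iv _ rfl) (f1.ia _ rfl) (f1.ia _ rfl)
        (f1.ia _ rfl) (f1.ia _ rfl) (f1.ia _ rfl) (f1.ia _ rfl), hS.bound⟩,
      fun p q h => h, hp1, rfl⟩
  · rintro s2 N f2 ⟨po', col', hS', hmono, hpick, rfl⟩ hb
    have e21 : s2.intVar 21 = e := ((f2.iv 21 rfl).trans (f1.iv 21 rfl)).trans he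
    have e2 : s2.intVar 2 = 2 ^ D := ((f2.iv 2 rfl).trans (f1.iv 2 rfl)).trans hN
    have er : s2.realVar 1 = s.realVar 1 := (f2.rv 1 rfl).trans (f1.rv 1 rfl)
    simp only [Test.Holds, IntExp.eval, RealExp.eval, Nat.zero_mod, e21, er] at hb
    obtain ⟨hc0, he0, hle⟩ := hb
    have hep : EdgePos n e := ⟨he0, hen⟩
    obtain ⟨hc1, hcn, hval, hcol⟩ := (hpick hep).1 hc0
    generalize hcc : s2.intVar 15 = c at *
    have hPc : P e c := (hP c ⟨hc1, hcn⟩).1 (by rw [← hval]; exact hle)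
    have hbd := hS'.bound
    rw [wp_seq]
    refine (output_spec s2 po' hS'.out (by omega)).wp fun s3 t3 f3 ht3 h3 => ?_
    rw [wp_seq]
    rw [e21, hcc] at h3
    have e21' : s3.intVar 21 = e := (f3.iv 21 rfl).trans e21
    have e2' : s3.intVar 2 = 2 ^ D := (f3.iv 2 rfl).trans e2
    have e15' : s3.intVar 15 = c := (f3.iv 15 rfl).trans hcc
    obtain ⟨a, b, hab, hm⟩ := mergeColours_spec s3 n D δ col' e c hD hW e2' e21' e15' hep
      ⟨hc1, hcn⟩ hcol.symm
      (hS'.classes.congr (f3.ia _ rfl) (f3.ia _ rfl) (f3.ia _ rfl) (f3.ia _ rfl))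
      (hS'.tree.congr (fun _ _ => rfl) (f3.ia _ rfl) (f3.ia _ rfl) (f3.ra _ rfl) (f3.ra _ rfl)
        (f3.ra _ rfl))
    refine hm.wp fun s4 t4 f4 ht4 h4 => ?_
    have e21'' : s4.intVar 21 = e := (f4.iv 21 rfl).trans e21'
    refine (pick_spec s4 n D δ _ hD hW h4.1 h4.2.1).wp fun s5 t5 f5 ht5 h5 => ?_
    rw [e21''] at h5
    refine ⟨_, ⟨po' ++ [s(e, c)], mergeCol col' a b,
      ⟨h4.1.congr (f5.ia _ rfl) (f5.ia _ rfl) (f5.ia _ rfl) (f5.ia _ rfl),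
      h4.2.1.congr (fun _ _ => rfl) (f5.ia _ rfl) (f5.ia _ rfl) (f5.ra _ rfl) (f5.ra _ rfl)
        (f5.ra _ rfl), hS'.forest.add hep.1 hep.2 hc1 hcn hPc hcol.symm hab,
      (h3.congr (f4.iv _ rfl) (f4.ia _ rfl) (f4.ia _ rfl) (f4.ia _ rfl) (f4.ia _ rfl)
        (f4.ia _ rfl) (f4.ia _ rfl)).congr (f5.iv _ rfl) (f5.ia _ rfl) (f5.ia _ rfl)
        (f5.ia _ rfl) (f5.ia _ rfl) (f5.ia _ rfl) (f5.ia _ rfl), ?_⟩, fun p q h => ?_, h5, rfl⟩, ?_⟩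
    -- An output adds one to the list and takes at least one from the potential. This crude bound
    -- keeps the output index within the words.
    · have := h4.2.2
      simp only [List.length_append, List.length_singleton]
      omega
    · unfold mergeCol
      rw [hmono p q h]
    · obtain ⟨k, hk⟩ : ∃ k, colourPot n col' = colourPot n (mergeCol col' a b) + k + 1 :=
        ⟨colourPot n col' - colourPot n (mergeCol col' a b) - 1, by have := h4.2.2; omega⟩
      have hk2 : colourPot n col' - colourPot n (mergeCol col' a b) = k + 1 := by omega
      rw [hk2] at ht4
      rw [hk]
      -- A drop by `k + 1` releases `900 (D + 1) (k + 1)` steps. Relabelling takes `400 (D + 1) (k +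
      -- 1)` of them, and at least `500 (D + 1)` remain for the output, the comparison of sizes and
      -- the next query.
      have : 900 * (D + 1) * (colourPot n (mergeCol col' a b) + k + 1) =
        900 * (D + 1) * colourPot n (mergeCol col' a b) + 400 * (D + 1) * (k + 1) +
          500 * ((D + 1) * k) + 500 * (D + 1) := by ring
      simp only [IntExp.steps, RealExp.steps, Test.steps]
      omega
  · rintro s2 t2 ⟨f2, N, ⟨po', col', hS', hmono, hpick, rfl⟩, ht2, hb⟩
    have e21 : s2.intVar 21 = e := ((f2.iv 21 rfl).trans (f1.iv 21 rfl)).trans he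
    have er : s2.realVar 1 = s.realVar 1 := (f2.rv 1 rfl).trans (f1.rv 1 rfl)
    simp only [Test.Holds, IntExp.eval, RealExp.eval, Nat.zero_mod, e21, er] at hb
    refine ⟨po', col', hS', hmono, fun he1 x hx hPx => ?_, ?_⟩
    · by_contra hne
      obtain ⟨h1, h2⟩ := (hpick ⟨he1, hen⟩).2 x hx.1 hx.2 hne
      exact hb ⟨h1, he1, h2.trans ((hP x hx).2 hPx)⟩
    · simp only [IntExp.steps, RealExp.steps, Test.steps] at ht2
      omega

end RealRAM

/-! ### The complete sweep and the initial colouring. -/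

namespace RealRAM

/-- Process all rows. -/
def sweep : Cmd :=
  .setInt 21 (.lit 0) ;;
  .loop (.intLt (.var 21) (.var 0)) (applyRow ;; queryRow ;; .setInt 21 (.add (.var 21) (.lit 1)))

/-- The total weight, at position `y`, of the events in the rows before row `k`. -/
noncomputable def rowsSum (evY : ℕ → ℕ) (evV : ℕ → ℝ) (rows : ℕ → List ℕ) (k y : ℕ) : ℝ :=
  ∑ x ∈ Finset.range k, rowSum evY evV (rows x) y

/-- With the events of the rows up to `e` applied, the prefix sums in the tree form row `e` of the
matrix. Pairs settled in earlier rows stay settled because colourings only get coarser. All queries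
together draw on a single potential of at most `n log n`. -/
theorem sweep_spec {W : ℕ} (s : State) (n D : ℕ) (rows : ℕ → List ℕ) (P : ℕ → ℕ → Prop)
    (col : ℕ → ℕ)
    (hP : P = fun e x =>
      prefixSum (rowsSum (s.intArr 19) (s.realArr 1) rows (e + 1)) x ≤ s.realVar 1)
    (hD : n < 2 ^ D) (hW : 4 * 2 ^ D + 3 ≤ W) (hW2 : n * Nat.log 2 n + 2 ≤ W)
    (h0 : s.intVar 0 = n) (hN : s.intVar 2 = 2 ^ D) (hS : Sweep n D P (fun _ => 0) s [] col)
    (hl : ∀ x < n, Linked (s.intArr 18) (s.intArr 17 x) (rows x))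
    (hy : ∀ x < n, ∀ q ∈ rows x, s.intArr 19 q < 2 ^ D) :
    Spec W sweep s (400 * (D + 1) * (∑ x ∈ Finset.range n, (rows x).length) +
      900 * (D + 1) * (n * Nat.log 2 n) + 200 * n + 20) fun s' =>
      ∃ po col, Forest n P po col ∧ OutOK s' po ∧
        ∀ e x, EdgePos n e → EdgePos n x → P e x → col x = col e := by
  have m1 : 1 % W = 1 := Nat.mod_eq_of_lt (by omega)
  simp only [Spec, sweep, wp_seq, wp_setInt, IntExp.eval, Nat.zero_mod]
  refine (WP.loop (Inv := fun s' N => ∃ k po col, s'.intVar 21 = k ∧ k ≤ n ∧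
      Sweep n D P (rowsSum (s.intArr 19) (s.realArr 1) rows k) s' po col ∧
      (∀ e x, e < k → EdgePos n e → EdgePos n x → P e x → col x = col e) ∧
      N = 400 * (D + 1) * (∑ x ∈ Finset.Ico k n, (rows x).length) +
        900 * (D + 1) * colourPot n col + 200 * (n - k)) _ ⟨0, [], col, by simp, by omega, ?_,
        fun e x he => by omega, rfl⟩ ?_).frame.mono ?_
  · exact ⟨hS.classes.congr rfl rfl rfl rfl,
      hS.tree.congr (fun _ _ => by simp [rowsSum]) rfl rfl rfl rfl rfl, hS.forest,
      hS.out.congr rfl rfl rfl rfl rfl rfl rfl, hS.bound⟩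
  · rintro s1 N f1 ⟨k, po, col1, hk, hkn, hS1, hdone, rfl⟩ hb
    have e0 : s1.intVar 0 = n := (f1.iv 0 rfl).trans (by simpa using h0)
    have e2 : s1.intVar 2 = 2 ^ D := (f1.iv 2 rfl).trans (by simpa using hN)
    have e19 : s1.intArr 19 = s.intArr 19 := f1.ia 19 rfl
    have e18 : s1.intArr 18 = s.intArr 18 := f1.ia 18 rfl
    have e17 : s1.intArr 17 = s.intArr 17 := f1.ia 17 rfl
    have er1 : s1.realArr 1 = s.realArr 1 := f1.ra 1 rfl
    have ev1 : s1.realVar 1 = s.realVar 1 := f1.rv 1 rfl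
    simp only [Test.Holds, IntExp.eval, hk, e0] at hb
    rw [wp_seq]
    refine (applyRow_spec s1 D _ (EdgePos n) col1 (rows k) hW e2 hS1.classes.arr hS1.tree
      (by rw [e18, e17, hk]; exact hl k hb) (by rw [e19]; exact hy k hb)).wp
      fun s2 t2 f2 ht2 hT2 => ?_
    rw [e19, er1] at hT2
    rw [wp_seq]
    refine (queryRow_spec s2 n D P (rowsSum (s.intArr 19) (s.realArr 1) rows (k + 1)) po col1 k
      hD hW hW2 ((f2.iv 2 rfl).trans e2) ((f2.iv 21 rfl).trans hk) hb
      ⟨hS1.classes.congr (f2.ia _ rfl) (f2.ia _ rfl) (f2.ia _ rfl) (f2.ia _ rfl), ?_, hS1.forest,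
        hS1.out.congr (f2.iv _ rfl) (f2.ia _ rfl) (f2.ia _ rfl) (f2.ia _ rfl) (f2.ia _ rfl)
        (f2.ia _ rfl) (f2.ia _ rfl), hS1.bound⟩ ?_).frame.mono ?_
    · refine hT2.congr (fun y _ => ?_) rfl rfl rfl rfl rfl
      rw [rowsSum, Finset.sum_range_succ, rowsSum]
    · intro x hx
      rw [hP, (f2.rv 1 rfl).trans ev1]
    · rintro s3 t3 ⟨f3, po', col', hS3, hmono, hrow, ht3⟩
      have e21 : s3.intVar 21 = k := ((f3.iv 21 rfl).trans (f2.iv 21 rfl)).trans hk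
      have mk : (k + 1) % W = k + 1 := Nat.mod_eq_of_lt (by omega)
      simp only [wp_setInt, IntExp.eval, e21, m1, mk]
      refine ⟨_, ⟨k + 1, po', col', by simp, hb, ⟨hS3.classes.congr rfl rfl rfl rfl,
        hS3.tree.congr (fun _ _ => rfl) rfl rfl rfl rfl rfl, hS3.forest,
        hS3.out.congr rfl rfl rfl rfl rfl rfl rfl, hS3.bound⟩, fun e x he hep hx hPx => ?_, rfl⟩, ?_⟩
      · rcases Nat.lt_or_ge e k with h | h
        · exact hmono _ _ (hdone e x h hep hx hPx)
        · obtain rfl : e = k := by omega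
          exact hrow hep.1 x hx hPx
      · rw [Finset.sum_eq_sum_Ico_succ_bot hb, Nat.mul_add (400 * (D + 1))]
        obtain ⟨j, rfl⟩ : ∃ j, n = k + 1 + j := ⟨n - (k + 1), by omega⟩
        have : k + 1 + j - k = j + 1 := by omega
        rw [this]
        have : k + 1 + j - (k + 1) = j := by omega
        rw [this]
        simp only [IntExp.steps, Test.steps]
        omega
  · rintro s2 t2 ⟨f2, N, ⟨k, po, col', hk, hkn, hS2, hdone, rfl⟩, ht2, hb⟩
    have e0 : s2.intVar 0 = n := (f2.iv 0 rfl).trans (by simpa using h0)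
    simp only [Test.Holds, IntExp.eval, hk, e0] at hb
    obtain rfl : k = n := by omega
    refine ⟨?_, po, col', hS2.forest, hS2.out, fun e x he => hdone e x he.2 he⟩
    have h3 : 900 * (D + 1) * colourPot k col ≤ 900 * (D + 1) * (k * Nat.log 2 k) :=
      Nat.mul_le_mul_left _ (colourPot_le _ _)
    rw [Finset.range_eq_Ico]
    simp only [IntExp.steps, Test.steps] at ht2 ⊢
    omega

/-- Choose the size of the segment tree and give every position its own colour. -/
def initColours : Cmd :=
  .setInt 2 (.lit 1) ;;
  .loop (.not (.intLt (.var 0) (.var 2))) (.setInt 2 (.add (.var 2) (.var 2))) ;;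
  .setInt 20 (.lit 1) ;;
  .loop (.intLt (.var 20) (.var 0))
   (.storeInt 22 (.var 20) (.var 20) ;; .storeInt 23 (.var 20) (.var 20) ;;
    .storeInt 25 (.var 20) (.lit 1) ;;
    .setInt 10 (.add (.var 2) (.var 20)) ;; .storeInt 20 (.var 10) (.var 20) ;;
    .storeReal 3 (.var 10) .zero ;; climb ;; .setInt 20 (.add (.var 20) (.lit 1)))

/-- The colouring in which every position below `k` has its own colour. -/
def ownCol (k p : ℕ) : ℕ := if p < k then p else 0

/-- Leaves are activated one by one with the repair procedure of the tree. Position 0 stays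
inactive: it belongs to the root, which has no edge above it, and 0 serves as the mark for a missing
candidate. The tree has more than `n` leaves because a boundary of a path may be `n`. -/
theorem initColours_spec {W : ℕ} (s : State) (n : ℕ) (P : ℕ → ℕ → Prop) (hn : 1 ≤ n)
    (hW : 20 * n + 20 ≤ W) (h0 : s.intVar 0 = n) (h1 : s.intVar 1 = 0)
    (hia : ∀ a, 20 ≤ a → a ≤ 25 → s.intArr a = fun _ => 0)
    (hra : ∀ a, 2 ≤ a → a ≤ 4 → s.realArr a = fun _ => 0) :
    Spec W initColours s (500 * (Nat.log 2 n + 2) * n + 100) fun s' =>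
      ∃ D col, n < 2 ^ D ∧ 2 ^ D ≤ 2 * n ∧ D = Nat.log 2 n + 1 ∧ s'.intVar 2 = 2 ^ D ∧
        Sweep n D P (fun _ => 0) s' [] col := by
  have m1 : 1 % W = 1 := Nat.mod_eq_of_lt (by omega)
  simp only [Spec, initColours, wp_seq, wp_setInt, IntExp.eval, m1]
  refine (WP.loop (Inv := fun s' N => ∃ d, s'.intVar 2 = 2 ^ d ∧ 2 ^ d ≤ 2 * n ∧
      d ≤ Nat.log 2 n + 1 ∧ N = 20 * (Nat.log 2 n + 1 - d)) (20 * (Nat.log 2 n + 1))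
      ⟨0, by simp, by simp; omega, by omega, by simp⟩ ?_).frame.mono ?_
  · rintro s1 N f1 ⟨d, hd, hdn, hdl, rfl⟩ hb
    have e0 : s1.intVar 0 = n := (f1.iv 0 rfl).trans (by simpa using h0)
    simp only [Test.Holds, IntExp.eval, hd, e0, not_lt] at hb
    have hlog : d ≤ Nat.log 2 n := Nat.le_log_of_pow_le (by norm_num) hb
    have m : (2 ^ d + 2 ^ d) % W = 2 ^ (d + 1) := by
      rw [Nat.mod_eq_of_lt (by omega), pow_succ]; omega
    simp only [wp_setInt, IntExp.eval, hd, m]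
    refine ⟨_, ⟨d + 1, by simp, by rw [pow_succ]; omega, by omega, rfl⟩, ?_⟩
    simp only [IntExp.steps, Test.steps]
    omega
  rintro s1 t1 ⟨f1, N, ⟨D, hd, hdn, hdl, rfl⟩, ht1, hb⟩
  have e0 : s1.intVar 0 = n := (f1.iv 0 rfl).trans (by simpa using h0)
  have e1 : s1.intVar 1 = 0 := (f1.iv 1 rfl).trans (by simpa using h1)
  have e24 : s1.intArr 24 = fun _ => 0 := (f1.ia 24 rfl).trans (hia 24 (by norm_num) (by norm_num))
  simp only [Test.Holds, IntExp.eval, hd, e0, not_lt, not_le] at hb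
  have hDl : D = Nat.log 2 n + 1 := by
    have : Nat.log 2 n < D := Nat.log_lt_of_lt_pow (by omega) hb
    omega
  refine (WP.loop (Inv := fun s' N => ∃ k, s'.intVar 20 = k ∧ 1 ≤ k ∧ k ≤ n ∧
      s'.intArr 22 = ownCol k ∧ s'.intArr 23 = ownCol k ∧
      (∀ c, 1 ≤ c → c < k → s'.intArr 25 c = 1) ∧
      SegTree D (fun _ => 0) (EdgePos k) (ownCol k) s' ∧
      N = 400 * (D + 1) * (n - k)) (400 * (D + 1) * (n - 1))
      ⟨1, by simp, le_rfl, hn, ?_, ?_, fun c h1 h2 => by omega, ?_, rfl⟩ ?_).frame.mono ?_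
  · have : s1.intArr 22 = fun _ => 0 := (f1.ia 22 rfl).trans (hia 22 (by norm_num) (by norm_num))
    ext p
    simp [this, ownCol, eq_comm]
  · have : s1.intArr 23 = fun _ => 0 := (f1.ia 23 rfl).trans (hia 23 (by norm_num) (by norm_num))
    ext p
    simp [this, ownCol, eq_comm]
  · have g20 : s1.intArr 20 = fun _ => 0 :=
      (f1.ia 20 rfl).trans (hia 20 (by norm_num) (by norm_num))
    have g21 : s1.intArr 21 = fun _ => 0 :=
      (f1.ia 21 rfl).trans (hia 21 (by norm_num) (by norm_num))
    have r2 : s1.realArr 2 = fun _ => 0 := (f1.ra 2 rfl).trans (hra 2 (by norm_num) (by norm_num))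
    intro h i hi
    refine ⟨by simp [r2], ⟨fun h => ?_, fun h => ?_, fun x hx => ?_, fun x hx => ?_⟩⟩
    · simp [g20] at h
    · simp [g21] at h
    · have := hx.1.1; have := hx.1.2; omega
    · have := hx.1.1; have := hx.1.2; omega
  · rintro s2 N f2 ⟨k, hk, hk1, hkn, h22, h23, h25, hT, rfl⟩ hlt
    have e2 : s2.intVar 2 = 2 ^ D := (f2.iv 2 rfl).trans (by simpa using hd)
    have e0' : s2.intVar 0 = n := (f2.iv 0 rfl).trans (by simpa using e0)
    simp only [Test.Holds, IntExp.eval, hk, e0'] at hlt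
    have mk : (2 ^ D + k) % W = 2 ^ D + k := Nat.mod_eq_of_lt (by omega)
    have mk1 : (k + 1) % W = k + 1 := Nat.mod_eq_of_lt (by omega)
    have hown : Function.update (ownCol k) k k = ownCol (k + 1) := by
      ext p
      unfold ownCol
      by_cases hp : p = k
      · subst hp; simp
      · have : p < k + 1 ↔ p < k := by omega
        simp [hp, this]
    simp only [wp_seq, wp_setInt, wp_storeInt, wp_storeReal, IntExp.eval, RealExp.eval,
      setIntVar_intVar, setIntVar_intArr, setIntArr_intVar,
      hk, e2, reduceIte, Nat.reduceEqDiff, m1, mk]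
    refine (climb_spec _ D (fun _ => 0) (EdgePos (k + 1)) k (by omega) (by simp) (by omega) ?_).wp
      fun s3 t3 f3 ht3 hT3 => ?_
    · intro h i hi hh
      simp only [setRealArr_intArr, setIntArr_intArr, setIntVar_intArr, Nat.reduceEqDiff,
        reduceIte, h22, hown]
      by_cases hix : i = (2 ^ D + k) / 2 ^ h
      · have hTi := hT h i hi
        obtain rfl := hh hix
        rw [pow_zero, Nat.div_one] at hix
        subst hix
        have hlo : (2 ^ D + k) * 2 ^ 0 - 2 ^ D = k := by simp
        have hhi : (2 ^ D + k + 1) * 2 ^ 0 - 2 ^ D = k + 1 := by simp; omega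
        unfold SegAt at hTi ⊢
        rw [hlo, hhi] at hTi ⊢
        obtain ⟨hs, b1, b2, lf1, ls1⟩ := hTi
        have hs2 : s2.intArr 21 (2 ^ D + k) = 0 := by
          by_contra hne
          obtain ⟨⟨h1, h2, h3⟩, -⟩ := b2 hne
          have := h1.2
          omega
        refine ⟨?_, ?_⟩
        · simpa using hs
        · simp only [setRealArr_realArr, setRealArr_intArr, setIntArr_intArr, setIntVar_intArr,
            Nat.reduceEqDiff, reduceIte, Function.update_self, hs2]
          refine ⟨fun _ => ⟨⟨⟨hk1, by omega⟩, le_rfl, by omega⟩, by simp⟩, fun h => absurd rfl h,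
            fun x hx => ⟨by omega, by simp⟩, fun x hx hc => ?_⟩
          obtain ⟨h1, h2, h3⟩ := hx
          obtain rfl : x = k := by omega
          exact absurd rfl hc
      · have hne : i ≠ 2 ^ D + k := by
          rintro rfl
          have h0 : InTree D 0 (2 ^ D + k) := by
            constructor
            · simp
            · rw [pow_succ]; simp; omega
          obtain rfl := hi.height_unique h0
          simp at hix
        refine (hT h i hi).congr (fun p hp1 hp2 => rfl) (fun p hp1 hp2 => ?_) (fun p hp1 hp2 => ?_)
          rfl ?_ rfl ?_ rfl
        · have := hi.ne_of_mem hix hp1 hp2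
          unfold EdgePos
          omega
        · rw [← hown, Function.update_of_ne (hi.ne_of_mem hix hp1 hp2)]
        · simp [Function.update_of_ne hne]
        · simp [Function.update_of_ne hne]
    · have g20 : s3.intVar 20 = k := (f3.iv 20 rfl).trans (by simpa using hk)
      have g22 := f3.ia 22 rfl
      have g23 := f3.ia 23 rfl
      have g25 := f3.ia 25 rfl
      simp only [setRealArr_intArr, setIntArr_intArr, setIntVar_intArr, Nat.reduceEqDiff,
        reduceIte, h22, h23, hown] at g22 g23 g25 hT3
      simp only [g20, mk1]
      refine ⟨_, ⟨k + 1, by simp, by omega, by omega, g22, g23, fun c hc1 hc2 => ?_,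
        hT3.congr (fun _ _ => rfl) rfl rfl rfl rfl rfl, rfl⟩, ?_⟩
      · simp only [g25]
        by_cases hc : c = k
        · subst hc; simp
        · rw [Function.update_of_ne hc]
          exact h25 c hc1 (by omega)
      · obtain ⟨j, rfl⟩ : ∃ j, n = k + 1 + j := ⟨n - (k + 1), by omega⟩
        have : k + 1 + j - k = j + 1 := by omega
        rw [this]
        have : k + 1 + j - (k + 1) = j := by omega
        rw [this, Nat.mul_add (400 * (D + 1)) j 1]
        generalize 400 * (D + 1) * j = z
        simp only [IntExp.steps, RealExp.steps, Test.steps]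
        omega
  · rintro s2 t2 ⟨f2, N, ⟨k, hk, hk1, hkn, h22, h23, h25, hT, rfl⟩, ht2, hlt⟩
    have e2 : s2.intVar 2 = 2 ^ D := (f2.iv 2 rfl).trans (by simpa using hd)
    have e0' : s2.intVar 0 = n := (f2.iv 0 rfl).trans (by simpa using e0)
    have e1' : s2.intVar 1 = 0 := (f2.iv 1 rfl).trans (by simpa using e1)
    have e24' : s2.intArr 24 = fun _ => 0 := (f2.ia 24 rfl).trans (by simpa using e24)
    simp only [Test.Holds, IntExp.eval, hk, e0'] at hlt
    obtain rfl : k = n := by omega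
    refine ⟨?_, D, ownCol k, hb, hdn, hDl, e2, ⟨h22, fun p => ?_, fun c hc1 hcn => ?_,
      fun c hc1 hcn => ?_⟩, hT, ⟨List.nodup_nil, by simp, ?_, fun p q hr => ?_,
      fun p q hp1 hpn hq1 hqn h => ?_⟩, ⟨e1', by simp⟩, by simpa using colourPot_le k _⟩
    · rw [hDl] at ht2
      have e : 500 * (Nat.log 2 k + 2) * k =
          400 * (Nat.log 2 k + 1 + 1) * (k - 1) + 400 * (Nat.log 2 k + 2) +
            100 * (Nat.log 2 k + 2) * k := by
        obtain ⟨j, rfl⟩ : ∃ j, k = j + 1 := ⟨k - 1, by omega⟩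
        rw [Nat.add_sub_cancel]
        ring
      have e2 : 0 ≤ 100 * (Nat.log 2 k + 2) * k := Nat.zero_le _
      rw [e]
      simp only [IntExp.steps, Test.steps] at ht1 ht2 ⊢
      omega
    · unfold ownCol; split_ifs <;> omega
    · refine ⟨[c], ⟨by simp [h23, ownCol, hcn], by omega, by simp [e24', Linked]⟩,
        List.nodup_singleton _, fun p => ?_⟩
      simp only [List.mem_singleton, ownCol]
      split_ifs <;> omega
    · rw [h25 c hc1 hcn, classSize, eq_comm, Finset.card_eq_one]
      refine ⟨c, ?_⟩
      ext p
      rw [Finset.mem_filter, Finset.mem_Ico, Finset.mem_singleton, ownCol]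
      split_ifs <;> omega
    · simp [listGraph]
    · have : p = q := by simpa [listGraph] using hr
      rw [this]
    · have : p = q := by simpa [ownCol, hpn, hqn] using h
      rw [this]

end RealRAM

namespace RealRAM

/-! ## Events -/

/-- The total weight of the events `(x, y)` with `x ≤ i` and `y ≤ j`. -/
noncomputable def evSum (evY : ℕ → ℕ) (evV : ℕ → ℝ) (rows : ℕ → List ℕ) (i j : ℕ) : ℝ :=
  ∑ x ∈ Finset.range (i + 1), ((rows x).map fun q => if evY q ≤ j then evV q else 0).sum

/-- Exchanging the sums over rows and over positions identifies the row kept by the sweep with a row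
of the two-dimensional prefix sums of the events. -/
theorem prefixSum_rowsSum (evY : ℕ → ℕ) (evV : ℕ → ℝ) (rows : ℕ → List ℕ) (i j : ℕ) :
    prefixSum (rowsSum evY evV rows (i + 1)) j = evSum evY evV rows i j := by
  unfold prefixSum rowsSum evSum rowSum
  rw [Finset.sum_comm]
  refine Finset.sum_congr rfl fun x _ => ?_
  induction rows x with
  | nil => simp
  | cons q l ih =>
    simp only [List.map_cons, List.sum_cons, Finset.sum_add_distrib, ih]
    congr 1
    simp

/-- The events are stored in linked lists, one for each row. -/
structure Events (n : ℕ) (s : State) (rows : ℕ → List ℕ) : Prop where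
  link : ∀ x, Linked (s.intArr 18) (s.intArr 17 x) (rows x)
  mem : ∀ x, ∀ q ∈ rows x, q ≤ s.intVar 33 ∧ s.intArr 19 q ≤ n
  card : ∑ x ∈ Finset.range (n + 1), (rows x).length = s.intVar 33

/-- The matrix that the stored events describe. -/
noncomputable def evMat (s : State) (rows : ℕ → List ℕ) (i j : ℕ) : ℝ :=
  evSum (s.intArr 19) (s.realArr 1) rows i j

theorem Events.congr {n : ℕ} {s s' : State} {rows : ℕ → List ℕ} (h : Events n s rows)
    (h1 : s'.intArr 17 = s.intArr 17) (h2 : s'.intArr 18 = s.intArr 18)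
    (h3 : s'.intArr 19 = s.intArr 19) (h4 : s'.intVar 33 = s.intVar 33) : Events n s' rows :=
  ⟨by rw [h1, h2]; exact h.link, by rw [h3, h4]; exact h.mem, by rw [h4]; exact h.card⟩

theorem evMat_congr {s s' : State} (rows : ℕ → List ℕ)
    (h1 : s'.intArr 19 = s.intArr 19) (h2 : s'.realArr 1 = s.realArr 1) :
    evMat s' rows = evMat s rows := by
  unfold evMat
  rw [h1, h2]

@[simp] theorem evMat_setIntVar (s : State) (x v : ℕ) (rows : ℕ → List ℕ) :
    evMat (s.setIntVar x v) rows = evMat s rows := rfl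

/-- Store an event with the row in array 16 at integer variable 31, the position in array 16 at
integer variable 32 and the weight in real variable 3. -/
def pushEvent : Cmd :=
  .setInt 33 (.add (.var 33) (.lit 1)) ;;
  .storeInt 19 (.var 33) (.arr 16 (.var 32)) ;;
  .storeReal 1 (.var 33) (.var 3) ;;
  .storeInt 18 (.var 33) (.arr 17 (.arr 16 (.var 31))) ;;
  .storeInt 17 (.arr 16 (.var 31)) (.var 33)

/-- The new event is numbered one above the counter. This number occurs in no list, so the earlier
events keep their data, and it is never 0, so that 0 can terminate the lists. -/
theorem pushEvent_spec {W : ℕ} (s : State) (n : ℕ) (rows : ℕ → List ℕ) (x y : ℕ)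
    (hx : s.intArr 16 (s.intVar 31) = x) (hy : s.intArr 16 (s.intVar 32) = y)
    (hxn : x ≤ n) (hyn : y ≤ n) (hW : s.intVar 33 + 2 ≤ W) (hE : Events n s rows) :
    Spec W pushEvent s 40 fun s' => s'.intVar 33 = s.intVar 33 + 1 ∧ ∃ rows', Events n s' rows' ∧
      ∀ i j, evMat s' rows' i j =
        evMat s rows i j + if x ≤ i ∧ y ≤ j then s.realVar 3 else 0 := by
  have m1 : 1 % W = 1 := Nat.mod_eq_of_lt (by omega)
  have m2 : (s.intVar 33 + 1) % W = s.intVar 33 + 1 := Nat.mod_eq_of_lt (by omega)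
  generalize hq : s.intVar 33 + 1 = q at *
  have hfresh : ∀ x, q ∉ rows x := fun x h => by
    have := (hE.mem x q h).1
    omega
  simp only [Spec, pushEvent, wp_seq, wp_setInt, wp_storeInt, wp_storeReal, IntExp.eval,
    RealExp.eval, setIntVar_intVar, setIntVar_intArr, setIntVar_realVar, setIntArr_intVar,
    setIntArr_intArr, setIntArr_realVar, setRealArr_intVar, setRealArr_intArr, m1, m2, hq,
    reduceIte, Nat.reduceEqDiff, hx, hy]
  refine ⟨by simp, by simp, Function.update rows x (q :: rows x), ⟨fun z => ?_, fun z p hp => ?_, ?_⟩,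
    fun i j => ?_⟩
  · simp only [setIntArr_intArr, Nat.reduceEqDiff, reduceIte]
    by_cases hz : z = x
    · subst hz
      simp only [Function.update_self]
      exact (hE.link z).push (hfresh z) (by omega)
    · rw [Function.update_of_ne hz, Function.update_of_ne hz]
      exact (hE.link z).update (hfresh z)
  · have hp' : p = q ∨ p ∈ rows z := by
      by_cases hz : z = x
      · subst hz
        simpa using hp
      · rw [Function.update_of_ne hz] at hp
        exact Or.inr hp
    simp only [setIntArr_intArr, setIntArr_intVar, setRealArr_intVar, setRealArr_intArr,
      setIntVar_intVar, setIntVar_intArr, Nat.reduceEqDiff, reduceIte]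
    rcases hp' with rfl | hp'
    · simp [hyn]
    · have h1 := hE.mem z p hp'
      rw [Function.update_of_ne (by omega)]
      exact ⟨by omega, h1.2⟩
  · simp only [setIntArr_intVar, setRealArr_intVar, setIntVar_intVar, reduceIte]
    rw [← hq, ← hE.card, ← Finset.add_sum_erase _ _ (Finset.mem_range.2 (show x < n + 1 by omega)),
      ← Finset.add_sum_erase (Finset.range (n + 1)) (fun x => (rows x).length)
      (Finset.mem_range.2 (show x < n + 1 by omega)), Function.update_self, List.length_cons]
    rw [Finset.sum_congr rfl fun z hz => by rw [Function.update_of_ne (Finset.ne_of_mem_erase hz)]]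
    omega
  · unfold evMat evSum
    simp only [setIntArr_intArr, setIntArr_realArr, setRealArr_realArr, setRealArr_intArr,
      setIntVar_intArr, setIntVar_realArr, Nat.reduceEqDiff, reduceIte]
    have old : ∀ z, ((rows z).map fun p => if Function.update (s.intArr 19) q y p ≤ j then
        Function.update (s.realArr 1) q (s.realVar 3) p else 0) =
        (rows z).map fun p => if s.intArr 19 p ≤ j then s.realArr 1 p else 0 := by
      intro z
      refine List.map_congr_left fun p hp => ?_
      have : p ≠ q := fun h => hfresh z (h ▸ hp)
      rw [Function.update_of_ne this, Function.update_of_ne this]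
    have e : ∀ z, ((Function.update rows x (q :: rows x) z).map fun p =>
        if Function.update (s.intArr 19) q y p ≤ j then
        Function.update (s.realArr 1) q (s.realVar 3) p else 0).sum =
        ((rows z).map fun p => if s.intArr 19 p ≤ j then s.realArr 1 p else 0).sum +
        if z = x then (if y ≤ j then s.realVar 3 else 0) else 0 := by
      intro z
      by_cases hz : z = x
      · subst hz
        rw [Function.update_self, List.map_cons, List.sum_cons, old, if_pos rfl, add_comm]
        simp
      · rw [Function.update_of_ne hz, old, if_neg hz, add_zero]
    rw [Finset.sum_congr rfl fun z _ => e z, Finset.sum_add_distrib]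
    congr 1
    rw [Finset.sum_ite_eq']
    simp only [Finset.mem_range, Nat.lt_succ_iff]
    split_ifs <;> first | rfl | (exfalso; tauto)

/-- The alternating sum of the indicator functions of `b k ≤ i`, `k < K`. -/
def altSum (b : ℕ → ℕ) (K i : ℕ) : ℝ := ∑ k ∈ Finset.range K, if b k ≤ i then (-1) ^ k else 0

/-- Add the weight in real variable 2 times the tensor square of the alternating sum of the list in
array 16, whose length is in integer variable 30, to the matrix of the events. -/
def pushProd : Cmd :=
  .setInt 31 (.lit 0) ;;
  .loop (.intLt (.var 31) (.var 30))
   (.setInt 32 (.lit 0) ;;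
    .loop (.intLt (.var 32) (.var 30))
     (.cond (.intEq (.mod (.add (.var 31) (.var 32)) (.lit 2)) (.lit 0))
        (.setReal 3 (.var 2)) (.setReal 3 (.sub .zero (.var 2))) ;;
      pushEvent ;;
      .setInt 32 (.add (.var 32) (.lit 1))) ;;
    .setInt 31 (.add (.var 31) (.lit 1)))

/-- The tensor square of an alternating sum of `K` steps expands into `K * K` products. The product
of the steps at `b k` and `b l` is the prefix sum of a unit mass at `(b k, b l)`, and it carries the
sign `(-1) ^ (k + l)`, which the program reads off from a parity. -/
theorem pushProd_spec {W : ℕ} (s : State) (n : ℕ) (rows : ℕ → List ℕ) (K : ℕ) (b : ℕ → ℕ)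
    (v : ℝ) (hK : s.intVar 30 = K) (hb : s.intArr 16 = b) (hv : s.realVar 2 = v)
    (hbn : ∀ k < K, b k ≤ n) (hW : s.intVar 33 + K * K + 2 * K + 4 ≤ W) (hE : Events n s rows) :
    Spec W pushProd s (100 * (K * K) + 50 * K + 20) fun s' => s'.intVar 33 = s.intVar 33 + K * K ∧
      ∃ rows', Events n s' rows' ∧ ∀ i j, evMat s' rows' i j =
        evMat s rows i j + v * altSum b K i * altSum b K j := by
  have m1 : 1 % W = 1 := Nat.mod_eq_of_lt (by omega)
  have m2 : 2 % W = 2 := Nat.mod_eq_of_lt (by omega)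
  simp only [Spec, pushProd, wp_seq, wp_setInt, IntExp.eval, Nat.zero_mod]
  refine (WP.loop (s := s.setIntVar 31 0) (Inv := fun s' N => ∃ k rows', s'.intVar 31 = k ∧ k ≤ K ∧
      s'.intVar 33 = s.intVar 33 + k * K ∧ Events n s' rows' ∧
      (∀ i j, evMat s' rows' i j = evMat s rows i j + v * altSum b k i * altSum b K j) ∧
      N = (100 * K + 40) * (K - k)) ((100 * K + 40) * K)
      ⟨0, rows, by simp, by omega, by simp, hE.congr rfl rfl rfl rfl, ?_, by simp⟩ ?_).frame.mono ?_
  · intro i j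
    rw [evMat_setIntVar]
    simp [altSum]
  · rintro s1 N f1 ⟨k, rows1, hk, hkK, h33, hE1, hM1, rfl⟩ hlt
    have e30 : s1.intVar 30 = K := (f1.iv 30 rfl).trans (by simpa using hK)
    have e16 : s1.intArr 16 = b := (f1.ia 16 rfl).trans (by simpa using hb)
    have ev : s1.realVar 2 = v := (f1.rv 2 rfl).trans (by simpa using hv)
    simp only [Test.Holds, IntExp.eval, hk, e30] at hlt
    have hkK2 : k * K + K ≤ K * K := by
      have := Nat.mul_le_mul_right K (Nat.succ_le_of_lt hlt)
      rwa [Nat.succ_mul] at this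
    simp only [wp_seq, wp_setInt, IntExp.eval, Nat.zero_mod]
    refine (WP.loop (s := s1.setIntVar 32 0) (Inv := fun s' N => ∃ l rows', s'.intVar 32 = l ∧ l ≤ K ∧
      s'.intVar 33 = s.intVar 33 + k * K + l ∧ Events n s' rows' ∧
      (∀ i j, evMat s' rows' i j = evMat s1 rows1 i j +
        v * (if b k ≤ i then (-1) ^ k else 0) * altSum b l j) ∧
      N = 90 * (K - l)) (90 * K) ⟨0, rows1, by simp, by omega, by simpa using h33,
        hE1.congr rfl rfl rfl rfl, ?_, by simp⟩ ?_).frame.mono ?_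
    · intro i j
      rw [evMat_setIntVar]
      simp [altSum]
    · rintro s2 N f2 ⟨l, rows2, hl, hlK, h33', hE2, hM2, rfl⟩ hlt2
      have e30' : s2.intVar 30 = K := (f2.iv 30 rfl).trans (by simpa using e30)
      have e31' : s2.intVar 31 = k := (f2.iv 31 rfl).trans (by simpa using hk)
      have e16' : s2.intArr 16 = b := (f2.ia 16 rfl).trans (by simpa using e16)
      have ev' : s2.realVar 2 = v := (f2.rv 2 rfl).trans (by simpa using ev)
      simp only [Test.Holds, IntExp.eval, hl, e30'] at hlt2
      have ml : (l + 1) % W = l + 1 := Nat.mod_eq_of_lt (by omega)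
      have mkl : (k + l) % W = k + l := Nat.mod_eq_of_lt (by omega)
      have key : ∀ s3 : State, s3.intVar = s2.intVar → s3.intArr = s2.intArr →
          s3.realArr = s2.realArr → s3.realVar 3 = v * (-1) ^ (k + l) →
          Spec W (pushEvent ;; .setInt 32 (.add (.var 32) (.lit 1))) s3 50 fun s' =>
            ∃ rows', s'.intVar 32 = l + 1 ∧ s'.intVar 33 = s.intVar 33 + k * K + (l + 1) ∧
            Events n s' rows' ∧ ∀ i j, evMat s' rows' i j = evMat s1 rows1 i j +
              v * (if b k ≤ i then (-1) ^ k else 0) * altSum b (l + 1) j := by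
        intro s3 hiv hia hra hrv
        rw [Spec, wp_seq]
        refine (pushEvent_spec s3 n rows2 (b k) (b l) (by rw [hiv, hia, e16', e31'])
          (by rw [hiv, hia, e16', hl]) (hbn k hlt) (hbn l hlt2) (by rw [hiv]; omega)
          (hE2.congr (by rw [hia]) (by rw [hia]) (by rw [hia]) (by rw [hiv]))).wp ?_
        rintro s4 t4 f4 ht4 ⟨h33'', rows4, hE4, hM4⟩
        have e32 : s4.intVar 32 = l := by rw [f4.iv 32 rfl, hiv, hl]
        simp only [wp_setInt, IntExp.eval, e32, m1, ml]
        refine ⟨by simp only [IntExp.steps]; omega, rows4, by simp, ?_, hE4.congr rfl rfl rfl rfl,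
          fun i j => ?_⟩
        · simp only [setIntVar_intVar, Nat.reduceEqDiff, reduceIte]
          rw [h33'', hiv]
          omega
        · rw [evMat_setIntVar, hM4, hrv, evMat_congr (s := s2) rows2
            (by rw [hia]) (by rw [hra]), hM2, altSum, altSum, Finset.sum_range_succ, pow_add]
          split_ifs with h1 h2 h3 <;> first | (exfalso; tauto) | ring
      have fin : ∀ {s' : State} {t c : ℕ}, t ≤ 50 → c ≤ 20 → (∃ rows', s'.intVar 32 = l + 1 ∧
          s'.intVar 33 = s.intVar 33 + k * K + (l + 1) ∧
            Events n s' rows' ∧ ∀ i j, evMat s' rows' i j = evMat s1 rows1 i j +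
              v * (if b k ≤ i then (-1) ^ k else 0) * altSum b (l + 1) j) →
          ∃ N', (∃ l rows', s'.intVar 32 = l ∧ l ≤ K ∧
          s'.intVar 33 = s.intVar 33 + k * K + l ∧ Events n s' rows' ∧
          (∀ i j, evMat s' rows' i j = evMat s1 rows1 i j +
            v * (if b k ≤ i then (-1) ^ k else 0) * altSum b l j) ∧
          N' = 90 * (K - l)) ∧
          c + t + (Test.intLt (IntExp.var 32) (IntExp.var 30)).steps + 1 + N' ≤ 90 * (K - l) := by
        rintro s' t c ht hc ⟨rows', h1, h2, h3, h4⟩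
        refine ⟨_, ⟨l + 1, rows', h1, by omega, h2, h3, h4, rfl⟩, ?_⟩
        simp only [IntExp.steps, Test.steps]
        omega
      rw [wp_seq]
      simp only [wp_cond, wp_setReal, RealExp.eval, Test.Holds, IntExp.eval, e31', hl, mkl, m2,
        Nat.zero_mod, ev']
      refine ⟨fun hpar => ?_, fun hpar => ?_⟩
      · refine Spec.wp (key _ rfl rfl rfl ?_) fun s' t f ht h => fin ht ?_ h
        · simp [Even.neg_one_pow (Nat.even_iff.2 hpar)]
        · simp [IntExp.steps, Test.steps, RealExp.steps]
      · refine Spec.wp (key _ rfl rfl rfl ?_) fun s' t f ht h => fin ht ?_ h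
        · simp [Odd.neg_one_pow (Nat.not_even_iff_odd.1 fun h => hpar (Nat.even_iff.1 h))]
        · simp [IntExp.steps, Test.steps, RealExp.steps]
    · rintro s2 t2 ⟨f2, N, ⟨l, rows2, hl, hlK, h33', hE2, hM2, rfl⟩, ht2, hlt2⟩
      have e30' : s2.intVar 30 = K := (f2.iv 30 rfl).trans (by simpa using e30)
      have e31' : s2.intVar 31 = k := (f2.iv 31 rfl).trans (by simpa using hk)
      simp only [Test.Holds, IntExp.eval, hl, e30'] at hlt2
      obtain rfl : l = K := by omega
      have mk : (k + 1) % W = k + 1 := Nat.mod_eq_of_lt (by omega)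
      simp only [e31', m1, mk]
      refine ⟨_, ⟨k + 1, rows2, by simp, hlt, ?_, hE2.congr rfl rfl rfl rfl, fun i j => ?_, rfl⟩, ?_⟩
      · simp only [setIntVar_intVar, Nat.reduceEqDiff, reduceIte, h33']
        ring
      · rw [evMat_setIntVar, hM2, hM1, altSum, altSum, altSum,
          Finset.sum_range_succ _ k]
        ring
      · obtain ⟨j, rfl⟩ : ∃ j, l = k + 1 + j := ⟨l - (k + 1), by omega⟩
        have e1 : k + 1 + j - k = j + 1 := by omega
        have e2 : k + 1 + j - (k + 1) = j := by omega
        rw [e1, e2, Nat.mul_add (100 * (k + 1 + j) + 40) j 1]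
        generalize (100 * (k + 1 + j) + 40) * j = z
        simp only [IntExp.steps, Test.steps] at ht2 ⊢
        omega
  · rintro s2 t2 ⟨f2, N, ⟨k, rows2, hk, hkK, h33', hE2, hM2, rfl⟩, ht2, hlt2⟩
    have e30' : s2.intVar 30 = K := (f2.iv 30 rfl).trans (by simpa using hK)
    simp only [Test.Holds, IntExp.eval, hk, e30'] at hlt2
    obtain rfl : k = K := by omega
    refine ⟨?_, h33', rows2, hE2, hM2⟩
    have : (100 * k + 40) * k = 100 * (k * k) + 40 * k := by ring
    simp only [IntExp.steps, Test.steps] at ht2 ⊢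
    omega

end RealRAM

namespace RealRAM

/-! ## Trees on positions with heavy paths -/

/-- `v` is an ancestor of `x`, or `x` itself, for the parent function `pp`. -/
inductive Anc (pp : ℕ → ℕ) (v : ℕ) : ℕ → Prop
  | refl : Anc pp v v
  | step {x : ℕ} : x ≠ 0 → Anc pp v (pp x) → Anc pp v x

theorem anc_iff {pp : ℕ → ℕ} {v x : ℕ} : Anc pp v x ↔ x = v ∨ (x ≠ 0 ∧ Anc pp v (pp x)) := by
  constructor
  · intro h
    cases h with
    | refl => exact Or.inl rfl
    | step h0 h => exact Or.inr ⟨h0, h⟩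
  · rintro (rfl | ⟨h0, h⟩)
    · exact .refl
    · exact .step h0 h

/-- A rooted tree on the positions `0, …, n - 1` with parent function `pp`, split into paths of
consecutive positions; `hd p` is the first position of the path of `p`. The weights `sz` at least
double above the first position of a path. -/
structure PosTree (n : ℕ) (pp hd sz : ℕ → ℕ) : Prop where
  lt : ∀ p, 1 ≤ p → p < n → pp p < p
  path : ∀ p < n, hd p = p ∨ (1 ≤ p ∧ hd p = hd (p - 1) ∧ pp p = p - 1)
  sz_pos : ∀ p < n, 1 ≤ sz p ∧ sz p ≤ n
  sz_le : ∀ p, 1 ≤ p → p < n → sz p ≤ sz (pp p)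
  sz_two : ∀ p, 1 ≤ p → p < n → hd p = p → 2 * sz p ≤ sz (pp p)

section PosTree

variable {n : ℕ} {pp hd sz : ℕ → ℕ}

theorem PosTree.anc_le (h : PosTree n pp hd sz) {v x : ℕ} (ha : Anc pp v x) (hx : x < n) :
    v ≤ x := by
  induction ha with
  | refl => exact le_rfl
  | step h0 _ ih =>
    have := h.lt _ (by omega) hx
    have := ih (by omega)
    omega

theorem PosTree.segment (h : PosTree n pp hd sz) (x : ℕ) (hx : x < n) :
    hd x ≤ x ∧ hd (hd x) = hd x ∧ ∀ q, hd x < q → q ≤ x → hd q = hd x ∧ pp q = q - 1 := by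
  induction x with
  | zero =>
    rcases h.path 0 hx with h1 | ⟨h1, -⟩
    · exact ⟨by omega, by rw [h1, h1], fun q h2 h3 => by omega⟩
    · omega
  | succ x ih =>
    rcases h.path (x + 1) hx with h1 | ⟨-, h2, h3⟩
    · exact ⟨by omega, by rw [h1, h1], fun q h4 h5 => by omega⟩
    · rw [Nat.add_sub_cancel] at h2 h3
      obtain ⟨i1, i2, i3⟩ := ih (by omega)
      rw [h2]
      refine ⟨by omega, i2, fun q h4 h5 => ?_⟩
      rcases Nat.lt_or_ge x q with h6 | h6
      · obtain rfl : q = x + 1 := by omega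
        exact ⟨h2, by omega⟩
      · exact i3 q h4 h6

theorem PosTree.hd_eq (h : PosTree n pp hd sz) {x q : ℕ} (hx : x < n) (h1 : hd x ≤ q)
    (h2 : q ≤ x) : hd q = hd x := by
  obtain ⟨_, h3, h4⟩ := h.segment x hx
  rcases Nat.eq_or_lt_of_le h1 with rfl | h5
  · exact h3
  · exact (h4 q h5 h2).1

/-- On a heavy path the parent is the preceding position, so climbing from `x` to `p` meets each
position between them once. -/
theorem PosTree.anc_chain (h : PosTree n pp hd sz) {v p x : ℕ} (hx : x < n) (h1 : hd x ≤ p)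
    (h2 : p ≤ x) : Anc pp v x ↔ (p < v ∧ v ≤ x) ∨ Anc pp v p := by
  obtain ⟨k, rfl⟩ := Nat.exists_eq_add_of_le h2
  induction k with
  | zero =>
    simp only [add_zero]
    refine ⟨Or.inr, fun h => h.resolve_left (by omega)⟩
  | succ k ih =>
    have h3 := (h.segment _ hx).2.2 (p + (k + 1)) (by omega) le_rfl
    have h4 : hd (p + k) = hd (p + (k + 1)) := h.hd_eq hx (by omega) (by omega)
    rw [anc_iff, h3.2]
    have h5 : p + (k + 1) - 1 = p + k := by omega
    rw [h5, ih (by omega) (by omega) (by omega)]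
    have h6 : Anc pp v p → v ≤ p := fun ha => h.anc_le ha (by omega)
    constructor
    · rintro (h | ⟨-, h | h⟩)
      · left; omega
      · left; omega
      · exact Or.inr h
    · rintro (h | h)
      · by_cases hv : v = p + (k + 1)
        · left; omega
        · right; exact ⟨by omega, Or.inl (by omega)⟩
      · right; exact ⟨by omega, Or.inr h⟩

theorem PosTree.sz_chain (h : PosTree n pp hd sz) {p x : ℕ} (hx : x < n) (h1 : hd x ≤ p)
    (h2 : p ≤ x) : sz x ≤ sz p := by
  obtain ⟨k, rfl⟩ := Nat.exists_eq_add_of_le h2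
  induction k with
  | zero => simp
  | succ k ih =>
    have h3 := (h.segment _ hx).2.2 (p + (k + 1)) (by omega) le_rfl
    have h4 : hd (p + k) = hd (p + (k + 1)) := h.hd_eq hx (by omega) (by omega)
    have h5 := h.sz_le (p + (k + 1)) (by omega) hx
    rw [h3.2, show p + (k + 1) - 1 = p + k by omega] at h5
    exact h5.trans (ih (by omega) (by omega) (by omega))

open Classical in
/-- `1` if the tree edge above `v` separates `x` from `y`, and `0` otherwise. -/
noncomputable def sepI (pp : ℕ → ℕ) (v x y : ℕ) : ℝ := if Anc pp v x ↔ Anc pp v y then 0 else 1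

theorem sepI_comm (v x y : ℕ) : sepI pp v x y = sepI pp v y x := by
  unfold sepI
  congr 1
  exact propext Iff.comm

theorem sepI_self (v x : ℕ) : sepI pp v x x = 0 := by
  simp [sepI]

/-- The ancestors of `x` that are not ancestors of `y` are the positions `y + 1, …, x`. The
vanishing term `sepI pp v y y` is kept so that this case has the shape of a step of the walk, one
that ends with both endpoints at `y`. -/
theorem PosTree.sepI_same (h : PosTree n pp hd sz) {v x y : ℕ} (hx : x < n) (hyx : y < x)
    (hh : hd y = hd x) :
    sepI pp v x y = sepI pp v y y + if y + 1 ≤ v ∧ v < x + 1 then 1 else 0 := by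
  have h1 := h.anc_chain (v := v) hx (by rw [← hh]; exact (h.segment y (by omega)).1) hyx.le
  have h6 : Anc pp v y → v ≤ y := fun ha => h.anc_le ha (by omega)
  rw [sepI_self, sepI, zero_add]
  by_cases hv : y + 1 ≤ v ∧ v < x + 1
  · have : ¬ Anc pp v y := fun ha => by have := h6 ha; omega
    have h2 : Anc pp v x := h1.2 (Or.inl (by omega))
    simp [hv, this, h2]
  · rw [if_pos, if_neg hv]
    rw [h1]
    constructor
    · rintro (h | h)
      · omega
      · exact h
    · exact Or.inr

/-- Heavy paths are intervals, so `y` lies before the whole path of `x`, and ancestors of `y` have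
positions at most `y`. Hence all positions from `hd x` to `x` lie on the tree path, and what remains
is the tree path from the parent of `hd x` to `y`. This is why the walk always moves the endpoint
with the larger position. -/
theorem PosTree.sepI_diff (h : PosTree n pp hd sz) {v x y : ℕ} (hx : x < n) (hyx : y < x)
    (hh : hd y ≠ hd x) : hd x ≠ 0 ∧
    sepI pp v x y = sepI pp v (pp (hd x)) y + if hd x ≤ v ∧ v < x + 1 then 1 else 0 := by
  have hle := (h.segment x hx).1
  have hlt : y < hd x := by
    by_contra hc
    exact hh (h.hd_eq hx (by omega) hyx.le)
  have h1 := h.anc_chain (v := v) hx le_rfl hle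
  have h0 : hd x ≠ 0 := by omega
  have hpp := h.lt (hd x) (by omega) (by omega)
  have h6 : Anc pp v y → v ≤ y := fun ha => h.anc_le ha (by omega)
  have h7 : Anc pp v (pp (hd x)) → v < hd x := fun ha => by
    have := h.anc_le ha (by omega)
    omega
  have h2 : Anc pp v (hd x) ↔ hd x = v ∨ Anc pp v (pp (hd x)) := by
    rw [anc_iff]; simp [h0]
  refine ⟨h0, ?_⟩
  unfold sepI
  by_cases hv : hd x ≤ v ∧ v < x + 1
  · have n1 : ¬ Anc pp v y := fun ha => by have := h6 ha; omega
    have n2 : ¬ Anc pp v (pp (hd x)) := fun ha => by have := h7 ha; omega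
    have n3 : Anc pp v x := h1.2 (by rw [h2]; omega)
    simp [hv, n1, n2, n3]
  · have : Anc pp v x ↔ Anc pp v (pp (hd x)) := by
      rw [h1, h2]
      constructor
      · rintro (h | h | h)
        · omega
        · omega
        · exact h
      · exact fun h => Or.inr (Or.inr h)
    rw [if_neg hv, add_zero]
    congr 1
    exact propext (iff_congr this Iff.rfl)

end PosTree

/-! ## The tree path of an edge -/

/-- Write the boundaries of the part of the tree path from the lower position in integer variable 40
upwards that lies on one heavy path, and move to the upper end of this part. -/
def walkStep : Cmd :=
  .setInt 42 (.arr 14 (.var 40)) ;;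
  .cond (.intEq (.arr 14 (.var 41)) (.var 42))
    (.setInt 43 (.add (.var 41) (.lit 1)) ;; .setInt 44 (.var 41))
    (.setInt 43 (.var 42) ;; .setInt 44 (.arr 26 (.var 42))) ;;
  .setInt 45 (.add (.var 40) (.lit 1)) ;;
  .storeInt 16 (.var 30) (.var 43) ;; .storeInt 16 (.add (.var 30) (.lit 1)) (.var 45) ;;
  .storeInt 16 (.add (.var 30) (.lit 2)) (.var 43) ;;
  .storeInt 16 (.add (.var 30) (.lit 3)) (.var 45) ;;
  .setInt 30 (.add (.var 30) (.lit 4)) ;; .setInt 40 (.var 44)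

/-- Write the boundaries of the tree path between the positions in integer variables 40 and 41 into
array 16, such that their alternating sum is `1` outside the path and `-1` on the path. -/
def walk : Cmd :=
  .storeInt 16 (.lit 0) (.lit 0) ;; .setInt 30 (.lit 1) ;;
  .loop (.not (.intEq (.var 40) (.var 41)))
   (.cond (.intLt (.var 40) (.var 41))
      (.setInt 42 (.var 40) ;; .setInt 40 (.var 41) ;; .setInt 41 (.var 42)) .skip ;;
    walkStep)

theorem altSum_congr {b b' : ℕ → ℕ} {K : ℕ} (h : ∀ k < K, b' k = b k) (i : ℕ) :
    altSum b' K i = altSum b K i := by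
  unfold altSum
  refine Finset.sum_congr rfl fun k hk => ?_
  rw [h k (Finset.mem_range.1 hk)]

/-- As `K` is odd, the new boundaries have the signs `-, +, -, +`: twice a step down at `lo` and a
step up at `hi`. Doubling them turns the value `1` into `-1` on the interval, and `K + 4` is odd
again. -/
theorem altSum_four {b b' : ℕ → ℕ} {K lo hi : ℕ} (hK : Odd K) (hlh : lo ≤ hi)
    (h : ∀ k < K, b' k = b k) (h0 : b' K = lo) (h1 : b' (K + 1) = hi) (h2 : b' (K + 2) = lo)
    (h3 : b' (K + 3) = hi) (i : ℕ) :
    altSum b' (K + 4) i = altSum b K i - 2 * if lo ≤ i ∧ i < hi then 1 else 0 := by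
  rw [← altSum_congr h]
  unfold altSum
  rw [Finset.sum_range_succ, Finset.sum_range_succ, Finset.sum_range_succ, Finset.sum_range_succ,
    h0, h1, h2, h3]
  have e0 := hK.neg_one_pow (α := ℝ)
  have e1 : (-1 : ℝ) ^ (K + 1) = 1 := by rw [pow_succ, e0]; norm_num
  have e2 : (-1 : ℝ) ^ (K + 2) = -1 := by rw [pow_succ, e1]; norm_num
  have e3 : (-1 : ℝ) ^ (K + 3) = 1 := by rw [pow_succ, e2]; norm_num
  rw [e0, e1, e2, e3]
  by_cases a : lo ≤ i
  · by_cases c : hi ≤ i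
    · simp [a, c, not_lt.2 c]
    · simp [a, c, not_le.1 c]; ring
  · have : ¬ hi ≤ i := by omega
    simp [a, this]

/-- Leaving a heavy path upwards at least doubles the weight `sz`, which is at most `n`, so each
endpoint does this at most `log n` times; one more step along a common path ends the walk. With four
boundaries for each step and the initial boundary 0 this makes `4 (2 log n + 1) + 1 = 8 log n + 5`.
-/
theorem walk_spec {W : ℕ} (s : State) (n : ℕ) (pp hd sz : ℕ → ℕ) (hT : PosTree n pp hd sz)
    (x y : ℕ) (hx : s.intVar 40 = x) (hy : s.intVar 41 = y) (hxn : x < n) (hyn : y < n)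
    (hhd : s.intArr 14 = hd) (hpp : s.intArr 26 = pp) (hW : 20 * n + 20 ≤ W) :
    Spec W walk s (400 * Nat.log 2 n + 300) fun s' => ∃ K, s'.intVar 30 = K ∧
      K ≤ 8 * Nat.log 2 n + 5 ∧ (∀ k < K, s'.intArr 16 k ≤ n) ∧
      ∀ i, altSum (s'.intArr 16) K i = 1 - 2 * sepI pp i x y := by
  have hL : Nat.log 2 n < n := Nat.log_lt_self 2 (by omega)
  have m0 : 1 % W = 1 := Nat.mod_eq_of_lt (by omega)
  have m2 : 2 % W = 2 := Nat.mod_eq_of_lt (by omega)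
  have m3 : 3 % W = 3 := Nat.mod_eq_of_lt (by omega)
  have m4 : 4 % W = 4 := Nat.mod_eq_of_lt (by omega)
  simp only [Spec, walk, wp_seq, wp_setInt, wp_storeInt, IntExp.eval, Nat.zero_mod, m0]
  -- The boundaries written so far together with the part of the path still to be walked account for
  -- the whole path; `M` bounds the number of remaining steps as long as the endpoints differ.
  let Inv : State → ℕ → Prop := fun s' N => ∃ K x' y' M, s'.intVar 30 = K ∧ s'.intVar 40 = x' ∧
    s'.intVar 41 = y' ∧ x' < n ∧ y' < n ∧ Odd K ∧ K + 4 * M ≤ 8 * Nat.log 2 n + 5 ∧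
    (∀ k < K, s'.intArr 16 k ≤ n) ∧
    (∀ i, altSum (s'.intArr 16) K i - 2 * sepI pp i x' y' = 1 - 2 * sepI pp i x y) ∧
    (x' ≠ y' → (Nat.log 2 n - Nat.log 2 (sz x')) + (Nat.log 2 n - Nat.log 2 (sz y')) + 1 ≤ M) ∧
    N = 120 * M
  refine (WP.loop (s := (s.setIntArr 16 0 0).setIntVar 30 1) (Inv := Inv)
    (120 * (2 * Nat.log 2 n + 1)) ?_ ?_).frame.mono ?_
  · refine ⟨1, x, y, 2 * Nat.log 2 n + 1, by simp, by simpa using hx, by simpa using hy, hxn, hyn,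
      odd_one, by omega, fun k hk => ?_, fun i => ?_, fun _ => by omega, rfl⟩
    · obtain rfl : k = 0 := by omega
      simp
    · simp [altSum]
  · rintro s1 N f1 ⟨K, x', y', M, hK, hx', hy', hxn', hyn', hodd, hKM, hb16, hsum, hM, rfl⟩ hne
    have e14 : s1.intArr 14 = hd := (f1.ia 14 rfl).trans (by simpa using hhd)
    have e26 : s1.intArr 26 = pp := (f1.ia 26 rfl).trans (by simpa using hpp)
    simp only [Test.Holds, IntExp.eval, hx', hy'] at hne
    have key : ∀ (s2 : State) (x2 y2 : ℕ), s2.intVar 30 = K → s2.intVar 40 = x2 →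
        s2.intVar 41 = y2 → s2.intArr = s1.intArr → x2 < n → y2 < x2 →
        (∀ i, altSum (s1.intArr 16) K i - 2 * sepI pp i x2 y2 = 1 - 2 * sepI pp i x y) →
        ((Nat.log 2 n - Nat.log 2 (sz x2)) + (Nat.log 2 n - Nat.log 2 (sz y2)) + 1 ≤ M) →
        Spec W walkStep s2 90
          (fun s3 => ∃ N', Inv s3 N' ∧ N' + 120 ≤ 120 * M) := by
      intro s2 x2 y2 h30 h40 h41 hia hx2 hyx hsum2 hM2
      have mx : (x2 + 1) % W = x2 + 1 := Nat.mod_eq_of_lt (by omega)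
      have my : (y2 + 1) % W = y2 + 1 := Nat.mod_eq_of_lt (by omega)
      have mK1 : (K + 1) % W = K + 1 := Nat.mod_eq_of_lt (by omega)
      have mK2 : (K + 2) % W = K + 2 := Nat.mod_eq_of_lt (by omega)
      have mK3 : (K + 3) % W = K + 3 := Nat.mod_eq_of_lt (by omega)
      have mK4 : (K + 4) % W = K + 4 := Nat.mod_eq_of_lt (by omega)
      have fin : ∀ (s3 : State) (lo z : ℕ), s3.intVar 30 = K + 4 → s3.intVar 40 = z →
          s3.intVar 41 = y2 → s3.intArr 16 = Function.update (Function.update (Function.update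
            (Function.update (s1.intArr 16) K lo) (K + 1) (x2 + 1)) (K + 2) lo) (K + 3) (x2 + 1) →
          lo ≤ x2 + 1 → z < n →
          (∀ i, sepI pp i x2 y2 = sepI pp i z y2 + if lo ≤ i ∧ i < x2 + 1 then 1 else 0) →
          (z ≠ y2 → (Nat.log 2 n - Nat.log 2 (sz z)) + 1 ≤ (Nat.log 2 n - Nat.log 2 (sz x2))) →
          ∃ N', Inv s3 N' ∧ N' + 120 ≤ 120 * M := by
        intro s3 lo z g30 g40 g41 g16 hlo hz hsep hpot
        have n1 : K + 1 ≠ K := by omega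
        have u0 : s3.intArr 16 K = lo := by rw [g16]; simp
        have u1 : s3.intArr 16 (K + 1) = x2 + 1 := by rw [g16]; simp
        have u2 : s3.intArr 16 (K + 2) = lo := by rw [g16]; simp
        have u3 : s3.intArr 16 (K + 3) = x2 + 1 := by rw [g16]; simp
        have u : ∀ k < K, s3.intArr 16 k = s1.intArr 16 k := by
          intro k hk
          rw [g16, Function.update_of_ne (by omega), Function.update_of_ne (by omega),
            Function.update_of_ne (by omega), Function.update_of_ne (by omega)]
        refine ⟨_, ⟨K + 4, z, y2, M - 1, g30, g40, g41, hz, by omega, ?_, by omega, ?_, fun i => ?_,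
          fun hne => ?_, rfl⟩, by omega⟩
        · exact hodd.add_even (by decide)
        · intro k hk
          rcases Nat.lt_or_ge k K with h | h
          · rw [u k h]; exact hb16 k h
          · have : k = K ∨ k = K + 1 ∨ k = K + 2 ∨ k = K + 3 := by omega
            rcases this with rfl | rfl | rfl | rfl <;> omega
        · rw [altSum_four hodd hlo u u0 u1 u2 u3, ← hsum2 i, hsep i]
          ring
        · have := hpot hne
          omega
      simp only [Spec, walkStep, wp_seq, wp_setInt, wp_storeInt, wp_cond, IntExp.eval, Test.Holds,
        setIntVar_intVar, setIntVar_intArr, h40, h41, h30, hia, e14, e26, reduceIte,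
        Nat.reduceEqDiff, m0, m2, m3, m4, mx, my, mK1, mK2, mK3, mK4, setIntArr_intVar]
      refine ⟨fun hh => ⟨by simp, ?_⟩, fun hh => ⟨by simp, ?_⟩⟩
      · refine fin _ (y2 + 1) y2 (by simp) (by simp) (by simpa using h41) (by simp [hia]) (by omega)
          (by omega) (fun i => hT.sepI_same hx2 hyx hh) (fun h => absurd rfl h)
      · have h0 := (hT.sepI_diff (v := 0) hx2 hyx hh).1
        have hle := (hT.segment x2 hx2).1
        have hlt := hT.lt (hd x2) (by omega) (by omega)
        refine fin _ (hd x2) (pp (hd x2)) (by simp) (by simp) (by simpa using h41) (by simp [hia])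
          (by omega) (by omega) (fun i => (hT.sepI_diff hx2 hyx hh).2) (fun _ => ?_)
        have z1 := hT.sz_chain hx2 le_rfl hle
        have z2 := hT.sz_two (hd x2) (by omega) (by omega) (hT.segment x2 hx2).2.1
        have z3 := hT.sz_pos x2 hx2
        have z4 := hT.sz_pos (pp (hd x2)) (by omega)
        have l1 : Nat.log 2 (sz x2) + 1 ≤ Nat.log 2 (sz (pp (hd x2))) := by
          rw [← Nat.log_mul_base (by norm_num) (by omega)]
          exact Nat.log_mono_right (by omega)
        have l2 : Nat.log 2 (sz (pp (hd x2))) ≤ Nat.log 2 n := Nat.log_mono_right z4.2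
        omega
    rw [wp_seq]
    simp only [wp_cond, wp_skip, wp_setInt, wp_seq, Test.Holds, IntExp.eval, hx', hy',
      setIntVar_intVar, reduceIte, Nat.reduceEqDiff]
    refine ⟨fun hlt => ?_, fun hlt => ?_⟩
    · refine Spec.wp (key _ y' x' ?_ ?_ ?_ ?_ hyn' hlt (fun i => ?_) ?_)
        fun s3 t3 f3 ht3 h3 => ?_
      · simpa using hK
      · simp
      · simp
      · rfl
      · rw [sepI_comm]; exact hsum i
      · have := hM hne; omega
      · obtain ⟨N', h4, h5⟩ := h3
        refine ⟨N', h4, ?_⟩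
        simp only [IntExp.steps, Test.steps]
        omega
    · refine Spec.wp (key _ x' y' ?_ ?_ ?_ ?_ hxn' (by omega) hsum ?_)
        fun s3 t3 f3 ht3 h3 => ?_
      · simpa using hK
      · exact hx'
      · exact hy'
      · rfl
      · exact hM hne
      · obtain ⟨N', h4, h5⟩ := h3
        refine ⟨N', h4, ?_⟩
        simp only [IntExp.steps, Test.steps]
        omega
  · rintro s2 t2 ⟨f2, N, ⟨K, x', y', M, hK, hx', hy', hxn', hyn', hodd, hKM, hb16, hsum, hM, rfl⟩,
      ht2, hne⟩
    simp only [Test.Holds, IntExp.eval, hx', hy', not_not] at hne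
    subst hne
    refine ⟨?_, K, hK, by omega, hb16, fun i => ?_⟩
    · simp only [IntExp.steps, Test.steps] at ht2 ⊢
      omega
    · have := hsum i
      rw [sepI_self] at this
      linarith

end RealRAM

namespace RealRAM

/-! ## The events of all edges -/

/-- Store the events of the arc in integer variable 47 with first endpoint in integer variable 46,
and add its weight to real variable 4. -/
def arcBody : Cmd :=
  .setInt 40 (.arr 13 (.var 46)) ;; .setInt 41 (.arr 13 (.arr 1 (.var 47))) ;;
  walk ;;
  .setReal 2 (.sub .zero (.arr 0 (.var 47))) ;; .setReal 4 (.add (.var 4) (.arr 0 (.var 47))) ;;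
  pushProd ;; .setInt 47 (.add (.var 47) (.lit 1))

/-- Store the events of all arcs. -/
def arcsLoop : Cmd :=
  .setInt 46 (.lit 0) ;;
  .loop (.intLt (.var 46) (.var 0))
   (.setInt 47 (.arr 0 (.var 46)) ;;
    .loop (.intLt (.var 47) (.arr 0 (.add (.var 46) (.lit 1)))) arcBody ;;
    .setInt 46 (.add (.var 46) (.lit 1)))

/-- The largest number of events of one arc. -/
def arcEvents (n : ℕ) : ℕ := (8 * Nat.log 2 n + 5) * (8 * Nat.log 2 n + 5)

/-- The contribution of an arc between positions `x` and `y` to the matrix. -/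
noncomputable def arcTerm (pp : ℕ → ℕ) (w : ℝ) (x y i j : ℕ) : ℝ :=
  -w * (1 - 2 * sepI pp i x y) * (1 - 2 * sepI pp j x y)

theorem arcBody_spec {W : ℕ} (s : State) (n : ℕ) (pp hd sz : ℕ → ℕ) (hT : PosTree n pp hd sz)
    (rows : ℕ → List ℕ) (x y j : ℕ) (hj : s.intVar 47 = j)
    (hx : s.intArr 13 (s.intVar 46) = x) (hy : s.intArr 13 (s.intArr 1 j) = y) (hxn : x < n)
    (hyn : y < n) (hhd : s.intArr 14 = hd) (hpp : s.intArr 26 = pp) (hW : 20 * n + 20 ≤ W)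
    (hE : Events n s rows) (hW2 : s.intVar 33 + 4 * arcEvents n ≤ W) (hjW : j + 2 ≤ W) :
    Spec W arcBody s (300 * arcEvents n) fun s' => s'.intVar 47 = j + 1 ∧
      s'.intVar 33 ≤ s.intVar 33 + arcEvents n ∧ s'.realVar 4 = s.realVar 4 + s.realArr 0 j ∧
      ∃ rows', Events n s' rows' ∧ ∀ i k, evMat s' rows' i k = evMat s rows i k +
        arcTerm pp (s.realArr 0 j) x y i k := by
  simp only [Spec, arcBody, wp_seq, wp_setInt, IntExp.eval, setIntVar_intVar, setIntVar_intArr, hj,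
    reduceIte, Nat.reduceEqDiff, hx, hy]
  refine (walk_spec ((s.setIntVar 40 x).setIntVar 41 y) n pp hd sz hT x y (by simp) (by simp) hxn
    hyn (by simpa using hhd) (by simpa using hpp) hW).wp fun s1 t1 f1 ht1 h1 => ?_
  obtain ⟨K, hK, hKL, hb, hsum⟩ := h1
  have e47 : s1.intVar 47 = j := (f1.iv 47 rfl).trans (by simpa using hj)
  have e33 : s1.intVar 33 = s.intVar 33 := (f1.iv 33 rfl).trans (by simp)
  have er0 : s1.realArr 0 = s.realArr 0 := f1.ra 0 rfl
  have er4 : s1.realVar 4 = s.realVar 4 := f1.rv 4 rfl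
  have hKK : K * K ≤ arcEvents n := Nat.mul_le_mul hKL hKL
  have hKe : K ≤ arcEvents n := hKL.trans (Nat.le_mul_self _)
  have hE0 : 8 * Nat.log 2 n + 5 ≤ arcEvents n := Nat.le_mul_self _
  have hE25 : 25 ≤ arcEvents n := by unfold arcEvents; nlinarith
  have hlog : 40 * Nat.log 2 n ≤ arcEvents n := by unfold arcEvents; nlinarith
  have hlog2 : 5 * K ≤ arcEvents n := (Nat.mul_le_mul_left 5 hKL).trans (by
    unfold arcEvents; nlinarith)
  simp only [wp_setReal, RealExp.eval, IntExp.eval, e47, setRealVar_realArr, setRealVar_intVar,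
    setRealVar_realVar, reduceIte, Nat.reduceEqDiff, er0, er4]
  refine (pushProd_spec ((s1.setRealVar 2 (0 - s.realArr 0 j)).setRealVar 4
    (s.realVar 4 + s.realArr 0 j)) n rows K (s1.intArr 16) (0 - s.realArr 0 j) (by simpa using hK) (by simp)
    (by simp) hb (by simp only [setRealVar_intVar, e33]; omega)
    (hE.congr (f1.ia 17 rfl) (f1.ia 18 rfl) (f1.ia 19 rfl) (f1.iv 33 rfl))).wp
    fun s2 t2 f2 ht2 h2 => ?_
  obtain ⟨h33, rows', hE', hM⟩ := h2
  have e47' : s2.intVar 47 = j := (f2.iv 47 rfl).trans (by simpa using e47)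
  have mj : (j + 1 % W) % W = j + 1 := by
    rw [Nat.mod_eq_of_lt (show 1 < W by omega), Nat.mod_eq_of_lt (by omega)]
  simp only [e47', mj, setIntVar_realVar]
  refine ⟨?_, trivial, ?_, ?_, rows', hE'.congr rfl rfl rfl rfl, fun i k => ?_⟩
  · simp only [IntExp.steps, RealExp.steps]
    omega
  · rw [h33, setRealVar_intVar, setRealVar_intVar, e33]
    omega
  · rw [f2.rv 4 rfl]
    simp
  · have : evMat ((s1.setRealVar 2 (0 - s.realArr 0 j)).setRealVar 4
        (s.realVar 4 + s.realArr 0 j)) rows = evMat s rows :=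
      evMat_congr rows (f1.ia 19 rfl) (f1.ra 1 rfl)
    rw [evMat_setIntVar, hM, this, hsum, hsum, arcTerm, zero_sub]

/-- Every edge is met twice, once as each of its arcs. An arc that does not cross a cut contributes
minus its weight there, so the total weight of the arcs is collected as well: the threshold for the
matrix has to be corrected by it. -/
theorem arcsLoop_spec {W : ℕ} (s : State) (n : ℕ) (pp hd sz : ℕ → ℕ) (hT : PosTree n pp hd sz)
    (rows : ℕ → List ℕ) (off tgt pos : ℕ → ℕ) (w : ℕ → ℝ) (h0 : s.intVar 0 = n)
    (hoff : s.intArr 0 = off) (htgt : s.intArr 1 = tgt) (hpos : s.intArr 13 = pos)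
    (hw : s.realArr 0 = w) (hoff0 : off 0 = 0) (hmono : ∀ u v, u ≤ v → v ≤ n → off u ≤ off v)
    (htn : ∀ j < off n, tgt j < n) (hpn : ∀ u < n, pos u < n)
    (hhd : s.intArr 14 = hd) (hpp : s.intArr 26 = pp) (hW : 20 * n + 20 ≤ W)
    (hE : Events n s rows) (hq : s.intVar 33 = 0) (hr4 : s.realVar 4 = 0)
    (hW2 : (off n + 4) * arcEvents n ≤ W) :
    Spec W arcsLoop s (400 * arcEvents n * off n + 100 * n + 100) fun s' =>
      s'.intVar 33 ≤ off n * arcEvents n ∧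
      s'.realVar 4 = ∑ u ∈ Finset.range n, ∑ j ∈ Finset.Ico (off u) (off (u + 1)), w j ∧
      ∃ rows', Events n s' rows' ∧ ∀ i k, evMat s' rows' i k = evMat s rows i k +
        ∑ u ∈ Finset.range n, ∑ j ∈ Finset.Ico (off u) (off (u + 1)),
          arcTerm pp (w j) (pos u) (pos (tgt j)) i k := by
  have hE25 : 25 ≤ arcEvents n := by unfold arcEvents; nlinarith
  have hoW : off n * arcEvents n + 4 * arcEvents n ≤ W := by rwa [← Nat.add_mul]
  have hoW' : off n * 25 ≤ off n * arcEvents n := Nat.mul_le_mul_left _ hE25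
  have m1 : 1 % W = 1 := Nat.mod_eq_of_lt (by omega)
  simp only [Spec, arcsLoop, wp_seq, wp_setInt, IntExp.eval, Nat.zero_mod]
  refine (WP.loop (s := s.setIntVar 46 0) (Inv := fun s' N => ∃ u rows', s'.intVar 46 = u ∧ u ≤ n ∧
      s'.intVar 33 ≤ off u * arcEvents n ∧
      s'.realVar 4 = ∑ u ∈ Finset.range u, ∑ j ∈ Finset.Ico (off u) (off (u + 1)), w j ∧
      Events n s' rows' ∧ (∀ i k, evMat s' rows' i k = evMat s rows i k +
        ∑ u ∈ Finset.range u, ∑ j ∈ Finset.Ico (off u) (off (u + 1)),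
          arcTerm pp (w j) (pos u) (pos (tgt j)) i k) ∧
      N = 400 * arcEvents n * (off n - off u) + 80 * (n - u))
      (400 * arcEvents n * off n + 80 * n)
      ⟨0, rows, by simp, by omega, by simp [hq], by simpa using hr4, hE.congr rfl rfl rfl rfl,
        fun i k => by simp, by simp [hoff0]⟩ ?_).frame.mono ?_
  · rintro s1 N f1 ⟨u, rows1, hu, hun, h33, h4, hE1, hM1, rfl⟩ hlt
    have e0 : s1.intVar 0 = n := (f1.iv 0 rfl).trans (by simpa using h0)
    have eo : s1.intArr 0 = off := (f1.ia 0 rfl).trans (by simpa using hoff)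
    simp only [Test.Holds, IntExp.eval, hu, e0] at hlt
    have hou := hmono u (u + 1) (by omega) hlt
    have hon := hmono (u + 1) n hlt le_rfl
    have mu : (u + 1) % W = u + 1 := Nat.mod_eq_of_lt (by omega)
    simp only [wp_seq, wp_setInt, IntExp.eval, hu, eo]
    refine (WP.loop (s := s1.setIntVar 47 (off u)) (Inv := fun s' N => ∃ j rows',
      s'.intVar 47 = j ∧ off u ≤ j ∧ j ≤ off (u + 1) ∧
      s'.intVar 33 ≤ j * arcEvents n ∧
      s'.realVar 4 = s1.realVar 4 + ∑ j ∈ Finset.Ico (off u) j, w j ∧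
      Events n s' rows' ∧ (∀ i k, evMat s' rows' i k = evMat s1 rows1 i k +
        ∑ j ∈ Finset.Ico (off u) j, arcTerm pp (w j) (pos u) (pos (tgt j)) i k) ∧
      N = 350 * arcEvents n * (off (u + 1) - j)) (350 * arcEvents n * (off (u + 1) - off u))
      ⟨off u, rows1, by simp, by omega, hou, by simpa using h33, by simp,
        hE1.congr rfl rfl rfl rfl, fun i k => by simp, rfl⟩ ?_).frame.mono ?_
    · rintro s2 N f2 ⟨j, rows2, hj, huj, hju, h33', h4', hE2, hM2, rfl⟩ hlt2
      have e46 : s2.intVar 46 = u := (f2.iv 46 rfl).trans (by simpa using hu)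
      have eo2 : s2.intArr 0 = off := (f2.ia 0 rfl).trans (by simpa using eo)
      have et2 : s2.intArr 1 = tgt := (f2.ia 1 rfl).trans ((f1.ia 1 rfl).trans (by simpa using htgt))
      have ep2 : s2.intArr 13 = pos :=
        (f2.ia 13 rfl).trans ((f1.ia 13 rfl).trans (by simpa using hpos))
      have eh2 : s2.intArr 14 = hd :=
        (f2.ia 14 rfl).trans ((f1.ia 14 rfl).trans (by simpa using hhd))
      have epp2 : s2.intArr 26 = pp :=
        (f2.ia 26 rfl).trans ((f1.ia 26 rfl).trans (by simpa using hpp))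
      have ew2 : s2.realArr 0 = w := (f2.ra 0 rfl).trans ((f1.ra 0 rfl).trans (by simpa using hw))
      simp only [Test.Holds, IntExp.eval, hj, e46, eo2, m1, mu] at hlt2
      have hjn : j < off n := by omega
      have hjA : j * arcEvents n ≤ off n * arcEvents n := Nat.mul_le_mul_right _ hjn.le
      refine (arcBody_spec s2 n pp hd sz hT rows2 (pos u) (pos (tgt j)) j hj (by rw [ep2, e46])
        (by rw [ep2, et2]) (hpn u hlt) (hpn _ (htn j hjn)) eh2 epp2 hW hE2 (by omega)
        (by omega)).wp fun s3 t3 f3 ht3 h3 => ?_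
      obtain ⟨hj3, h333, h43, rows3, hE3, hM3⟩ := h3
      refine ⟨_, ⟨j + 1, rows3, hj3, by omega, hlt2, ?_, ?_, hE3, fun i k => ?_, rfl⟩, ?_⟩
      · rw [Nat.succ_mul]; omega
      · rw [h43, h4', Finset.sum_Ico_succ_top huj, ew2, add_assoc]
      · rw [hM3, hM2, Finset.sum_Ico_succ_top huj, ew2, add_assoc]
      · obtain ⟨d, hd⟩ : ∃ d, off (u + 1) = j + 1 + d := ⟨off (u + 1) - (j + 1), by omega⟩
        have e1 : off (u + 1) - j = d + 1 := by omega
        have e2 : off (u + 1) - (j + 1) = d := by omega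
        rw [e1, e2, Nat.mul_add (350 * arcEvents n) d 1]
        generalize 350 * arcEvents n * d = z
        simp only [IntExp.steps, Test.steps]
        omega
    · rintro s2 t2 ⟨f2, N, ⟨j, rows2, hj, huj, hju, h33', h4', hE2, hM2, rfl⟩, ht2, hlt2⟩
      have e46 : s2.intVar 46 = u := (f2.iv 46 rfl).trans (by simpa using hu)
      have eo2 : s2.intArr 0 = off := (f2.ia 0 rfl).trans (by simpa using eo)
      simp only [Test.Holds, IntExp.eval, hj, e46, eo2, m1, mu] at hlt2
      obtain rfl : j = off (u + 1) := by omega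
      simp only [e46, m1, mu]
      refine ⟨_, ⟨u + 1, rows2, by simp, hlt, by simpa using h33', ?_, hE2.congr rfl rfl rfl rfl,
        fun i k => ?_, rfl⟩, ?_⟩
      · rw [setIntVar_realVar, h4', h4, Finset.sum_range_succ]
      · rw [evMat_setIntVar, hM2, hM1, Finset.sum_range_succ, add_assoc]
      · have e1 : off n - off u = (off n - off (u + 1)) + (off (u + 1) - off u) := by omega
        rw [e1, Nat.mul_add (400 * arcEvents n)]
        have : 350 * arcEvents n * (off (u + 1) - off u) ≤
            400 * arcEvents n * (off (u + 1) - off u) :=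
          Nat.mul_le_mul_right _ (by omega)
        generalize 400 * arcEvents n * (off (u + 1) - off u) = z at *
        generalize 400 * arcEvents n * (off n - off (u + 1)) = z at *
        simp only [IntExp.steps, Test.steps] at ht2 ⊢
        omega
  · rintro s2 t2 ⟨f2, N, ⟨u, rows2, hu, hun, h33, h4, hE2, hM2, rfl⟩, ht2, hlt2⟩
    have e0 : s2.intVar 0 = n := (f2.iv 0 rfl).trans (by simpa using h0)
    simp only [Test.Holds, IntExp.eval, hu, e0] at hlt2
    obtain rfl : u = n := by omega
    refine ⟨?_, h33, h4, rows2, hE2, hM2⟩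
    simp only [IntExp.steps, Test.steps] at ht2 ⊢
    omega

end RealRAM

namespace RealRAM

/-! ## The events of the vertices of degree two -/

/-- The position of the tree edge between `u` and `v`, stored at its lower endpoint. -/
def edgePos (par pos : ℕ → ℕ) (u v : ℕ) : ℕ := if par u = v then pos u else pos v

/-- The number of elements of the list `[p, q]` that are equal to `i`. -/
def pairInd (p q i : ℕ) : ℝ := (if i = p then 1 else 0) + if i = q then 1 else 0

/-- Here there is no initial boundary 0, so the signs start with `+`, and the steps at `p` and `p +
1` leave the indicator of `{p}`. -/
theorem altSum_pair {b : ℕ → ℕ} {p q : ℕ} (h0 : b 0 = p) (h1 : b 1 = p + 1) (h2 : b 2 = q)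
    (h3 : b 3 = q + 1) (i : ℕ) : altSum b 4 i = pairInd p q i := by
  have key : ∀ p : ℕ, (if p ≤ i then (1 : ℝ) else 0) - (if p + 1 ≤ i then 1 else 0) =
      if i = p then 1 else 0 := by
    intro p
    rcases Nat.lt_trichotomy i p with h | h | h
    · simp [not_le.2 h, h.ne, show ¬ p + 1 ≤ i by omega]
    · simp [h]
    · simp [h.le, h.ne', Nat.succ_le_of_lt h]
  unfold altSum pairInd
  rw [← key p, ← key q]
  simp only [Finset.sum_range_succ, Finset.sum_range_zero, h0, h1, h2, h3]
  split_ifs <;> norm_num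

/-- Replace the vertex in integer variable `x` by the position of its edge to the vertex in integer
variable 46. -/
def loadEdgePos (x : ℕ) : Cmd :=
  .cond (.intEq (.arr 8 (.var 46)) (.var x)) (.setInt x (.arr 13 (.var 46)))
    (.setInt x (.arr 13 (.var x)))

/-- The boundary list of the edges whose positions are in integer variables 40 and 41. -/
def pairList : Cmd :=
  .storeInt 16 (.lit 0) (.var 40) ;; .storeInt 16 (.lit 1) (.add (.var 40) (.lit 1)) ;;
  .storeInt 16 (.lit 2) (.var 41) ;; .storeInt 16 (.lit 3) (.add (.var 41) (.lit 1)) ;;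
  .setInt 30 (.lit 4)

/-- Store the events of the two edges at the vertex in integer variable 46. -/
def degreeTwoEvents : Cmd :=
  .setInt 40 (.arr 3 (.arr 2 (.var 46))) ;;
  .setInt 41 (.arr 3 (.add (.arr 2 (.var 46)) (.lit 1))) ;;
  loadEdgePos 40 ;; loadEdgePos 41 ;; pairList ;; pushProd

/-- Store the events of all vertices of degree two, with the weight in real variable 2. -/
def degreeTwoLoop : Cmd :=
  .setInt 46 (.lit 0) ;;
  .loop (.intLt (.var 46) (.var 0))
   (.cond (.intEq (.sub (.arr 2 (.add (.var 46) (.lit 1))) (.arr 2 (.var 46))) (.lit 2))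
      degreeTwoEvents .skip ;;
    .setInt 46 (.add (.var 46) (.lit 1)))

theorem loadEdgePos_spec {W : ℕ} (s : State) (x : ℕ) : Spec W (loadEdgePos x) s 10 fun s' =>
    s' = s.setIntVar x (edgePos (s.intArr 8) (s.intArr 13) (s.intVar 46) (s.intVar x)) := by
  simp only [Spec, loadEdgePos, wp_cond, wp_setInt, Test.Holds, IntExp.eval, IntExp.steps,
    Test.steps, edgePos]
  refine ⟨fun h => ⟨by omega, by rw [if_pos h]⟩, fun h => ⟨by omega, by rw [if_neg h]⟩⟩

/-- The tensor square of the indicator of two positions takes `4 * 4` events. It also changes the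
two diagonal entries, which is harmless: they are never candidates. -/
theorem degreeTwoEvents_spec {W : ℕ} (s : State) (n : ℕ) (rows : ℕ → List ℕ)
    (off tgt par pos : ℕ → ℕ) (u p q : ℕ) (κ : ℝ) (hu : s.intVar 46 = u) (hoff : s.intArr 2 = off)
    (htgt : s.intArr 3 = tgt) (hpar : s.intArr 8 = par) (hpos : s.intArr 13 = pos)
    (hκ : s.realVar 2 = κ) (hp : edgePos par pos u (tgt (off u)) = p)
    (hq : edgePos par pos u (tgt (off u + 1)) = q) (hpn : p < n) (hqn : q < n)
    (hoW : off u + 2 ≤ W) (hW : s.intVar 33 + n + 40 ≤ W) (hE : Events n s rows) :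
    Spec W degreeTwoEvents s 2200 fun s' => s'.intVar 33 = s.intVar 33 + 16 ∧
      ∃ rows', Events n s' rows' ∧ ∀ i k, evMat s' rows' i k = evMat s rows i k +
        κ * pairInd p q i * pairInd p q k := by
  have m0 : 0 % W = 0 := Nat.zero_mod _
  have m1 : 1 % W = 1 := Nat.mod_eq_of_lt (by omega)
  have m2 : 2 % W = 2 := Nat.mod_eq_of_lt (by omega)
  have m3 : 3 % W = 3 := Nat.mod_eq_of_lt (by omega)
  have m4 : 4 % W = 4 := Nat.mod_eq_of_lt (by omega)
  have mo : (off u + 1) % W = off u + 1 := Nat.mod_eq_of_lt (by omega)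
  have mp : (p + 1) % W = p + 1 := Nat.mod_eq_of_lt (by omega)
  have mq : (q + 1) % W = q + 1 := Nat.mod_eq_of_lt (by omega)
  rw [Spec, degreeTwoEvents, wp_seq, wp_setInt, wp_seq, wp_setInt, wp_seq]
  refine (loadEdgePos_spec _ 40).wp fun s1 t1 f1 ht1 h1 => ?_
  rw [wp_seq]
  refine (loadEdgePos_spec _ 41).wp fun s2 t2 f2 ht2 h2 => ?_
  subst h1
  simp only [setIntVar_intVar, setIntVar_intArr, hu, htgt, hoff, hpar, hpos, reduceIte,
    Nat.reduceEqDiff, IntExp.eval, m1, mo, hp, hq] at h2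
  simp only [pairList, wp_seq, wp_setInt, wp_storeInt, IntExp.eval, m0, m1, m2, m3, m4,
    setIntArr_intVar]
  have e40 : s2.intVar 40 = p := by rw [h2]; simp
  have e41 : s2.intVar 41 = q := by rw [h2]; simp
  have e33 : s2.intVar 33 = s.intVar 33 := by rw [h2]; simp
  have ea : s2.intArr = s.intArr := by rw [h2]; simp
  have er : s2.realArr = s.realArr := by rw [h2]; simp
  have ev : s2.realVar = s.realVar := by rw [h2]; simp
  simp only [e40, e41, mp, mq]
  generalize hs3 : ((((s2.setIntArr 16 0 p).setIntArr 16 1 (p + 1)).setIntArr 16 2 q).setIntArr 16 3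
    (q + 1)).setIntVar 30 4 = s3
  have b33 : s3.intVar 33 = s.intVar 33 := by rw [← hs3]; simpa using e33
  have b16 : s3.intArr 16 0 = p ∧ s3.intArr 16 1 = p + 1 ∧ s3.intArr 16 2 = q ∧
      s3.intArr 16 3 = q + 1 := by rw [← hs3]; simp
  have b2 : s3.realVar 2 = κ := by rw [← hs3]; simpa [ev] using hκ
  have b17 : s3.intArr 17 = s.intArr 17 := by rw [← hs3]; simp [ea]
  have b18 : s3.intArr 18 = s.intArr 18 := by rw [← hs3]; simp [ea]
  have b19 : s3.intArr 19 = s.intArr 19 := by rw [← hs3]; simp [ea]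
  have br : s3.realArr 1 = s.realArr 1 := by rw [← hs3]; simp [er]
  refine (pushProd_spec s3 n rows 4 (s3.intArr 16) κ (by rw [← hs3]; simp) rfl b2
    (fun k hk => ?_) (by rw [b33]; omega) (hE.congr b17 b18 b19 b33)).wp fun s4 t4 f4 ht4 h4 => ?_
  · obtain rfl | rfl | rfl | rfl : k = 0 ∨ k = 1 ∨ k = 2 ∨ k = 3 := by omega
    all_goals omega
  · obtain ⟨h33, rows', hE', hM⟩ := h4
    refine ⟨by simp only [IntExp.steps]; omega, by omega, rows', hE', fun i k => ?_⟩
    rw [hM, evMat_congr rows b19 br, altSum_pair b16.1 b16.2.1 b16.2.2.1 b16.2.2.2,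
      altSum_pair b16.1 b16.2.1 b16.2.2.1 b16.2.2.2]

/-- The contribution of the vertex `u` of a tree with offsets `off` and neighbours `tgt` to the
matrix. -/
noncomputable def degreeTwoTerm (off tgt par pos : ℕ → ℕ) (κ : ℝ) (u i k : ℕ) : ℝ :=
  if off (u + 1) - off u = 2 then
    κ * pairInd (edgePos par pos u (tgt (off u))) (edgePos par pos u (tgt (off u + 1))) i *
      pairInd (edgePos par pos u (tgt (off u))) (edgePos par pos u (tgt (off u + 1))) k
  else 0

theorem degreeTwoLoop_spec {W : ℕ} (s : State) (n : ℕ) (rows : ℕ → List ℕ)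
    (off tgt par pos : ℕ → ℕ) (κ : ℝ) (h0 : s.intVar 0 = n) (hoff : s.intArr 2 = off)
    (htgt : s.intArr 3 = tgt) (hpar : s.intArr 8 = par) (hpos : s.intArr 13 = pos)
    (hκ : s.realVar 2 = κ) (hmono : ∀ u v, u ≤ v → v ≤ n → off u ≤ off v)
    (htn : ∀ j < off n, tgt j < n) (hpn : ∀ u < n, pos u < n) (hoW : off n + 2 ≤ W)
    (hW : s.intVar 33 + 20 * n + 60 ≤ W) (hE : Events n s rows) :
    Spec W degreeTwoLoop s (2300 * n + 20) fun s' => s'.intVar 33 ≤ s.intVar 33 + 16 * n ∧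
      ∃ rows', Events n s' rows' ∧ ∀ i k, evMat s' rows' i k = evMat s rows i k +
        ∑ u ∈ Finset.range n, degreeTwoTerm off tgt par pos κ u i k := by
  have m1 : 1 % W = 1 := Nat.mod_eq_of_lt (by omega)
  have m2 : 2 % W = 2 := Nat.mod_eq_of_lt (by omega)
  simp only [Spec, degreeTwoLoop, wp_seq, wp_setInt, IntExp.eval, Nat.zero_mod]
  refine (WP.loop (s := s.setIntVar 46 0) (Inv := fun s' N => ∃ u rows', s'.intVar 46 = u ∧ u ≤ n ∧
      s'.intVar 33 ≤ s.intVar 33 + 16 * u ∧ Events n s' rows' ∧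
      (∀ i k, evMat s' rows' i k = evMat s rows i k +
        ∑ u ∈ Finset.range u, degreeTwoTerm off tgt par pos κ u i k) ∧
      N = 2300 * (n - u)) (2300 * n)
      ⟨0, rows, by simp, by omega, by simp, hE.congr rfl rfl rfl rfl,
        fun i k => by simp, by simp⟩ ?_).frame.mono ?_
  · rintro s1 N f1 ⟨u, rows1, hu, hun, h33, hE1, hM1, rfl⟩ hlt
    have e0 : s1.intVar 0 = n := (f1.iv 0 rfl).trans (by simpa using h0)
    have eo : s1.intArr 2 = off := (f1.ia 2 rfl).trans (by simpa using hoff)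
    have et : s1.intArr 3 = tgt := (f1.ia 3 rfl).trans (by simpa using htgt)
    have epar : s1.intArr 8 = par := (f1.ia 8 rfl).trans (by simpa using hpar)
    have epos : s1.intArr 13 = pos := (f1.ia 13 rfl).trans (by simpa using hpos)
    have eκ : s1.realVar 2 = κ := (f1.rv 2 rfl).trans (by simpa using hκ)
    simp only [Test.Holds, IntExp.eval, hu, e0] at hlt
    have hon := hmono (u + 1) n hlt le_rfl
    have mu : (u + 1) % W = u + 1 := Nat.mod_eq_of_lt (by omega)
    have hep : ∀ v < n, edgePos par pos u v < n := fun v hv => by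
      unfold edgePos
      split_ifs
      · exact hpn u hlt
      · exact hpn v hv
    rw [wp_seq, wp_cond]
    simp only [Test.Holds, IntExp.eval, hu, eo, m1, m2, mu]
    refine ⟨fun h2 => ?_, fun h2 => ?_⟩
    · refine (degreeTwoEvents_spec s1 n rows1 off tgt par pos u _ _ κ hu eo et epar epos eκ rfl rfl
        (hep _ (htn _ (by omega))) (hep _ (htn _ (by omega))) (by omega) (by omega) hE1).wp
        fun s2 t2 f2 ht2 hs2 => ?_
      obtain ⟨h33', rows2, hE2, hM2⟩ := hs2
      have e46 : s2.intVar 46 = u := (f2.iv 46 rfl).trans hu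
      simp only [wp_setInt, IntExp.eval, e46, m1, mu]
      refine ⟨_, ⟨u + 1, rows2, by simp, hlt, ?_, hE2.congr rfl rfl rfl rfl, fun i k => ?_, rfl⟩, ?_⟩
      · simp only [setIntVar_intVar, Nat.reduceEqDiff, reduceIte]
        omega
      · rw [evMat_setIntVar, hM2, hM1, Finset.sum_range_succ, add_assoc]
        congr 2
        rw [degreeTwoTerm, if_pos h2]
      · simp only [IntExp.steps, Test.steps]
        omega
    · simp only [wp_skip, wp_setInt, IntExp.eval, hu, m1, mu]
      refine ⟨_, ⟨u + 1, rows1, by simp, hlt, ?_, hE1.congr rfl rfl rfl rfl, fun i k => ?_, rfl⟩, ?_⟩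
      · simp only [setIntVar_intVar, Nat.reduceEqDiff, reduceIte]
        omega
      · rw [evMat_setIntVar, hM1, Finset.sum_range_succ, degreeTwoTerm, if_neg h2, add_zero]
      · simp only [IntExp.steps, Test.steps]
        omega
  · rintro s2 t2 ⟨f2, N, ⟨u, rows2, hu, hun, h33, hE2, hM2, rfl⟩, ht2, hlt2⟩
    have e0 : s2.intVar 0 = n := (f2.iv 0 rfl).trans (by simpa using h0)
    simp only [Test.Holds, IntExp.eval, hu, e0] at hlt2
    obtain rfl : u = n := by omega
    refine ⟨?_, h33, rows2, hE2, hM2⟩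
    simp only [IntExp.steps, Test.steps] at ht2 ⊢
    omega

end RealRAM

namespace RealRAM

/-! ## Breadth first search -/

theorem le_of_injOn_lt {f : ℕ → ℕ} {t n : ℕ} (hf : ∀ k < t, f k < n)
    (hi : ∀ k < t, ∀ l < t, f k = f l → k = l) : t ≤ n := by
  have := Finset.card_le_card_of_injOn (s := Finset.range t) (t := Finset.range n) f
    (fun k hk => by simpa using hf k (by simpa using hk))
    (fun k hk l hl h => hi k (by simpa using hk) l (by simpa using hl) h)
  simpa using this

/-- `v` is a neighbour of `u` in the graph with offsets `off` and neighbours `tgt`. -/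
def ArcRel (off tgt : ℕ → ℕ) (u v : ℕ) : Prop := ∃ j, off u ≤ j ∧ j < off (u + 1) ∧ tgt j = v

/-- The first `t` entries of `ord` are vertices in search order with parents `par`, and `vis` marks
them. -/
structure Searched (n : ℕ) (R : ℕ → ℕ → Prop) (par vis ord : ℕ → ℕ) (t : ℕ) : Prop where
  pos : 1 ≤ t
  lt : ∀ k < t, ord k < n
  inj : ∀ k < t, ∀ l < t, ord k = ord l → k = l
  visited : ∀ v < n, vis v ≠ 0 ↔ ∃ k < t, ord k = v
  parent : ∀ k, 1 ≤ k → k < t → ∃ l < k, par (ord k) = ord l ∧ R (ord l) (ord k)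
  ord_zero : ord 0 = 0
  par_zero : par 0 = 0

theorem Searched.le {n : ℕ} {R : ℕ → ℕ → Prop} {par vis ord : ℕ → ℕ} {t : ℕ}
    (h : Searched n R par vis ord t) : t ≤ n := le_of_injOn_lt h.lt h.inj

theorem Searched.push {n : ℕ} {R : ℕ → ℕ → Prop} {par vis ord : ℕ → ℕ} {t : ℕ}
    (h : Searched n R par vis ord t) {i u : ℕ} (hi : i < t) (hu : u < n) (hv : vis u = 0)
    (hR : R (ord i) u) :
    Searched n R (Function.update par u (ord i)) (Function.update vis u 1)
      (Function.update ord t u) (t + 1) := by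
  have hfresh : ∀ k < t, ord k ≠ u := fun k hk e => (h.visited u hu).2 ⟨k, hk, e⟩ hv
  have h0 : u ≠ 0 := fun e => hfresh 0 (by omega) (h.ord_zero.trans e.symm)
  have ho : ∀ k < t, Function.update ord t u k = ord k := fun k hk =>
    Function.update_of_ne (by omega) _ _
  refine ⟨by omega, fun k hk => ?_, fun k hk l hl e => ?_, fun v hvn => ?_, fun k hk hkt => ?_, ?_, ?_⟩
  · rcases Nat.lt_succ_iff_lt_or_eq.1 hk with hk | rfl
    · rw [ho k hk]; exact h.lt k hk
    · simpa using hu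
  · rcases Nat.lt_succ_iff_lt_or_eq.1 hk with hk | rfl <;>
      rcases Nat.lt_succ_iff_lt_or_eq.1 hl with hl | rfl
    · rw [ho k hk, ho l hl] at e; exact h.inj k hk l hl e
    · rw [ho k hk, Function.update_self] at e; exact absurd e (hfresh k hk)
    · rw [ho l hl, Function.update_self] at e; exact absurd e.symm (hfresh l hl)
    · rfl
  · by_cases e : v = u
    · subst e
      simp only [Function.update_self, ne_eq, one_ne_zero, not_false_eq_true, true_iff]
      exact ⟨t, by omega, by simp⟩
    · rw [Function.update_of_ne e, h.visited v hvn]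
      constructor
      · rintro ⟨k, hk, hkv⟩
        exact ⟨k, by omega, by rw [ho k hk, hkv]⟩
      · rintro ⟨k, hk, hkv⟩
        rcases Nat.lt_succ_iff_lt_or_eq.1 hk with hk | rfl
        · exact ⟨k, hk, by rw [← ho k hk, hkv]⟩
        · rw [Function.update_self] at hkv; exact absurd hkv.symm e
  · rcases Nat.lt_succ_iff_lt_or_eq.1 hkt with hkt | rfl
    · obtain ⟨l, hl, h1, h2⟩ := h.parent k hk hkt
      refine ⟨l, hl, ?_, ?_⟩
      · rw [ho k hkt, ho l (by omega), Function.update_of_ne (hfresh k hkt), h1]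
      · rwa [ho k hkt, ho l (by omega)]
    · exact ⟨i, hi, by simp [ho i hi], by simpa [ho i hi] using hR⟩
  · rw [ho 0 (by have := h.pos; omega), h.ord_zero]
  · rw [Function.update_of_ne h0.symm, h.par_zero]

/-- Inspect the tree arc in integer variable 53, which starts in the vertex in integer variable
52. -/
def visitArc : Cmd :=
  .setInt 54 (.arr 3 (.var 53)) ;;
  .cond (.intEq (.arr 9 (.var 54)) (.lit 0))
   (.storeInt 9 (.var 54) (.lit 1) ;; .storeInt 8 (.var 54) (.var 52) ;;
    .storeInt 10 (.var 50) (.var 54) ;; .setInt 50 (.add (.var 50) (.lit 1))) .skip ;;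
  .setInt 53 (.add (.var 53) (.lit 1))

/-- Breadth first search of the tree from vertex `0`. -/
def search : Cmd :=
  .storeInt 9 (.lit 0) (.lit 1) ;; .setInt 50 (.lit 1) ;; .setInt 51 (.lit 0) ;;
  .loop (.intLt (.var 51) (.var 50))
   (.setInt 52 (.arr 10 (.var 51)) ;; .setInt 53 (.arr 2 (.var 52)) ;;
    .loop (.intLt (.var 53) (.arr 2 (.add (.var 52) (.lit 1)))) visitArc ;;
    .setInt 51 (.add (.var 51) (.lit 1)))

theorem visitArc_spec {W : ℕ} (s : State) (n : ℕ) (R : ℕ → ℕ → Prop) (i j t u : ℕ)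
    (h50 : s.intVar 50 = t) (h52 : s.intVar 52 = s.intArr 10 i) (h53 : s.intVar 53 = j)
    (hu : s.intArr 3 j = u) (hun : u < n) (hit : i < t) (hW : n + 1 ≤ W) (hj : j + 1 < W)
    (h1W : 1 < W)
    (hR : R (s.intArr 10 i) u)
    (hS : Searched n R (s.intArr 8) (s.intArr 9) (s.intArr 10) t) :
    Spec W visitArc s 40 fun s' => s'.intVar 53 = j + 1 ∧ ∃ t', t ≤ t' ∧ s'.intVar 50 = t' ∧
      (∀ k < t, s'.intArr 10 k = s.intArr 10 k) ∧
      (∀ v, s.intArr 9 v ≠ 0 → s'.intArr 9 v ≠ 0) ∧ s'.intArr 9 u ≠ 0 ∧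
      Searched n R (s'.intArr 8) (s'.intArr 9) (s'.intArr 10) t' := by
  have m0 : 0 % W = 0 := Nat.zero_mod _
  have m1 : 1 % W = 1 := Nat.mod_eq_of_lt h1W
  have mj : (j + 1) % W = j + 1 := Nat.mod_eq_of_lt hj
  simp only [Spec, visitArc, wp_seq, wp_setInt, wp_cond, wp_storeInt, wp_skip, Test.Holds,
    IntExp.eval, setIntVar_intVar, setIntVar_intArr, setIntArr_intVar, setIntArr_intArr, h50, h52,
    h53, hu, m0, m1, reduceIte, Nat.reduceEqDiff, mj]
  refine ⟨fun hv => ⟨by simp, trivial, t + 1, by omega, ?_, fun k hk => ?_, fun v hv' => ?_, by simp,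
    ?_⟩, fun hv => ⟨by simp, trivial, t, le_rfl, rfl, fun k hk => trivial, fun v => id, hv, hS⟩⟩
  · have := (hS.push hit hun hv hR).le
    exact Nat.mod_eq_of_lt (by omega)
  · exact Function.update_of_ne (by omega) _ _
  · by_cases e : v = u
    · simp [e]
    · rwa [Function.update_of_ne e]
  · exact hS.push hit hun hv hR

/-- The vertices in the queue are distinct, so their adjacency lists occupy disjoint parts of the
array of arcs. This bounds the total time of the inner loop of the search. -/
theorem sum_degree_le {off ord : ℕ → ℕ} {n t : ℕ} (hoff0 : off 0 = 0)
    (hmono : ∀ u v, u ≤ v → v ≤ n → off u ≤ off v) (hf : ∀ k < t, ord k < n)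
    (hi : ∀ k < t, ∀ l < t, ord k = ord l → k = l) :
    ∑ k ∈ Finset.range t, (off (ord k + 1) - off (ord k)) ≤ off n := by
  have h1 : ∀ m ≤ n, ∑ v ∈ Finset.range m, (off (v + 1) - off v) = off m := by
    intro m
    induction m with
    | zero => simp [hoff0]
    | succ m ih =>
      intro hm
      rw [Finset.sum_range_succ, ih (by omega)]
      have := hmono m (m + 1) (by omega) hm
      omega
  rw [← h1 n le_rfl]
  have : ∑ k ∈ Finset.range t, (off (ord k + 1) - off (ord k)) =
      ∑ v ∈ (Finset.range t).image ord, (off (v + 1) - off v) := by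
    rw [Finset.sum_image]
    intro k hk l hl e
    exact hi k (by simpa using hk) l (by simpa using hl) e
  rw [this]
  refine Finset.sum_le_sum_of_subset fun v hv => ?_
  obtain ⟨k, hk, rfl⟩ := Finset.mem_image.1 hv
  exact Finset.mem_range.2 (hf k (Finset.mem_range.1 hk))

/-- When the queue is exhausted, the visited vertices contain 0 and are closed under passing to
neighbours, so connectivity, in the form of `hconn`, makes them all vertices. -/
theorem search_spec {W : ℕ} (s : State) (n : ℕ) (off tgt : ℕ → ℕ) (hn : 1 ≤ n)
    (hoff : s.intArr 2 = off) (htgt : s.intArr 3 = tgt) (hoff0 : off 0 = 0)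
    (hmono : ∀ u v, u ≤ v → v ≤ n → off u ≤ off v) (htn : ∀ j < off n, tgt j < n)
    (hconn : ∀ C : ℕ → Prop, C 0 → (∀ u < n, C u → ∀ v, ArcRel off tgt u v → C v) → ∀ u < n, C u)
    (hW : 20 * n + 20 ≤ W) (hoW : off n + 2 ≤ W) (h8 : s.intArr 8 = fun _ => 0)
    (h9 : s.intArr 9 = fun _ => 0) (h10 : s.intArr 10 = fun _ => 0) :
    Spec W search s (60 * off n + 60 * n + 60) fun s' =>
      Searched n (ArcRel off tgt) (s'.intArr 8) (s'.intArr 9) (s'.intArr 10) n := by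
  have m0 : 0 % W = 0 := Nat.zero_mod _
  have m1 : 1 % W = 1 := Nat.mod_eq_of_lt (by omega)
  have hinit : Searched n (ArcRel off tgt) (fun _ => 0) (Function.update (fun _ => 0) 0 1)
      (fun _ => 0) 1 := by
    refine ⟨le_rfl, fun k hk => hn, fun k hk l hl _ => by omega, fun v hv => ?_,
      fun k h1 h2 => by omega, rfl, rfl⟩
    by_cases e : v = 0
    · subst e
      simp
    · simp [e, eq_comm]
  simp only [Spec, search, wp_seq, wp_setInt, wp_storeInt, IntExp.eval, m0, m1]
  refine (WP.loop (s := ((s.setIntArr 9 0 1).setIntVar 50 1).setIntVar 51 0)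
      (Inv := fun s' N => ∃ i t, s'.intVar 51 = i ∧ s'.intVar 50 = t ∧ i ≤ t ∧
      Searched n (ArcRel off tgt) (s'.intArr 8) (s'.intArr 9) (s'.intArr 10) t ∧
      (∀ k < i, ∀ v, ArcRel off tgt (s'.intArr 10 k) v → s'.intArr 9 v ≠ 0) ∧
      N = 60 * (off n - ∑ k ∈ Finset.range i,
        (off (s'.intArr 10 k + 1) - off (s'.intArr 10 k))) + 50 * (n - i))
      (60 * off n + 50 * n) ⟨0, 1, by simp, by simp, by omega, by simpa [h8, h9, h10] using hinit,
        fun k hk => by omega, by simp⟩ ?_).frame.mono ?_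
  · rintro s1 N f1 ⟨i, t, h51, h50, hit, hS, hdone, rfl⟩ hlt
    have eo : s1.intArr 2 = off := (f1.ia 2 rfl).trans (by simpa using hoff)
    simp only [Test.Holds, IntExp.eval, h51, h50] at hlt
    have htn' := hS.le
    generalize hv : s1.intArr 10 i = v
    have hvn : v < n := hv ▸ hS.lt i hlt
    have hov := hmono v (v + 1) (by omega) hvn
    have hon := hmono (v + 1) n hvn le_rfl
    have mv : (v + 1) % W = v + 1 := Nat.mod_eq_of_lt (by omega)
    simp only [wp_seq, wp_setInt, IntExp.eval, h51, hv, setIntVar_intArr, setIntVar_intVar,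
      reduceIte, eo]
    refine (WP.loop (s := (s1.setIntVar 52 v).setIntVar 53 (off v))
      (Inv := fun s' N => ∃ j t', s'.intVar 53 = j ∧ s'.intVar 50 = t' ∧ t ≤ t' ∧ off v ≤ j ∧
      j ≤ off (v + 1) ∧ Searched n (ArcRel off tgt) (s'.intArr 8) (s'.intArr 9) (s'.intArr 10) t' ∧
      (∀ k < t, s'.intArr 10 k = s1.intArr 10 k) ∧
      (∀ v, s1.intArr 9 v ≠ 0 → s'.intArr 9 v ≠ 0) ∧
      (∀ l, off v ≤ l → l < j → s'.intArr 9 (tgt l) ≠ 0) ∧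
      N = 50 * (off (v + 1) - j)) (50 * (off (v + 1) - off v))
      ⟨off v, t, by simp, by simpa using h50, le_rfl, le_rfl, hov, by simpa using hS,
        fun k hk => by simp, fun v h => by simpa using h, fun l h1 h2 => by omega, rfl⟩
      ?_).frame.mono ?_
    · rintro s2 N f2 ⟨j, t', h53, h50', htt, hvj, hjv, hS', hold, hvis, hnew, rfl⟩ hlt2
      have e52 : s2.intVar 52 = v := (f2.iv 52 rfl).trans (by simp)
      have eo2 : s2.intArr 2 = off := (f2.ia 2 rfl).trans (by simpa using eo)
      have et2 : s2.intArr 3 = tgt := (f2.ia 3 rfl).trans ((f1.ia 3 rfl).trans (by simpa using htgt))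
      simp only [Test.Holds, IntExp.eval, h53, e52, eo2, m1, mv] at hlt2
      have hvi : s2.intArr 10 i = v := by rw [hold i hlt, hv]
      refine (visitArc_spec s2 n (ArcRel off tgt) i j t' (tgt j) h50' (by rw [e52, hvi]) h53
        (by rw [et2]) (htn j (by omega)) (by omega) (by omega) (by omega) (by omega)
        (by rw [hvi]; exact ⟨j, hvj, hlt2, rfl⟩) hS').wp fun s3 t3 f3 ht3 h3 => ?_
      obtain ⟨h53', t'', htt', h50'', hold', hvis', hu', hS''⟩ := h3
      refine ⟨_, ⟨j + 1, t'', h53', h50'', by omega, by omega, hlt2, hS'', fun k hk => ?_,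
        fun w hw => hvis' w (hvis w hw), fun l h1 h2 => ?_, rfl⟩, ?_⟩
      · rw [hold' k (by omega), hold k hk]
      · rcases Nat.lt_succ_iff_lt_or_eq.1 h2 with h2 | rfl
        · exact hvis' _ (hnew l h1 h2)
        · exact hu'
      · simp only [IntExp.steps, Test.steps]
        omega
    · rintro s2 t2 ⟨f2, N, ⟨j, t', h53, h50', htt, hvj, hjv, hS', hold, hvis, hnew, rfl⟩, ht2, hlt2⟩
      have e52 : s2.intVar 52 = v := (f2.iv 52 rfl).trans (by simp)
      have e51 : s2.intVar 51 = i := (f2.iv 51 rfl).trans (by simpa using h51)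
      have eo2 : s2.intArr 2 = off := (f2.ia 2 rfl).trans (by simpa using eo)
      simp only [Test.Holds, IntExp.eval, h53, e52, eo2, m1, mv] at hlt2
      obtain rfl : j = off (v + 1) := by omega
      have mi : (i + 1) % W = i + 1 := Nat.mod_eq_of_lt (by omega)
      have hvi : s2.intArr 10 i = v := by rw [hold i hlt, hv]
      have hsum : ∑ k ∈ Finset.range i, (off (s2.intArr 10 k + 1) - off (s2.intArr 10 k)) =
          ∑ k ∈ Finset.range i, (off (s1.intArr 10 k + 1) - off (s1.intArr 10 k)) :=
        Finset.sum_congr rfl fun k hk => by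
          have := Finset.mem_range.1 hk
          rw [hold k (by omega)]
      have hle := sum_degree_le (off := off) (ord := s1.intArr 10) (n := n) (t := i + 1) hoff0 hmono
        (fun k hk => hS.lt k (by omega)) (fun k hk l hl => hS.inj k (by omega) l (by omega))
      rw [Finset.sum_range_succ, hv] at hle
      simp only [e51, m1, mi]
      refine ⟨_, ⟨i + 1, t', by simp, by simpa using h50', by omega, by simpa using hS',
        fun k hk w hw => ?_, rfl⟩, ?_⟩
      · rcases Nat.lt_succ_iff_lt_or_eq.1 hk with hk | rfl
        · rw [hold k (by omega)] at hw
          exact hvis w (hdone k hk w hw)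
        · rw [hvi] at hw
          obtain ⟨l, h1, h2, rfl⟩ := hw
          exact hnew l h1 h2
      · rw [Finset.sum_range_succ, hsum, hvi]
        simp only [IntExp.steps, Test.steps] at ht2 ⊢
        omega
  · rintro s2 t2 ⟨f2, N, ⟨i, t, h51, h50, hit, hS, hdone, rfl⟩, ht2, hlt2⟩
    simp only [Test.Holds, IntExp.eval, h51, h50] at hlt2
    obtain rfl : i = t := by omega
    have hall := hconn (fun v => v < n ∧ s2.intArr 9 v ≠ 0)
      ⟨hn, (hS.visited 0 hn).2 ⟨0, hS.pos, hS.ord_zero⟩⟩ (fun u hu ⟨_, hv⟩ v huv => by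
        obtain ⟨k, hk, rfl⟩ := (hS.visited u hu).1 hv
        refine ⟨?_, hdone k hk v huv⟩
        obtain ⟨j, -, hj, rfl⟩ := huv
        exact htn j (lt_of_lt_of_le hj (hmono _ n hu le_rfl)))
    have hin : i = n := by
      refine le_antisymm hS.le ?_
      have hsub : Finset.range n ⊆ (Finset.range i).image (s2.intArr 10) := fun v hv => by
        have hvn := Finset.mem_range.1 hv
        obtain ⟨k, hk, e⟩ := (hS.visited v hvn).1 (hall v hvn).2
        exact Finset.mem_image.2 ⟨k, Finset.mem_range.2 hk, e⟩
      have := (Finset.card_le_card hsub).trans Finset.card_image_le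
      simpa using this
    subst hin
    refine ⟨?_, hS⟩
    simp only [IntExp.steps, Test.steps] at ht2 ⊢
    omega

end RealRAM

namespace RealRAM

/-! ## Subtree sizes and heavy children -/

/-- `sz` counts the proper descendants, and `heavy` is the largest child, of each vertex, where only
the vertices `ord k` with `i ≤ k` are taken into account as children. -/
structure Sized (n : ℕ) (par ord sz heavy : ℕ → ℕ) (i : ℕ) : Prop where
  total : ∑ k ∈ Finset.range i, (sz (ord k) + 1) = n
  bound : ∀ k, i ≤ k → k < n → sz (ord k) + 1 ≤ n
  mono : ∀ k, i ≤ k → k < n → sz (ord k) + 1 ≤ sz (par (ord k))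
  child : ∀ v < n, heavy v ≠ 0 → ∃ k, i ≤ k ∧ k < n ∧ ord k = heavy v ∧ par (heavy v) = v
  parent : ∀ k, i ≤ k → k < n → heavy (par (ord k)) ≠ 0 ∧
    sz (ord k) ≤ sz (heavy (par (ord k))) ∧ (heavy (par (ord k)) = ord k ∨
      sz (ord k) + sz (heavy (par (ord k))) + 2 ≤ sz (par (ord k)))

/-- In reverse search order the size of a vertex is final when it is added to that of its parent.
The inequality with `+ 2` says that two different children fit below their parent together. It holds
for the new child and an old one because the old child is contained in the old size of the parent,
to which the new child is just being added. -/
theorem Sized.step {n : ℕ} {R : ℕ → ℕ → Prop} {par vis ord sz heavy sz' heavy' : ℕ → ℕ} {i : ℕ}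
    (hS : Searched n R par vis ord n) (h : Sized n par ord sz heavy (i + 1)) (hi : 1 ≤ i)
    (hin : i < n)
    (hsz : sz' = Function.update sz (par (ord i)) (sz (par (ord i)) + sz (ord i) + 1))
    (hh : heavy' = if heavy (par (ord i)) = 0 ∨ sz (heavy (par (ord i))) < sz (ord i) then
      Function.update heavy (par (ord i)) (ord i) else heavy) :
    Sized n par ord sz' heavy' i := by
  obtain ⟨l, hl, hp, -⟩ := hS.parent i hi hin
  generalize hvdef : ord i = v at *
  generalize hpdef : par v = p at *
  have hne : ∀ k, i ≤ k → k < n → ord k ≠ p := fun k hk hkn e => by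
    have := hS.inj k hkn l (by omega) (e.trans hp)
    omega
  have hv0 : v ≠ 0 := fun e => by
    have := hS.inj i hin 0 (by omega) (by rw [hvdef, e, hS.ord_zero])
    omega
  have hpn : p < n := hp ▸ hS.lt l (by omega)
  have hsk : ∀ k, i ≤ k → k < n → sz' (ord k) = sz (ord k) := fun k hk hkn => by
    rw [hsz, Function.update_of_ne (hne k hk hkn)]
  have hsp : sz' p = sz p + sz v + 1 := by rw [hsz, Function.update_self]
  have hge : ∀ x, sz x ≤ sz' x := fun x => by
    by_cases e : x = p
    · rw [e, hsp]; omega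
    · rw [hsz, Function.update_of_ne e]
  have hother : ∀ q, q ≠ p → heavy' q = heavy q := fun q hq => by
    rw [hh]
    split_ifs
    · exact Function.update_of_ne hq _ _
    · rfl
  have hck : ∀ q < n, heavy q ≠ 0 → ∃ k, i + 1 ≤ k ∧ k < n ∧ ord k = heavy q := fun q hq h0 => by
    obtain ⟨k, h1, h2, h3, -⟩ := h.child q hq h0
    exact ⟨k, h1, h2, h3⟩
  have hsh : ∀ q < n, heavy q ≠ 0 → sz' (heavy q) = sz (heavy q) := fun q hq h0 => by
    obtain ⟨k, h1, h2, h3⟩ := hck q hq h0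
    rw [← h3, hsk k (by omega) h2]
  have hvs : sz' v = sz v := by rw [← hvdef, hsk i le_rfl hin]
  -- The vertex `v` leaves the range of summation, and its share `sz v + 1` passes to its parent,
  -- which comes earlier in the search order and so remains in the range.
  have htot : ∑ k ∈ Finset.range i, (sz' (ord k) + 1) = n := by
    have h1 := h.total
    rw [Finset.sum_range_succ, hvdef] at h1
    rw [← h1, ← Finset.add_sum_erase _ _ (Finset.mem_range.2 hl),
      ← Finset.add_sum_erase (Finset.range i) (fun k => sz (ord k) + 1) (Finset.mem_range.2 hl),
      ← hp, hsp]
    have : ∑ k ∈ (Finset.range i).erase l, (sz' (ord k) + 1) =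
        ∑ k ∈ (Finset.range i).erase l, (sz (ord k) + 1) :=
      Finset.sum_congr rfl fun k hk => by
        have hk1 := Finset.ne_of_mem_erase hk
        have hk2 := Finset.mem_range.1 (Finset.mem_of_mem_erase hk)
        have : ord k ≠ p := fun e => hk1 (hS.inj k (by omega) l (by omega) (e.trans hp))
        rw [hsz, Function.update_of_ne this]
    rw [this]
    omega
  have hpar : ∀ k, 1 ≤ k → k < n → par (ord k) < n := fun k h1 h2 => by
    obtain ⟨l', hl', e, -⟩ := hS.parent k h1 h2
    rw [e]; exact hS.lt l' (by omega)
  refine ⟨htot, fun k hk hkn => ?_, fun k hk hkn => ?_, fun q hq h0 => ?_, fun k hk hkn => ?_⟩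
  · rw [hsk k hk hkn]
    rcases Nat.eq_or_lt_of_le hk with rfl | hk
    · rw [hvdef]
      have h1 := h.total
      rw [Finset.sum_range_succ, hvdef] at h1
      omega
    · exact h.bound k hk hkn
  · rw [hsk k hk hkn]
    rcases Nat.eq_or_lt_of_le hk with rfl | hk
    · rw [hvdef, hpdef, hsp]; omega
    · exact (h.mono k hk hkn).trans (hge _)
  · by_cases hqp : q = p
    · subst hqp
      by_cases hc : heavy q = 0 ∨ sz (heavy q) < sz v
      · rw [hh, if_pos hc, Function.update_self]
        exact ⟨i, le_rfl, hin, hvdef, hpdef⟩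
      · rw [hh, if_neg hc]
        obtain ⟨k, h1, h2⟩ := h.child q hq (fun e => hc (Or.inl e))
        exact ⟨k, by omega, h2⟩
    · rw [hother q hqp] at h0 ⊢
      obtain ⟨k, h1, h2⟩ := h.child q hq h0
      exact ⟨k, by omega, h2⟩
  · have hkv : k = i ∨ i + 1 ≤ k := by omega
    rw [hsk k hk hkn]
    by_cases hqp : par (ord k) = p
    · rw [hqp, hsp]
      by_cases hc : heavy p = 0 ∨ sz (heavy p) < sz v
      · have e : heavy' p = v := by rw [hh, if_pos hc, Function.update_self]
        rw [e, hvs]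
        refine ⟨hv0, ?_⟩
        rcases hkv with rfl | hk
        · rw [hvdef]; exact ⟨le_rfl, Or.inl rfl⟩
        · obtain ⟨h1, h2, h3⟩ := h.parent k hk hkn
          have h4 := h.mono k hk hkn
          rw [hqp] at h1 h2 h3 h4
          have := hc.resolve_left h1
          exact ⟨by omega, Or.inr (by omega)⟩
      · have e : heavy' p = heavy p := by rw [hh, if_neg hc]
        rw [not_or, not_lt] at hc
        rw [e, hsh p hpn hc.1]
        refine ⟨hc.1, ?_⟩
        rcases hkv with rfl | hk
        · obtain ⟨k', h1, h2, h3, h4⟩ := h.child p hpn hc.1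
          have h5 := h.mono k' h1 h2
          rw [h3, h4] at h5
          rw [hvdef]
          exact ⟨hc.2, Or.inr (by omega)⟩
        · obtain ⟨h1, h2, h3⟩ := h.parent k hk hkn
          rw [hqp] at h1 h2 h3
          exact ⟨h2, h3.imp id (by omega)⟩
    · have hk' : i + 1 ≤ k := by
        rcases hkv with rfl | hk
        · rw [hvdef] at hqp; exact absurd hpdef hqp
        · exact hk
      obtain ⟨h1, h2, h3⟩ := h.parent k hk' hkn
      rw [hother _ hqp, hsh _ (hpar k (by omega) hkn) h1]
      exact ⟨h1, h2, h3.imp id fun h => h.trans (hge _)⟩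

/-- Compute the numbers of proper descendants and the heavy children. -/
def computeSizes : Cmd :=
  .setInt 51 (.var 0) ;;
  .loop (.intLt (.lit 1) (.var 51))
   (.setInt 51 (.sub (.var 51) (.lit 1)) ;; .setInt 52 (.arr 10 (.var 51)) ;;
    .setInt 53 (.arr 8 (.var 52)) ;;
    .cond (.or (.intEq (.arr 12 (.var 53)) (.lit 0))
        (.intLt (.arr 11 (.arr 12 (.var 53))) (.arr 11 (.var 52))))
      (.storeInt 12 (.var 53) (.var 52)) .skip ;;
    .storeInt 11 (.var 53) (.add (.add (.arr 11 (.var 53)) (.arr 11 (.var 52))) (.lit 1)))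

theorem computeSizes_spec {W : ℕ} (s : State) (n : ℕ) (R : ℕ → ℕ → Prop) (par vis ord : ℕ → ℕ)
    (hn : 1 ≤ n) (h0 : s.intVar 0 = n) (hpar : s.intArr 8 = par) (hord : s.intArr 10 = ord)
    (hS : Searched n R par vis ord n) (hW : 20 * n + 20 ≤ W) (h11 : s.intArr 11 = fun _ => 0)
    (h12 : s.intArr 12 = fun _ => 0) :
    Spec W computeSizes s (60 * n + 20) fun s' =>
      Sized n par ord (s'.intArr 11) (s'.intArr 12) 1 := by
  have m0 : 0 % W = 0 := Nat.zero_mod _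
  have m1 : 1 % W = 1 := Nat.mod_eq_of_lt (by omega)
  simp only [Spec, computeSizes, wp_seq, wp_setInt, IntExp.eval, h0]
  refine (WP.loop (s := s.setIntVar 51 n) (Inv := fun s' N => ∃ i, s'.intVar 51 = i ∧ 1 ≤ i ∧ i ≤ n ∧
      Sized n par ord (s'.intArr 11) (s'.intArr 12) i ∧ N = 60 * (i - 1))
      (60 * (n - 1)) ⟨n, by simp, hn, le_rfl, ?_, rfl⟩ ?_).frame.mono ?_
  · simp only [setIntVar_intArr, h11, h12]
    exact ⟨by simp, fun k h1 h2 => by omega, fun k h1 h2 => by omega,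
      fun v hv h => absurd rfl h, fun k h1 h2 => by omega⟩
  · rintro s1 N f1 ⟨i', h51, hi1, hin, hZ, rfl⟩ hlt
    have e8 : s1.intArr 8 = par := (f1.ia 8 rfl).trans (by simpa using hpar)
    have e10 : s1.intArr 10 = ord := (f1.ia 10 rfl).trans (by simpa using hord)
    simp only [Test.Holds, IntExp.eval, h51, m1] at hlt
    obtain ⟨i, rfl⟩ : ∃ i, i' = i + 1 := ⟨i' - 1, by omega⟩
    simp only [wp_seq, wp_setInt, wp_cond, wp_storeInt, wp_skip, Test.Holds, IntExp.eval,
      setIntVar_intVar, setIntVar_intArr, setIntArr_intVar, setIntArr_intArr, h51, e8, e10, m0, m1,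
      reduceIte, Nat.reduceEqDiff, Nat.add_sub_cancel]
    have hb := hZ.total
    obtain ⟨l, hl, hp, -⟩ := hS.parent i (by omega) (by omega)
    -- Both sizes occur in the sum `total`, which equals `n`, so the addition does not overflow.
    have hov : s1.intArr 11 (par (ord i)) + s1.intArr 11 (ord i) + 1 < W := by
      rw [Finset.sum_range_succ, ← Finset.add_sum_erase _ _ (Finset.mem_range.2 hl), ← hp] at hb
      omega
    have ma : (s1.intArr 11 (par (ord i)) + s1.intArr 11 (ord i)) % W =
      s1.intArr 11 (par (ord i)) + s1.intArr 11 (ord i) := Nat.mod_eq_of_lt (by omega)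
    have mb : (s1.intArr 11 (par (ord i)) + s1.intArr 11 (ord i) + 1) % W =
      s1.intArr 11 (par (ord i)) + s1.intArr 11 (ord i) + 1 := Nat.mod_eq_of_lt hov
    simp only [ma, mb]
    refine ⟨fun hc => ⟨_, ⟨i, by simp, by omega, by omega, ?_, rfl⟩, ?_⟩,
      fun hc => ⟨_, ⟨i, by simp, by omega, by omega, ?_, rfl⟩, ?_⟩⟩
    · exact hZ.step hS (by omega) (by omega) (by simp) (by simp [if_pos hc])
    · simp only [IntExp.steps, Test.steps]; omega
    · exact hZ.step hS (by omega) (by omega) (by simp) (by simp [if_neg hc])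
    · simp only [IntExp.steps, Test.steps]; omega
  · rintro s2 t2 ⟨f2, N, ⟨i, h51, hi1, hin, hZ, rfl⟩, ht2, hlt2⟩
    simp only [Test.Holds, IntExp.eval, h51, m1] at hlt2
    obtain rfl : i = 1 := by omega
    refine ⟨?_, hZ⟩
    simp only [IntExp.steps, Test.steps] at ht2 ⊢
    omega

end RealRAM

namespace RealRAM

/-! ## Positions along heavy paths -/

/-- The positions below `c` are assigned: `vert` and `pos` translate between positions and vertices,
`hd` is the first position of the heavy path and `pp` the position of the parent. -/
structure Placed (n : ℕ) (par heavy pos vert hd pp : ℕ → ℕ) (c : ℕ) : Prop where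
  vert_lt : ∀ p < c, vert p < n
  pos_vert : ∀ p < c, pos (vert p) = p
  parent : ∀ p, 1 ≤ p → p < c → ∃ q < p, vert q = par (vert p) ∧ pp p = q
  root : 0 < c → vert 0 = 0 ∧ pp 0 = 0
  path : ∀ p < c, (hd p = p ∧ (p = 0 ∨ heavy (par (vert p)) ≠ vert p)) ∨
    (1 ≤ p ∧ hd p = hd (p - 1) ∧ pp p = p - 1 ∧ vert p = heavy (vert (p - 1)))

theorem Placed.le {n : ℕ} {par heavy pos vert hd pp : ℕ → ℕ} {c : ℕ}
    (h : Placed n par heavy pos vert hd pp c) : c ≤ n :=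
  le_of_injOn_lt h.vert_lt fun k hk l hl e => by rw [← h.pos_vert k hk, e, h.pos_vert l hl]

/-- The vertex `x` may be placed at position `c` on a path that starts at `st`. -/
def Placeable (par heavy vert hd : ℕ → ℕ) (c x st : ℕ) : Prop :=
  (st = c ∧ ((c = 0 ∧ x = 0) ∨ (x ≠ 0 ∧ heavy (par x) ≠ x ∧ ∃ q < c, vert q = par x))) ∨
    (1 ≤ c ∧ st = hd (c - 1) ∧ x ≠ 0 ∧ x = heavy (vert (c - 1)) ∧ par x = vert (c - 1))

theorem Placed.push {n : ℕ} {par heavy pos vert hd pp : ℕ → ℕ} {c x st : ℕ}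
    (h : Placed n par heavy pos vert hd pp c) (hx : x < n) (hfresh : ∀ p < c, vert p ≠ x)
    (h0 : par 0 = 0) (hp : Placeable par heavy vert hd c x st) :
    Placed n par heavy (Function.update pos x c) (Function.update vert c x)
      (Function.update hd c st) (Function.update pp c (Function.update pos x c (par x))) (c + 1) := by
  have hv : ∀ p < c, Function.update vert c x p = vert p := fun p hp =>
    Function.update_of_ne (by omega) _ _
  have hh : ∀ p < c, Function.update hd c st p = hd p := fun p hp =>
    Function.update_of_ne (by omega) _ _
  have hpp : ∀ p < c, Function.update pp c (Function.update pos x c (par x)) p = pp p := fun p hp =>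
    Function.update_of_ne (by omega) _ _
  have hparent : 1 ≤ c → ∃ q < c, vert q = par x := by
    intro hc
    rcases hp with ⟨-, ⟨h1, -⟩ | ⟨-, -, h3⟩⟩ | ⟨h1, -, -, -, h3⟩
    · omega
    · exact h3
    · exact ⟨c - 1, by omega, h3.symm⟩
  have hpos : ∀ q < c, vert q = par x → Function.update pos x c (par x) = q := fun q hq e => by
    rw [← e, Function.update_of_ne (hfresh q hq), h.pos_vert q hq]
  have hx0 : c = 0 → x = 0 := by
    rintro rfl
    rcases hp with ⟨-, ⟨-, h1⟩ | ⟨-, -, q, hq, -⟩⟩ | ⟨h1, -⟩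
    · exact h1
    · omega
    · omega
  refine ⟨fun p hpc => ?_, fun p hpc => ?_, fun p h1 hpc => ?_, fun _ => ?_, fun p hpc => ?_⟩
  · rcases Nat.lt_succ_iff_lt_or_eq.1 hpc with hpc | rfl
    · rw [hv p hpc]; exact h.vert_lt p hpc
    · rwa [Function.update_self]
  · rcases Nat.lt_succ_iff_lt_or_eq.1 hpc with hpc | rfl
    · rw [hv p hpc, Function.update_of_ne (hfresh p hpc), h.pos_vert p hpc]
    · rw [Function.update_self, Function.update_self]
  · rcases Nat.lt_succ_iff_lt_or_eq.1 hpc with hpc | rfl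
    · obtain ⟨q, hq, e1, e2⟩ := h.parent p h1 hpc
      exact ⟨q, hq, by rw [hv p hpc, hv q (by omega), e1], by rw [hpp p hpc, e2]⟩
    · obtain ⟨q, hq, e⟩ := hparent h1
      exact ⟨q, hq, by rw [hv q hq, Function.update_self, e], by
        rw [Function.update_self, hpos q hq e]⟩
  · rcases Nat.eq_zero_or_pos c with rfl | hc
    · obtain rfl := hx0 rfl
      rw [Function.update_self, Function.update_self, h0, Function.update_self]
      exact ⟨rfl, rfl⟩
    · rw [hv 0 hc, hpp 0 hc]; exact h.root hc
  · rcases Nat.lt_succ_iff_lt_or_eq.1 hpc with hpc | rfl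
    · rw [hv p hpc, hh p hpc, hpp p hpc, hh (p - 1) (by omega), hv (p - 1) (by omega)]
      exact h.path p hpc
    · rw [Function.update_self, Function.update_self, Function.update_self]
      rcases hp with ⟨h1, ⟨h2, -⟩ | ⟨-, h2, -⟩⟩ | ⟨h1, h2, h3, h4, h5⟩
      · exact Or.inl ⟨h1, Or.inl h2⟩
      · exact Or.inl ⟨h1, Or.inr h2⟩
      · refine Or.inr ⟨h1, ?_, hpos (p - 1) (by omega) h5.symm, ?_⟩
        · rw [hh (p - 1) (by omega), h2]
        · rw [hv (p - 1) (by omega), h4]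

/-- Place the vertex in integer variable 53 on the path that starts at the position in integer
variable 55, and go to its heavy child. -/
def placeVertex : Cmd :=
  .storeInt 13 (.var 53) (.var 54) ;; .storeInt 15 (.var 54) (.var 53) ;;
  .storeInt 14 (.var 54) (.var 55) ;; .storeInt 26 (.var 54) (.arr 13 (.arr 8 (.var 53))) ;;
  .setInt 54 (.add (.var 54) (.lit 1)) ;; .setInt 53 (.arr 12 (.var 53))

/-- Place the heavy path that starts in the vertex in integer variable 52. -/
def placePath : Cmd :=
  .setInt 53 (.var 52) ;; .setInt 55 (.var 54) ;; placeVertex ;;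
  .loop (.not (.intEq (.var 53) (.lit 0))) placeVertex

/-- Place all heavy paths. -/
def placeAll : Cmd :=
  .setInt 51 (.lit 0) ;; .setInt 54 (.lit 0) ;;
  .loop (.intLt (.var 51) (.var 0))
   (.setInt 52 (.arr 10 (.var 51)) ;;
    .cond (.or (.intEq (.var 51) (.lit 0))
        (.not (.intEq (.arr 12 (.arr 8 (.var 52))) (.var 52)))) placePath .skip ;;
    .setInt 51 (.add (.var 51) (.lit 1)))

theorem placeVertex_spec {W : ℕ} (s : State) (n c x st : ℕ) (par heavy : ℕ → ℕ)
    (h8 : s.intArr 8 = par) (h12 : s.intArr 12 = heavy) (h53 : s.intVar 53 = x)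
    (h54 : s.intVar 54 = c) (h55 : s.intVar 55 = st) (hW : n + 1 ≤ W)
    (hx : x < n) (h0 : par 0 = 0)
    (hP : Placed n par heavy (s.intArr 13) (s.intArr 15) (s.intArr 14) (s.intArr 26) c)
    (hfresh : ∀ p < c, s.intArr 15 p ≠ x)
    (hp : Placeable par heavy (s.intArr 15) (s.intArr 14) c x st) :
    Spec W placeVertex s 30 fun s' => s'.intVar 54 = c + 1 ∧ s'.intVar 53 = heavy x ∧
      (∀ p < c, s'.intArr 15 p = s.intArr 15 p) ∧ s'.intArr 15 c = x ∧
      (∀ p < c, s'.intArr 14 p = s.intArr 14 p) ∧ s'.intArr 14 c = st ∧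
      Placed n par heavy (s'.intArr 13) (s'.intArr 15) (s'.intArr 14) (s'.intArr 26) (c + 1) := by
  have key := hP.push hx hfresh h0 hp
  have hle := key.le
  have m1 : 1 % W = 1 := Nat.mod_eq_of_lt (by omega)
  have mc : (c + 1) % W = c + 1 := Nat.mod_eq_of_lt (by omega)
  simp only [Spec, placeVertex, wp_seq, wp_setInt, wp_storeInt, IntExp.eval, setIntVar_intVar,
    setIntVar_intArr, setIntArr_intVar, setIntArr_intArr, h53, h54, h55, h8, h12, m1, mc, reduceIte,
    Nat.reduceEqDiff]
  refine ⟨by simp, trivial, trivial, fun p hp => Function.update_of_ne (by omega) _ _, by simp,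
    fun p hp => Function.update_of_ne (by omega) _ _, by simp, key⟩

/-- If `x` were placed already, it could not be the start of a path, as it is a heavy child and not
0. Otherwise its parent would have a smaller position than `x`, but the parent occupies the last
position `c - 1`. -/
theorem Placed.fresh_heavy {n : ℕ} {par heavy pos vert hd pp : ℕ → ℕ} {c x : ℕ}
    (h : Placed n par heavy pos vert hd pp c) (hc : 1 ≤ c) (hx0 : x ≠ 0)
    (hx : x = heavy (vert (c - 1))) (hpx : par x = vert (c - 1)) : ∀ p < c, vert p ≠ x := by
  intro p hp e
  rcases h.path p hp with ⟨-, h1 | h1⟩ | ⟨h1, -, -, h2⟩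
  · subst h1
    exact hx0 (e ▸ (h.root hc).1)
  · rw [e, hpx] at h1
    exact h1 hx.symm
  · obtain ⟨q, hq, e1, e2⟩ := h.parent p h1 hp
    rw [e, hpx] at e1
    have h3 := h.pos_vert q (by omega)
    rw [e1, h.pos_vert (c - 1) (by omega)] at h3
    omega

/-- While a path is being placed, only the last placed vertex may still lack its heavy child. The
loop ends at a vertex without one, which restores closure under heavy children. -/
theorem placePath_spec {W : ℕ} (s : State) (n c x : ℕ) (par heavy : ℕ → ℕ)
    (h8 : s.intArr 8 = par) (h12 : s.intArr 12 = heavy) (h52 : s.intVar 52 = x)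
    (h54 : s.intVar 54 = c) (hW : n + 1 ≤ W) (hx : x < n) (h0 : par 0 = 0)
    (hheavy : ∀ v < n, heavy v ≠ 0 → heavy v < n ∧ par (heavy v) = v)
    (hP : Placed n par heavy (s.intArr 13) (s.intArr 15) (s.intArr 14) (s.intArr 26) c)
    (hfresh : ∀ p < c, s.intArr 15 p ≠ x)
    (hp : Placeable par heavy (s.intArr 15) (s.intArr 14) c x c)
    (hclosed : ∀ p < c, heavy (s.intArr 15 p) ≠ 0 →
      ∃ q < c, s.intArr 15 q = heavy (s.intArr 15 p)) :
    WP W placePath (fun s' t => ∃ c', s'.intVar 54 = c' ∧ c < c' ∧ t ≤ 50 * (c' - c) + 50 ∧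
      (∀ p < c, s'.intArr 15 p = s.intArr 15 p) ∧ s'.intArr 15 c = x ∧
      (∀ p < c, s'.intArr 14 p = s.intArr 14 p) ∧
      (∀ p, c < p → p < c' → s'.intArr 14 p = c) ∧
      Placed n par heavy (s'.intArr 13) (s'.intArr 15) (s'.intArr 14) (s'.intArr 26) c' ∧
      ∀ p < c', heavy (s'.intArr 15 p) ≠ 0 → ∃ q < c', s'.intArr 15 q = heavy (s'.intArr 15 p)) s := by
  have m0 : 0 % W = 0 := Nat.zero_mod _
  rw [placePath, wp_seq, wp_setInt, wp_seq, wp_setInt, wp_seq]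
  simp only [IntExp.eval, h52, setIntVar_intVar, Nat.reduceEqDiff, reduceIte, h54]
  refine (placeVertex_spec ((s.setIntVar 53 x).setIntVar 55 c) n c x c par heavy (by simpa using h8)
    (by simpa using h12) (by simp) (by simpa using h54) (by simp) hW hx h0 (by simpa using hP)
    (by simpa using hfresh) (by simpa using hp)).wp fun s1 t1 f1 ht1 h1 => ?_
  obtain ⟨g54, g53, gv, gvc, gh, ghc, gP⟩ := h1
  refine (WP.loop (s := s1) (Inv := fun s' N => ∃ c', s'.intVar 54 = c' ∧ c < c' ∧
      s'.intVar 53 = heavy (s'.intArr 15 (c' - 1)) ∧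
      (∀ p < c, s'.intArr 15 p = s.intArr 15 p) ∧ s'.intArr 15 c = x ∧
      (∀ p < c, s'.intArr 14 p = s.intArr 14 p) ∧
      (∀ p, c ≤ p → p < c' → s'.intArr 14 p = c) ∧
      Placed n par heavy (s'.intArr 13) (s'.intArr 15) (s'.intArr 14) (s'.intArr 26) c' ∧
      (∀ p, p + 1 < c' → heavy (s'.intArr 15 p) ≠ 0 →
        ∃ q < c', s'.intArr 15 q = heavy (s'.intArr 15 p)) ∧ N + 50 * c' = 50 * n)
      (50 * (n - (c + 1))) ⟨c + 1, g54, by omega, by simpa [gvc] using g53, by simpa using gv, gvc,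
        by simpa using gh, fun p h1 h2 => ?_, gP, fun p h1 h2 => ?_, ?_⟩ ?_).frame.mono ?_
  · obtain rfl : p = c := by omega
    exact ghc
  · rw [gv p (by omega), setIntVar_intArr, setIntVar_intArr] at h2 ⊢
    obtain ⟨q, hq, e⟩ := hclosed p (by omega) h2
    exact ⟨q, by omega, by rw [gv q hq, setIntVar_intArr, setIntVar_intArr, e]⟩
  · have := gP.le
    omega
  · rintro s2 N f2 ⟨c', k54, hcc, k53, kv, kvc, kh, khc, kP, kcl, hN⟩ hlt
    simp only [Test.Holds, IntExp.eval, m0] at hlt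
    have e8 : s2.intArr 8 = par := (f2.ia 8 rfl).trans ((f1.ia 8 rfl).trans (by simpa using h8))
    have e12 : s2.intArr 12 = heavy :=
      (f2.ia 12 rfl).trans ((f1.ia 12 rfl).trans (by simpa using h12))
    have e55 : s2.intVar 55 = c := (f2.iv 55 rfl).trans ((f1.iv 55 rfl).trans (by simp))
    rw [k53] at hlt
    generalize hy : s2.intArr 15 (c' - 1) = y at *
    have hyn : y < n := hy ▸ kP.vert_lt _ (by omega)
    obtain ⟨hyn', hpy⟩ := hheavy y hyn hlt
    refine (placeVertex_spec s2 n c' (heavy y) c par heavy e8 e12 k53 k54 e55 hW hyn' h0 kP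
      (kP.fresh_heavy (by omega) hlt (by rw [hy]) (by rw [hy, hpy]))
      (Or.inr ⟨by omega, (khc _ (by omega) (by omega)).symm, hlt, by rw [hy], by rw [hy, hpy]⟩)).wp
      fun s3 t3 f3 ht3 h3 => ?_
    obtain ⟨q54, q53, qv, qvc, qh, qhc, qP⟩ := h3
    have hle := qP.le
    refine ⟨50 * (n - (c' + 1)), ⟨c' + 1, q54, by omega, by rw [q53, Nat.add_sub_cancel, qvc],
      fun p hp => by rw [qv p (by omega), kv p hp], by rw [qv c hcc, kvc],
      fun p hp => by rw [qh p (by omega), kh p hp], fun p h1 h2 => ?_, qP, fun p h1 h2 => ?_,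
      by omega⟩, ?_⟩
    · rcases Nat.lt_succ_iff_lt_or_eq.1 h2 with h2 | rfl
      · rw [qh p h2, khc p h1 h2]
      · exact qhc
    · rw [qv p (by omega)] at h2 ⊢
      rcases Nat.lt_or_ge (p + 1) c' with h3 | h3
      · obtain ⟨q, hq, e⟩ := kcl p h3 h2
        exact ⟨q, by omega, by rw [qv q hq, e]⟩
      · refine ⟨c', by omega, ?_⟩
        rw [qvc, show p = c' - 1 by omega, hy]
    · simp only [IntExp.steps, Test.steps]
      omega
  · rintro s2 t2 ⟨f2, N, ⟨c', k54, hcc, k53, kv, kvc, kh, khc, kP, kcl, hN⟩, ht2, hlt2⟩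
    simp only [Test.Holds, IntExp.eval, m0, not_not] at hlt2
    have hle := kP.le
    refine ⟨c', k54, hcc, ?_, kv, kvc, kh, fun p h1 h2 => khc p h1.le h2, kP, fun p h1 h2 => ?_⟩
    · simp only [IntExp.steps, Test.steps] at ht2 ⊢
      omega
    · rcases Nat.lt_or_ge (p + 1) c' with h3 | h3
      · exact kcl p h3 h2
      · rw [k53] at hlt2
        rw [show p = c' - 1 by omega] at h2
        exact absurd hlt2 h2

/-- Vertices and positions correspond to each other, and the positions form a tree with heavy
paths. -/
structure Layout (n : ℕ) (par pos vert hd pp : ℕ → ℕ) : Prop where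
  par_zero : par 0 = 0
  par_lt : ∀ v < n, par v < n
  pos_lt : ∀ v < n, pos v < n
  vert_lt : ∀ p < n, vert p < n
  pos_vert : ∀ p < n, pos (vert p) = p
  vert_pos : ∀ v < n, vert (pos v) = v
  pos_zero : pos 0 = 0
  pp_pos : ∀ v < n, pp (pos v) = pos (par v)
  tree : ∃ sz, PosTree n pp hd sz

/-- Only the starts of paths trigger a placement, namely the root and the vertices that are not the
heavy child of their parent. Their parents are earlier in the search order, hence placed; all other
vertices are placed by closure under heavy children. Subtrees need not become intervals, only heavy
paths do. The weight of a position is the number of descendants including itself, and `Sized.parent`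
shows that it doubles above the start of a path. -/
theorem placeAll_spec {W : ℕ} (s : State) (n : ℕ) (R : ℕ → ℕ → Prop)
    (par vis ord sz heavy : ℕ → ℕ) (hn : 1 ≤ n) (h0 : s.intVar 0 = n) (hpar : s.intArr 8 = par)
    (hord : s.intArr 10 = ord) (hheavy : s.intArr 12 = heavy) (hS : Searched n R par vis ord n)
    (hZ : Sized n par ord sz heavy 1) (hW : 20 * n + 20 ≤ W) :
    Spec W placeAll s (150 * n + 20) fun s' =>
      Layout n par (s'.intArr 13) (s'.intArr 15) (s'.intArr 14) (s'.intArr 26) := by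
  have m0 : 0 % W = 0 := Nat.zero_mod _
  have m1 : 1 % W = 1 := Nat.mod_eq_of_lt (by omega)
  have hhv : ∀ v < n, heavy v ≠ 0 → heavy v < n ∧ par (heavy v) = v := fun v hv h => by
    obtain ⟨k, h1, h2, h3, h4⟩ := hZ.child v hv h
    exact ⟨h3 ▸ hS.lt k h2, h4⟩
  have hord0 : ∀ k, 1 ≤ k → k < n → ord k ≠ 0 := fun k h1 h2 e => by
    have := hS.inj k h2 0 (by omega) (e.trans hS.ord_zero.symm)
    omega
  have hsurj : ∀ v < n, ∃ k < n, ord k = v := fun v hv => by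
    have hinj : Set.InjOn ord (Finset.range n) := fun k hk l hl e =>
      hS.inj k (by simpa using hk) l (by simpa using hl) e
    have : (Finset.range n).image ord = Finset.range n := by
      refine Finset.eq_of_subset_of_card_le (fun v hv => ?_) ?_
      · obtain ⟨k, hk, rfl⟩ := Finset.mem_image.1 hv
        exact Finset.mem_range.2 (hS.lt k (Finset.mem_range.1 hk))
      · rw [Finset.card_image_of_injOn hinj]
    obtain ⟨k, hk, e⟩ := Finset.mem_image.1 (this.symm ▸ Finset.mem_range.2 hv)
    exact ⟨k, Finset.mem_range.1 hk, e⟩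
  simp only [Spec, placeAll, wp_seq, wp_setInt, IntExp.eval, m0]
  refine (WP.loop (s := (s.setIntVar 51 0).setIntVar 54 0) (Inv := fun s' N => ∃ i c,
      s'.intVar 51 = i ∧ s'.intVar 54 = c ∧ i ≤ n ∧ (i = 0 ↔ c = 0) ∧
      Placed n par heavy (s'.intArr 13) (s'.intArr 15) (s'.intArr 14) (s'.intArr 26) c ∧
      (∀ k < i, ∃ p < c, s'.intArr 15 p = ord k) ∧
      (∀ p < c, s'.intArr 14 p = p → ∃ k < i, s'.intArr 15 p = ord k) ∧
      (∀ p < c, heavy (s'.intArr 15 p) ≠ 0 →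
        ∃ q < c, s'.intArr 15 q = heavy (s'.intArr 15 p)) ∧ N + 50 * c + 80 * i = 130 * n)
      (130 * n) ⟨0, 0, by simp, by simp, by omega, by simp, ⟨fun p h => by omega,
        fun p h => by omega, fun p _ h => by omega, fun h => by omega, fun p h => by omega⟩,
        fun k hk => by omega, fun p h => by omega, fun p h => by omega, by simp⟩ ?_).frame.mono ?_
  · rintro s1 N f1 ⟨i, c, h51, h54, hin, hi0, hP, hdone, hstart, hclosed, hN⟩ hlt
    have e0 : s1.intVar 0 = n := (f1.iv 0 rfl).trans (by simpa using h0)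
    have e8 : s1.intArr 8 = par := (f1.ia 8 rfl).trans (by simpa using hpar)
    have e10 : s1.intArr 10 = ord := (f1.ia 10 rfl).trans (by simpa using hord)
    have e12 : s1.intArr 12 = heavy := (f1.ia 12 rfl).trans (by simpa using hheavy)
    simp only [Test.Holds, IntExp.eval, h51, e0] at hlt
    have mi : (i + 1) % W = i + 1 := Nat.mod_eq_of_lt (by omega)
    have hle := hP.le
    simp only [wp_seq, wp_setInt, wp_cond, Test.Holds, IntExp.eval, h51, e10, e12, e8, m0,
      setIntVar_intVar, setIntVar_intArr, reduceIte, Nat.reduceEqDiff]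
    refine ⟨fun hc => ?_, fun hc => ?_⟩
    · have hpl : Placeable par heavy (s1.intArr 15) (s1.intArr 14) c (ord i) c := by
        refine Or.inl ⟨rfl, ?_⟩
        rcases Nat.eq_zero_or_pos i with rfl | hi
        · exact Or.inl ⟨hi0.1 rfl, hS.ord_zero⟩
        · obtain ⟨l, hl, e, -⟩ := hS.parent i hi hlt
          refine Or.inr ⟨hord0 i hi hlt, hc.resolve_left (by omega), ?_⟩
          rw [e]
          exact hdone l hl
      have hfresh : ∀ p < c, s1.intArr 15 p ≠ ord i := by
        intro p hp e
        have hi : 1 ≤ i := by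
          rcases Nat.eq_zero_or_pos i with rfl | hi
          · have := hi0.1 rfl; omega
          · exact hi
        have hstart' : s1.intArr 14 p = p → False := fun h => by
          obtain ⟨k, hk, e'⟩ := hstart p hp h
          have := hS.inj k (by omega) i hlt (e'.symm.trans e)
          omega
        rcases hP.path p hp with ⟨h1, -⟩ | ⟨h1, -, h3, h2⟩
        · exact hstart' h1
        · obtain ⟨q, hq, e1, e2⟩ := hP.parent p h1 hp
          obtain rfl : q = p - 1 := by omega
          rw [e1, e] at h2
          exact hc.resolve_left (by omega) h2.symm
      refine (placePath_spec (s1.setIntVar 52 (ord i)) n c (ord i) par heavy (by simpa using e8)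
        (by simpa using e12) (by simp) (by simpa using h54) (by omega) (hS.lt i hlt) hS.par_zero hhv
        (by simpa using hP) (by simpa using hfresh) (by simpa using hpl)
        (by simpa using hclosed)).frame.mono ?_
      rintro s2 t2 ⟨f2, c', g54, hcc, ht2, gv, gvc, gh, ghc, gP, gcl⟩
      have e51 : s2.intVar 51 = i := (f2.iv 51 rfl).trans (by simpa using h51)
      have hle2 := gP.le
      simp only [setIntVar_intArr] at gv gh
      simp only [e51, m1, mi]
      refine ⟨130 * n - 50 * c' - 80 * (i + 1), ⟨i + 1, c', by simp, by simpa using g54, hlt,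
        by omega, by simpa using gP, fun k hk => ?_, fun p hp hps => ?_, by simpa using gcl,
        by omega⟩, ?_⟩
      · rcases Nat.lt_succ_iff_lt_or_eq.1 hk with hk | rfl
        · obtain ⟨p, hp, e⟩ := hdone k hk
          exact ⟨p, by omega, by rw [gv p hp, e]⟩
        · exact ⟨c, hcc, gvc⟩
      · rcases Nat.lt_trichotomy p c with h | h | h
        · rw [gh p h] at hps
          obtain ⟨k, hk, e⟩ := hstart p h hps
          exact ⟨k, by omega, by rw [gv p h, e]⟩
        · subst h
          exact ⟨i, by omega, gvc⟩
        · rw [ghc p h hp] at hps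
          omega
      · simp only [IntExp.steps, Test.steps]
        omega
    · rw [not_or, not_not] at hc
      simp only [wp_skip, setIntVar_intVar, Nat.reduceEqDiff, reduceIte, h51, m1, mi]
      refine ⟨130 * n - 50 * c - 80 * (i + 1), ⟨i + 1, c, by simp, by simpa using h54, hlt,
        by omega, by simpa using hP, fun k hk => ?_, fun p hp hps => ?_, by simpa using hclosed,
        by omega⟩, ?_⟩
      · rcases Nat.lt_succ_iff_lt_or_eq.1 hk with hk | rfl
        · obtain ⟨p, hp, e⟩ := hdone k hk
          exact ⟨p, by omega, by simpa using e⟩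
        · obtain ⟨l, hl, e, -⟩ := hS.parent k (by omega) hlt
          obtain ⟨p, hp, e'⟩ := hdone l hl
          have := hclosed p hp (by rw [e', ← e, hc.2]; exact hord0 k (by omega) hlt)
          rw [e', ← e, hc.2] at this
          simpa using this
      · obtain ⟨k, hk, e⟩ := hstart p hp (by simpa using hps)
        exact ⟨k, by omega, by simpa using e⟩
      · simp only [IntExp.steps, Test.steps]
        omega
  · rintro s2 t2 ⟨f2, N, ⟨i, c, h51, h54, hin, hi0, hP, hdone, hstart, hclosed, hN⟩, ht2, hlt2⟩
    have e0 : s2.intVar 0 = n := (f2.iv 0 rfl).trans (by simpa using h0)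
    simp only [Test.Holds, IntExp.eval, h51, e0] at hlt2
    obtain rfl : i = n := by omega
    have hle := hP.le
    have hall : ∀ v < i, ∃ p < c, s2.intArr 15 p = v := fun v hv => by
      obtain ⟨k, hk, rfl⟩ := hsurj v hv
      exact hdone k hk
    obtain rfl : c = i := by
      refine le_antisymm hle ?_
      have hsub : Finset.range i ⊆ (Finset.range c).image (s2.intArr 15) := fun v hv => by
        obtain ⟨p, hp, e⟩ := hall v (Finset.mem_range.1 hv)
        exact Finset.mem_image.2 ⟨p, Finset.mem_range.2 hp, e⟩
      have := (Finset.card_le_card hsub).trans Finset.card_image_le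
      simpa using this
    have hpv : ∀ v < c, s2.intArr 13 v < c ∧ s2.intArr 15 (s2.intArr 13 v) = v := fun v hv => by
      obtain ⟨p, hp, rfl⟩ := hall v hv
      rw [hP.pos_vert p hp]
      exact ⟨hp, rfl⟩
    have hr := hP.root hn
    have hp0 : s2.intArr 13 0 = 0 := by
      have := hP.pos_vert 0 hn
      rwa [hr.1] at this
    have hbig : ∀ v < c, sz v + 1 ≤ c := fun v hv => by
      obtain ⟨k, hk, rfl⟩ := hsurj v hv
      rcases Nat.eq_zero_or_pos k with rfl | hk1
      · have := hZ.total
        simp only [Finset.sum_range_one] at this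
        omega
      · exact hZ.bound k hk1 hk
    have hrank : ∀ p, 1 ≤ p → p < c → ∃ k, 1 ≤ k ∧ k < c ∧ ord k = s2.intArr 15 p :=
      fun p h1 hp => by
        obtain ⟨k, hk, e⟩ := hsurj _ (hP.vert_lt p hp)
        refine ⟨k, ?_, hk, e⟩
        rcases Nat.eq_zero_or_pos k with rfl | hk1
        · rw [hS.ord_zero] at e
          have := hP.pos_vert p hp
          rw [← e, hp0] at this
          omega
        · exact hk1
    refine ⟨?_, hS.par_zero, fun v hv => ?_, fun v hv => (hpv v hv).1, hP.vert_lt, hP.pos_vert,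
      fun v hv => (hpv v hv).2, hp0, fun v hv => ?_, fun p => sz (s2.intArr 15 p) + 1,
      fun p h1 hp => ?_, fun p hp => ?_, fun p hp => ⟨by omega, hbig _ (hP.vert_lt p hp)⟩,
      fun p h1 hp => ?_, fun p h1 hp h => ?_⟩
    · simp only [IntExp.steps, Test.steps] at ht2 ⊢
      omega
    · obtain ⟨k, hk, rfl⟩ := hsurj v hv
      rcases Nat.eq_zero_or_pos k with rfl | hk1
      · rw [hS.ord_zero, hS.par_zero]; exact hn
      · obtain ⟨l, hl, e, -⟩ := hS.parent k hk1 hk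
        rw [e]; exact hS.lt l (by omega)
    · obtain ⟨p, hp, rfl⟩ := hall v hv
      rw [hP.pos_vert p hp]
      rcases Nat.eq_zero_or_pos p with rfl | h1
      · rw [hr.1, hr.2, hS.par_zero, hp0]
      · obtain ⟨q, hq, e1, e2⟩ := hP.parent p h1 hp
        rw [e2, ← e1, hP.pos_vert q (by omega)]
    · obtain ⟨q, hq, e1, e2⟩ := hP.parent p h1 hp
      omega
    · rcases hP.path p hp with ⟨h1, -⟩ | ⟨h1, h2, h3, -⟩
      · exact Or.inl h1
      · exact Or.inr ⟨h1, h2, h3⟩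
    · obtain ⟨q, hq, e1, e2⟩ := hP.parent p h1 hp
      obtain ⟨k, hk1, hk, e⟩ := hrank p h1 hp
      have := hZ.mono k hk1 hk
      rw [e, ← e1] at this
      simp only [e2]
      omega
    · obtain ⟨q, hq, e1, e2⟩ := hP.parent p h1 hp
      obtain ⟨k, hk1, hk, e⟩ := hrank p h1 hp
      obtain ⟨-, h3, h4⟩ := hZ.parent k hk1 hk
      rw [e, ← e1] at h3 h4
      have h5 : heavy (s2.intArr 15 q) ≠ s2.intArr 15 p := by
        rcases hP.path p hp with ⟨-, h5 | h5⟩ | ⟨-, h5, -⟩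
        · omega
        · rwa [← e1] at h5
        · exfalso
          -- The start of a path never lies after its members, so a position that continues a path
          -- is not its own start.
          have h6 : ∀ p < c, s2.intArr 14 p ≤ p := by
            intro p
            induction p with
            | zero =>
              intro hp
              rcases hP.path 0 hp with ⟨h, -⟩ | ⟨h, -⟩ <;> omega
            | succ p ih =>
              intro hp
              rcases hP.path (p + 1) hp with ⟨h, -⟩ | ⟨-, h, -⟩
              · omega
              · rw [h, Nat.add_sub_cancel]
                exact (ih (by omega)).trans (by omega)
          have := h6 (p - 1) (by omega)
          omega
      have := h4.resolve_left h5
      simp only [e2]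
      omega

end RealRAM

namespace RealRAM

/-! ## The whole program -/

/-- Root the tree and lay it out along heavy paths. -/
def prepare : Cmd := search ;; computeSizes ;; placeAll

theorem prepare_spec {W : ℕ} (s : State) (n : ℕ) (off tgt : ℕ → ℕ) (hn : 1 ≤ n)
    (h0 : s.intVar 0 = n) (hoff : s.intArr 2 = off) (htgt : s.intArr 3 = tgt) (hoff0 : off 0 = 0)
    (hmono : ∀ u v, u ≤ v → v ≤ n → off u ≤ off v) (htn : ∀ j < off n, tgt j < n)
    (hconn : ∀ C : ℕ → Prop, C 0 → (∀ u < n, C u → ∀ v, ArcRel off tgt u v → C v) → ∀ u < n, C u)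
    (hW : 20 * n + 20 ≤ W) (hoW : off n + 2 ≤ W)
    (hz : ∀ a, 8 ≤ a → s.intArr a = fun _ => 0) :
    Spec W prepare s (60 * off n + 270 * n + 100) fun s' =>
      Layout n (s'.intArr 8) (s'.intArr 13) (s'.intArr 15) (s'.intArr 14) (s'.intArr 26) ∧
      ∀ v < n, v ≠ 0 → ArcRel off tgt (s'.intArr 8 v) v := by
  rw [Spec, prepare, wp_seq]
  refine (search_spec s n off tgt hn hoff htgt hoff0 hmono htn hconn hW hoW (hz 8 (by omega))
    (hz 9 (by omega)) (hz 10 (by omega))).wp fun s1 t1 f1 ht1 hS => ?_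
  rw [wp_seq]
  refine (computeSizes_spec s1 n _ _ _ _ hn ((f1.iv 0 rfl).trans h0) rfl rfl hS hW
    ((f1.ia 11 rfl).trans (hz 11 (by omega))) ((f1.ia 12 rfl).trans (hz 12 (by omega)))).wp
    fun s2 t2 f2 ht2 hZ => ?_
  rw [← f2.ia 8 rfl, ← f2.ia 9 rfl, ← f2.ia 10 rfl] at hS
  rw [← f2.ia 8 rfl, ← f2.ia 10 rfl] at hZ
  refine (placeAll_spec s2 n _ _ _ _ _ _ hn ((f2.iv 0 rfl).trans ((f1.iv 0 rfl).trans h0)) rfl rfl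
    rfl hS hZ hW).wp fun s3 t3 f3 ht3 hL => ?_
  rw [← f3.ia 8 rfl] at hL
  refine ⟨by omega, hL, fun v hv hv0 => ?_⟩
  obtain ⟨k, hk, rfl⟩ : ∃ k < n, s2.intArr 10 k = v := by
    have hinj : Set.InjOn (s2.intArr 10) (Finset.range n) := fun k hk l hl e =>
      hS.inj k (by simpa using hk) l (by simpa using hl) e
    have : (Finset.range n).image (s2.intArr 10) = Finset.range n := by
      refine Finset.eq_of_subset_of_card_le (fun v hv => ?_) ?_
      · obtain ⟨k, hk, rfl⟩ := Finset.mem_image.1 hv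
        exact Finset.mem_range.2 (hS.lt k (Finset.mem_range.1 hk))
      · rw [Finset.card_image_of_injOn hinj]
    obtain ⟨k, hk, e⟩ := Finset.mem_image.1 (this.symm ▸ Finset.mem_range.2 hv)
    exact ⟨k, Finset.mem_range.1 hk, e⟩
  have hk1 : 1 ≤ k := by
    rcases Nat.eq_zero_or_pos k with rfl | h
    · exact absurd hS.ord_zero hv0
    · exact h
  obtain ⟨l, hl, e, hR⟩ := hS.parent k hk1 hk
  rw [f3.ia 8 rfl, e]
  exact hR

/-- Set real variable 2 to a positive weight that is larger than four times the threshold. -/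
def setPenalty : Cmd :=
  .cond (.realLt (.var 0) .zero) (.setReal 2 .one)
    (.setReal 2 (.add .one (.add (.add (.var 0) (.var 0)) (.add (.var 0) (.var 0)))))

/-- Set real variable 1 to the threshold for the matrix. -/
def setThreshold : Cmd :=
  .setReal 1 (.sub (.add (.add (.var 0) (.var 0)) (.add (.var 0) (.var 0))) (.var 4))

/-- Store the events of all arcs and vertices. -/
def storeEvents : Cmd := arcsLoop ;; setPenalty ;; degreeTwoLoop ;; setThreshold

/-- The weight of the events at vertices of degree two. -/
noncomputable def penalty (β : ℝ) : ℝ := if β < 0 then 1 else 1 + (β + β + (β + β))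

/-- A negative threshold needs the separate value 1, because `1 + 4β` could be negative and would
then lower entries. -/
theorem penalty_pos (β : ℝ) : 0 < penalty β := by
  unfold penalty; split_ifs <;> linarith

theorem lt_penalty (β : ℝ) : 4 * β < penalty β := by
  unfold penalty; split_ifs <;> linarith

/-- The matrix whose small entries are the pairs of edges with non-trivial cuts of small weight. -/
noncomputable def costMatrix (n : ℕ) (off tgt : ℕ → ℕ) (w : ℕ → ℝ) (offT tgtT par pos pp : ℕ → ℕ)
    (κ : ℝ) (i k : ℕ) : ℝ :=
  (∑ u ∈ Finset.range n, ∑ j ∈ Finset.Ico (off u) (off (u + 1)),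
    arcTerm pp (w j) (pos u) (pos (tgt j)) i k) +
  ∑ u ∈ Finset.range n, degreeTwoTerm offT tgtT par pos κ u i k

theorem storeEvents_spec {W : ℕ} (s : State) (n : ℕ) (off tgt offT tgtT par pos vert hd pp : ℕ → ℕ)
    (w : ℕ → ℝ) (β : ℝ) (h0 : s.intVar 0 = n) (hβ : s.realVar 0 = β)
    (hL : Layout n par pos vert hd pp)
    (hoff : s.intArr 0 = off) (htgt : s.intArr 1 = tgt) (hw : s.realArr 0 = w)
    (hoffT : s.intArr 2 = offT) (htgtT : s.intArr 3 = tgtT)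
    (h8 : s.intArr 8 = par) (h13 : s.intArr 13 = pos) (h14 : s.intArr 14 = hd)
    (h26 : s.intArr 26 = pp) (hoff0 : off 0 = 0) (hmono : ∀ u v, u ≤ v → v ≤ n → off u ≤ off v)
    (htn : ∀ j < off n, tgt j < n) (hmonoT : ∀ u v, u ≤ v → v ≤ n → offT u ≤ offT v)
    (htnT : ∀ j < offT n, tgtT j < n) (hoW : offT n + 2 ≤ W)
    (hW : (off n + 4) * arcEvents n + 20 * n + 60 ≤ W)
    (hz : ∀ a, 17 ≤ a → a ≤ 19 → s.intArr a = fun _ => 0) (hq : s.intVar 33 = 0)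
    (hr4 : s.realVar 4 = 0) :
    Spec W storeEvents s (400 * arcEvents n * off n + 2400 * n + 200) fun s' =>
      s'.intVar 33 ≤ off n * arcEvents n + 16 * n ∧
      s'.realVar 1 =
        4 * β - ∑ u ∈ Finset.range n, ∑ j ∈ Finset.Ico (off u) (off (u + 1)), w j ∧
      ∃ rows, Events n s' rows ∧ ∀ i k, evMat s' rows i k =
        costMatrix n off tgt w offT tgtT par pos pp (penalty β) i k := by
  obtain ⟨sz, hT⟩ := hL.tree
  have hE : Events n s fun _ => [] := by
    refine ⟨fun x => ?_, by simp, by simp [hq]⟩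
    rw [hz 17 (by omega) (by omega)]
    rfl
  have hM0 : ∀ i k, evMat s (fun _ => []) i k = 0 := fun i k => by simp [evMat, evSum]
  rw [Spec, storeEvents, wp_seq]
  refine (arcsLoop_spec s n pp hd sz hT _ off tgt pos w h0 hoff htgt h13 hw hoff0 hmono htn
    hL.pos_lt h14 h26 (by omega) hE hq hr4 (by omega)).wp fun s1 t1 f1 ht1 h1 => ?_
  obtain ⟨g33, g4, rows1, hE1, hM1⟩ := h1
  rw [wp_seq]
  have eβ : s1.realVar 0 = β := (f1.rv 0 rfl).trans hβ
  have hpen : Spec W setPenalty s1 20 fun s' => s' = s1.setRealVar 2 (penalty β) := by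
    simp only [Spec, setPenalty, wp_cond, wp_setReal, Test.Holds, RealExp.eval, eβ, RealExp.steps,
      Test.steps, penalty]
    exact ⟨fun h => ⟨by omega, by rw [if_pos h]⟩, fun h => ⟨by omega, by rw [if_neg h]⟩⟩
  refine hpen.wp fun s2 t2 f2 ht2 h2 => ?_
  subst h2
  rw [wp_seq]
  have hA : off n * arcEvents n ≤ (off n + 4) * arcEvents n := Nat.mul_le_mul_right _ (by omega)
  refine (degreeTwoLoop_spec (s1.setRealVar 2 (penalty β)) n rows1 offT tgtT par pos (penalty β)
    (by simpa using (f1.iv 0 rfl).trans h0) (by simpa using (f1.ia 2 rfl).trans hoffT)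
    (by simpa using (f1.ia 3 rfl).trans htgtT) (by simpa using (f1.ia 8 rfl).trans h8)
    (by simpa using (f1.ia 13 rfl).trans h13) (by simp) hmonoT htnT hL.pos_lt hoW
    (by rw [setRealVar_intVar]; omega) (hE1.congr rfl rfl rfl rfl)).wp fun s3 t3 f3 ht3 h3 => ?_
  obtain ⟨q33, rows3, hE3, hM3⟩ := h3
  rw [setRealVar_intVar] at q33
  have e0 : s3.realVar 0 = β := (f3.rv 0 rfl).trans (by simpa using eβ)
  have e4 : s3.realVar 4 = s1.realVar 4 := (f3.rv 4 rfl).trans (by simp)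
  simp only [setThreshold, wp_setReal, RealExp.eval, e0, e4, g4]
  refine ⟨?_, ?_, ?_, rows3, hE3.congr rfl rfl rfl rfl, fun i k => ?_⟩
  · simp only [RealExp.steps]
    omega
  · rw [setRealVar_intVar]; omega
  · simp only [setRealVar_realVar, reduceIte]
    ring
  · have e : evMat (s1.setRealVar 2 (penalty β)) rows1 = evMat s1 rows1 := evMat_congr _ rfl rfl
    have e' : ∀ r, evMat (s3.setRealVar 1 r) rows3 = evMat s3 rows3 := fun r =>
      evMat_congr _ rfl rfl
    rw [e', hM3, e, hM1, hM0, zero_add, costMatrix]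

/-- The program of the theorem. -/
def spanningForestProgram : Cmd := prepare ;; storeEvents ;; initColours ;; sweep

/-- Input and result are described by arrays of numbers only. This separates the analysis of the
program from the graph theory, which afterwards interprets `costMatrix` in terms of cuts. -/
theorem spanningForestProgram_spec {W : ℕ} (s : State) (n : ℕ) (off tgt offT tgtT : ℕ → ℕ)
    (w : ℕ → ℝ) (β : ℝ) (hn : 1 ≤ n) (h0 : s.intVar 0 = n) (hβ : s.realVar 0 = β)
    (hoff : s.intArr 0 = off) (htgt : s.intArr 1 = tgt) (hw : s.realArr 0 = w)
    (hoffT : s.intArr 2 = offT) (htgtT : s.intArr 3 = tgtT)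
    (hoff0 : off 0 = 0) (hmono : ∀ u v, u ≤ v → v ≤ n → off u ≤ off v)
    (htn : ∀ j < off n, tgt j < n) (hoffT0 : offT 0 = 0)
    (hmonoT : ∀ u v, u ≤ v → v ≤ n → offT u ≤ offT v) (htnT : ∀ j < offT n, tgtT j < n)
    (hconn : ∀ C : ℕ → Prop, C 0 → (∀ u < n, C u → ∀ v, ArcRel offT tgtT u v → C v) →
      ∀ u < n, C u)
    (hoT : offT n ≤ 2 * n) (hW : (off n + 4) * arcEvents n + n * n + 20 * n + 60 ≤ W)
    (hz : ∀ a, 8 ≤ a → s.intArr a = fun _ => 0) (hzr : ∀ a, 1 ≤ a → s.realArr a = fun _ => 0)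
    (hzv : ∀ x, 1 ≤ x → s.intVar x = 0) (hzrv : ∀ x, 1 ≤ x → s.realVar x = 0) :
    Spec W spanningForestProgram s (900 * (Nat.log 2 n + 2) * (off n * arcEvents n + 17 * n) +
        900 * (Nat.log 2 n + 2) * (n * Nat.log 2 n) + 4000 * n + 1000) fun s' =>
      ∃ par pos vert hd pp, Layout n par pos vert hd pp ∧
        (∀ v < n, v ≠ 0 → ArcRel offT tgtT (par v) v) ∧
      ∃ P : ℕ → ℕ → Prop, (∀ i k, P i k ↔
          costMatrix n off tgt w offT tgtT par pos pp (penalty β) i k ≤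
          4 * β - ∑ u ∈ Finset.range n, ∑ j ∈ Finset.Ico (off u) (off (u + 1)), w j) ∧
      ∃ po col, Forest n P po col ∧ s'.intVar 1 = po.length ∧
        (∀ i (h : i < po.length), outputPair s' i =
          Sym2.map (fun p => s(par (vert p), vert p)) po[i]) ∧
        ∀ e x, EdgePos n e → EdgePos n x → P e x → col x = col e := by
  rw [Spec, spanningForestProgram, wp_seq]
  refine (prepare_spec s n offT tgtT hn h0 hoffT htgtT hoffT0 hmonoT htnT hconn (by omega)
    (by omega) hz).wp fun s1 t1 f1 ht1 h1 => ?_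
  obtain ⟨hL, hA⟩ := h1
  rw [wp_seq]
  refine (storeEvents_spec s1 n off tgt offT tgtT _ _ _ _ _ w β ((f1.iv 0 rfl).trans h0)
    ((f1.rv 0 rfl).trans hβ) hL ((f1.ia 0 rfl).trans hoff) ((f1.ia 1 rfl).trans htgt)
    ((f1.ra 0 rfl).trans hw) ((f1.ia 2 rfl).trans hoffT) ((f1.ia 3 rfl).trans htgtT) rfl rfl rfl
    rfl hoff0 hmono htn hmonoT htnT (by omega) (by omega) (fun a h1 h2 => ?_)
    ((f1.iv 33 rfl).trans (hzv 33 (by omega))) ((f1.rv 4 rfl).trans (hzrv 4 (by omega)))).wp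
    fun s2 t2 f2 ht2 h2 => ?_
  · obtain rfl | rfl | rfl : a = 17 ∨ a = 18 ∨ a = 19 := by omega
    · exact (f1.ia 17 rfl).trans (hz 17 (by omega))
    · exact (f1.ia 18 rfl).trans (hz 18 (by omega))
    · exact (f1.ia 19 rfl).trans (hz 19 (by omega))
  obtain ⟨g33, gθ, rows, hE, hM⟩ := h2
  rw [wp_seq]
  refine (initColours_spec s2 n (fun i k => evMat s2 rows i k ≤ s2.realVar 1) hn (by omega)
    ((f2.iv 0 rfl).trans ((f1.iv 0 rfl).trans h0))
    ((f2.iv 1 rfl).trans ((f1.iv 1 rfl).trans (hzv 1 (by omega)))) (fun a h1 h2 => ?_)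
    (fun a h1 h2 => ?_)).wp fun s3 t3 f3 ht3 h3 => ?_
  · obtain rfl | rfl | rfl | rfl | rfl | rfl : a = 20 ∨ a = 21 ∨ a = 22 ∨ a = 23 ∨ a = 24 ∨ a = 25 := by
      omega
    · exact (f2.ia 20 rfl).trans ((f1.ia 20 rfl).trans (hz 20 (by omega)))
    · exact (f2.ia 21 rfl).trans ((f1.ia 21 rfl).trans (hz 21 (by omega)))
    · exact (f2.ia 22 rfl).trans ((f1.ia 22 rfl).trans (hz 22 (by omega)))
    · exact (f2.ia 23 rfl).trans ((f1.ia 23 rfl).trans (hz 23 (by omega)))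
    · exact (f2.ia 24 rfl).trans ((f1.ia 24 rfl).trans (hz 24 (by omega)))
    · exact (f2.ia 25 rfl).trans ((f1.ia 25 rfl).trans (hz 25 (by omega)))
  · obtain rfl | rfl | rfl : a = 2 ∨ a = 3 ∨ a = 4 := by omega
    · exact (f2.ra 2 rfl).trans ((f1.ra 2 rfl).trans (hzr 2 (by omega)))
    · exact (f2.ra 3 rfl).trans ((f1.ra 3 rfl).trans (hzr 3 (by omega)))
    · exact (f2.ra 4 rfl).trans ((f1.ra 4 rfl).trans (hzr 4 (by omega)))
  obtain ⟨D, col0, hD, hD2, hDl, hN, hSw⟩ := h3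
  have hEs : Events n s3 rows := hE.congr (f3.ia 17 rfl) (f3.ia 18 rfl) (f3.ia 19 rfl) (f3.iv 33 rfl)
  have hlog : n * Nat.log 2 n ≤ n * n := Nat.mul_le_mul_left _ (Nat.log_le_self 2 n)
  refine (sweep_spec s3 n D rows (fun i k => evMat s2 rows i k ≤ s2.realVar 1) col0 ?_ hD (by omega)
    (by omega) ((f3.iv 0 rfl).trans ((f2.iv 0 rfl).trans ((f1.iv 0 rfl).trans h0))) hN hSw
    (fun x _ => hEs.link x) (fun x _ q hq => lt_of_le_of_lt (hEs.mem x q hq).2 hD)).wp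
    fun s4 t4 f4 ht4 h4 => ?_
  · funext e x
    rw [prefixSum_rowsSum, f3.rv 1 rfl, f3.ia 19 rfl, f3.ra 1 rfl]
    rfl
  obtain ⟨po, col, hF, ⟨ho1, ho2⟩, hc⟩ := h4
  refine ⟨?_, _, _, _, _, _, hL, hA, _, fun i k => ?_, po, col, hF, ho1, fun i h => ?_, hc⟩
  · have h5 : ∑ x ∈ Finset.range n, (rows x).length ≤ off n * arcEvents n + 16 * n := by
      -- Events with boundary `n` sit in row `n`, which the sweep never reads.
      refine le_trans (Finset.sum_le_sum_of_subset (Finset.range_mono (Nat.le_succ n))) ?_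
      rw [hE.card]
      exact g33
    have hl : D + 1 = Nat.log 2 n + 2 := by omega
    rw [hl] at ht4
    have h7 : 1 ≤ Nat.log 2 n + 2 := by omega
    generalize Nat.log 2 n + 2 = l at *
    have h6 := Nat.mul_le_mul_left (400 * l) h5
    have e1 : 400 * arcEvents n * off n = 400 * (off n * arcEvents n) := by ring
    have e2 : 900 * l * (off n * arcEvents n + 17 * n) =
      900 * (l * (off n * arcEvents n)) + 15300 * (l * n) := by ring
    have e3 : 400 * l * (off n * arcEvents n + 16 * n) =
      400 * (l * (off n * arcEvents n)) + 6400 * (l * n) := by ring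
    have e4 : 500 * l * n = 500 * (l * n) := by ring
    have e5 : off n * arcEvents n ≤ l * (off n * arcEvents n) := Nat.le_mul_of_pos_left _ h7
    rw [e1] at ht2
    rw [e4] at ht3
    rw [e3] at h6
    rw [e2]
    omega
  · rw [hM, gθ]
  · rw [ho2 i h, f4.ia 8 rfl, f4.ia 15 rfl, f3.ia 8 rfl, f3.ia 15 rfl, f2.ia 8 rfl, f2.ia 15 rfl]

end RealRAM

namespace RealRAM

/-! ## Cuts of a tree that is laid out on positions -/

theorem Anc.trans {pp : ℕ → ℕ} {u v x : ℕ} (h1 : Anc pp u v) (h2 : Anc pp v x) : Anc pp u x := by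
  induction h2 with
  | refl => exact h1
  | step h0 _ ih => exact .step h0 ih

/-- The ancestors of `x` are its iterated parents, and these form a chain. -/
theorem Anc.comparable {pp : ℕ → ℕ} {p q x : ℕ} (h1 : Anc pp p x) (h2 : Anc pp q x) :
    Anc pp p q ∨ Anc pp q p := by
  induction h1 with
  | refl => exact Or.inr h2
  | step h0 h ih =>
    rcases anc_iff.1 h2 with rfl | ⟨-, h2⟩
    · exact Or.inl (.step h0 h)
    · exact ih h2

theorem iff_iff_comm {a b c d : Prop} (h : (a ↔ b) ↔ (c ↔ d)) : (a ↔ c) ↔ (b ↔ d) := by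
  by_cases ha : a <;> by_cases hb : b <;> by_cases hc : c <;> by_cases hd : d <;>
    simp_all only [iff_true, iff_false, not_true]

/-- The tree `T` has the parent function `pp` on the positions `ps v` of its vertices `v`. -/
structure TreeLayout {n : ℕ} (T : SimpleGraph (Fin n)) (pp : ℕ → ℕ) (ps : Fin n → ℕ)
    (vt : ℕ → Fin n) : Prop where
  ps_lt : ∀ v, ps v < n
  vt_ps : ∀ v, vt (ps v) = v
  ps_vt : ∀ p < n, ps (vt p) = p
  lt : ∀ p, 1 ≤ p → p < n → pp p < p
  adj : ∀ u v, T.Adj u v ↔ (ps v ≠ 0 ∧ pp (ps v) = ps u) ∨ (ps u ≠ 0 ∧ pp (ps u) = ps v)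

/-- The tree edge between the vertex at position `p` and its parent. -/
def treeEdge {n : ℕ} (pp : ℕ → ℕ) (vt : ℕ → Fin n) (p : ℕ) : Sym2 (Fin n) := s(vt (pp p), vt p)

namespace TreeLayout

variable {n : ℕ} {T : SimpleGraph (Fin n)} {pp : ℕ → ℕ} {ps : Fin n → ℕ} {vt : ℕ → Fin n}

theorem anc_le (h : TreeLayout T pp ps vt) {p x : ℕ} (ha : Anc pp p x) (hx : x < n) : p ≤ x := by
  induction ha with
  | refl => exact le_rfl
  | step h0 _ ih =>
    have := h.lt _ (by omega) hx
    have := ih (by omega)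
    omega

theorem adj_treeEdge (h : TreeLayout T pp ps vt) {p : ℕ} (hp : EdgePos n p) :
    T.Adj (vt (pp p)) (vt p) := by
  have := h.lt p hp.1 hp.2
  rw [h.adj, h.ps_vt p hp.2, h.ps_vt (pp p) (by have := hp.2; omega)]
  exact Or.inl ⟨by have := hp.1; omega, rfl⟩

theorem treeEdge_mem (h : TreeLayout T pp ps vt) {p : ℕ} (hp : EdgePos n p) :
    treeEdge pp vt p ∈ T.edgeSet := h.adj_treeEdge hp

theorem treeEdge_of_adj (h : TreeLayout T pp ps vt) {u v : Fin n}
    (hp : pp (ps v) = ps u) : s(u, v) = treeEdge pp vt (ps v) := by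
  rw [treeEdge, hp, h.vt_ps, h.vt_ps]

theorem exists_treeEdge (h : TreeLayout T pp ps vt) {e : Sym2 (Fin n)} (he : e ∈ T.edgeSet) :
    ∃ p, EdgePos n p ∧ e = treeEdge pp vt p := by
  induction e with
  | _ u v =>
    rw [SimpleGraph.mem_edgeSet, h.adj] at he
    rcases he with ⟨h0, h1⟩ | ⟨h0, h1⟩
    · exact ⟨ps v, ⟨by omega, h.ps_lt v⟩, h.treeEdge_of_adj h1⟩
    · exact ⟨ps u, ⟨by omega, h.ps_lt u⟩, by rw [Sym2.eq_swap]; exact h.treeEdge_of_adj h1⟩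

theorem vt_inj (h : TreeLayout T pp ps vt) {p q : ℕ} (hp : p < n) (hq : q < n)
    (e : vt p = vt q) : p = q := by
  rw [← h.ps_vt p hp, e, h.ps_vt q hq]

theorem treeEdge_inj (h : TreeLayout T pp ps vt) {p q : ℕ} (hp : EdgePos n p) (hq : EdgePos n q)
    (e : treeEdge pp vt p = treeEdge pp vt q) : p = q := by
  obtain ⟨hp1, hpn⟩ := hp
  obtain ⟨hq1, hqn⟩ := hq
  have h1 := h.lt p hp1 hpn
  have h2 := h.lt q hq1 hqn
  rcases Sym2.eq_iff.1 e with ⟨-, e⟩ | ⟨e1, e2⟩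
  · exact h.vt_inj hpn hqn e
  · have := h.vt_inj (by omega) hqn e1
    have := h.vt_inj hpn (by omega) e2
    omega

theorem anc_vt (h : TreeLayout T pp ps vt) {p : ℕ} (hp : EdgePos n p) : Anc pp p (ps (vt p)) := by
  rw [h.ps_vt p hp.2]
  exact .refl

theorem not_anc_vt (h : TreeLayout T pp ps vt) {p : ℕ} (hp : EdgePos n p) :
    ¬ Anc pp p (ps (vt (pp p))) := by
  have h1 := h.lt p hp.1 hp.2
  have h2 := hp.2
  rw [h.ps_vt (pp p) (by omega)]
  intro ha
  have := h.anc_le ha (by omega)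
  omega

/-- The lower endpoint of the edge is not at position `p`, so whether it has `p` as an ancestor is
decided at its parent, the upper endpoint. -/
theorem anc_iff_of_adj (h : TreeLayout T pp ps vt) {p : ℕ} {u v : Fin n}
    (ha : T.Adj u v) (hne : s(u, v) ≠ treeEdge pp vt p) : Anc pp p (ps u) ↔ Anc pp p (ps v) := by
  have key : ∀ u v : Fin n, s(u, v) ≠ treeEdge pp vt p → ps v ≠ 0 → pp (ps v) = ps u →
      (Anc pp p (ps u) ↔ Anc pp p (ps v)) := by
    intro u v hne h0 h1
    rw [anc_iff (x := ps v), h1]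
    have : ps v ≠ p := fun e => hne (by rw [h.treeEdge_of_adj h1, e])
    simp [h0, this]
  rcases (h.adj u v).1 ha with ⟨h0, h1⟩ | ⟨h0, h1⟩
  · exact key u v hne h0 h1
  · exact (key v u (by rwa [Sym2.eq_swap]) h0 h1).symm

/-- By `anc_iff_of_adj` no remaining edge leads from the descendants of `p` to the other vertices.
Conversely, climbing to parents without using the deleted edge connects every descendant with `p`
and every other vertex with position 0. -/
theorem reachable_iff (h : TreeLayout T pp ps vt) {p : ℕ} (hp : EdgePos n p) (u v : Fin n) :
    (T.deleteEdges {treeEdge pp vt p}).Reachable u v ↔ (Anc pp p (ps u) ↔ Anc pp p (ps v)) := by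
  constructor
  · rintro ⟨w⟩
    induction w with
    | nil => exact Iff.rfl
    | cons ha _ ih =>
      rw [← ih]
      rw [SimpleGraph.deleteEdges_adj] at ha
      exact h.anc_iff_of_adj ha.1 ha.2
  · have hadj : ∀ x : Fin n, ps x ≠ 0 → ps x ≠ p →
        (T.deleteEdges {treeEdge pp vt p}).Adj x (vt (pp (ps x))) := by
      intro x h0 hxp
      have hx : EdgePos n (ps x) := ⟨by omega, h.ps_lt x⟩
      rw [SimpleGraph.deleteEdges_adj]
      refine ⟨?_, fun e => hxp (h.treeEdge_inj hx hp ?_)⟩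
      · have := h.adj_treeEdge hx
        rw [h.vt_ps] at this
        exact this.symm
      · rw [← Set.mem_singleton_iff.1 e, treeEdge, h.vt_ps, Sym2.eq_swap]
    have hps : ∀ x : Fin n, ps x ≠ 0 → ps (vt (pp (ps x))) = pp (ps x) ∧ pp (ps x) < ps x := by
      intro x h0
      have h1 := h.lt (ps x) (by omega) (h.ps_lt x)
      have h2 := h.ps_lt x
      exact ⟨h.ps_vt _ (by omega), h1⟩
    have h1 : ∀ k, ∀ x : Fin n, ps x = k → Anc pp p (ps x) →
        (T.deleteEdges {treeEdge pp vt p}).Reachable x (vt p) := by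
      intro k
      induction k using Nat.strong_induction_on with
      | _ k ih =>
        rintro x rfl ha
        rcases anc_iff.1 ha with e | ⟨h0, ha'⟩
        · rw [← e, h.vt_ps]
        · by_cases e : ps x = p
          · rw [← e, h.vt_ps]
          · obtain ⟨i1, i2⟩ := hps x h0
            exact (hadj x h0 e).reachable.trans (ih _ i2 _ i1 (by rwa [i1]))
    have h2 : ∀ k, ∀ x : Fin n, ps x = k → ¬ Anc pp p (ps x) →
        (T.deleteEdges {treeEdge pp vt p}).Reachable x (vt 0) := by
      intro k
      induction k using Nat.strong_induction_on with
      | _ k ih =>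
        rintro x rfl ha
        by_cases h0 : ps x = 0
        · rw [← h0, h.vt_ps]
        · obtain ⟨i1, i2⟩ := hps x h0
          have e : ps x ≠ p := fun e => ha (e ▸ .refl)
          exact (hadj x h0 e).reachable.trans
            (ih _ i2 _ i1 (by rw [i1]; exact fun h => ha (.step h0 h)))
    intro he
    by_cases ha : Anc pp p (ps u)
    · exact (h1 _ u rfl ha).trans (h1 _ v rfl (he.1 ha)).symm
    · exact (h2 _ u rfl ha).trans (h2 _ v rfl (fun hv => ha (he.2 hv))).symm

/-- The root `r` is arbitrary, whereas the layout is rooted at position 0, so either side of the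
edge can be the lower one. What counts is whether the edge separates `x` from `r`. -/
theorem mem_below (h : TreeLayout T pp ps vt) {p : ℕ} (hp : EdgePos n p) (r x : Fin n) :
    x ∈ below T r (treeEdge pp vt p) ↔ ¬ (Anc pp p (ps r) ↔ Anc pp p (ps x)) := by
  rw [below, Set.mem_ofPred_eq, h.reachable_iff hp]

theorem mem_subtreeEdges (h : TreeLayout T pp ps vt) {p q : ℕ} (hp : EdgePos n p)
    (hq : EdgePos n q) (hpq : p ≠ q) (r : Fin n) :
    treeEdge pp vt q ∈ subtreeEdges T r (treeEdge pp vt p) ↔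
      ¬ (Anc pp p (ps r) ↔ Anc pp p q) := by
  have h1 : Anc pp p (ps (vt (pp q))) ↔ Anc pp p (ps (vt q)) :=
    h.anc_iff_of_adj (h.adj_treeEdge hq) fun e => hpq (h.treeEdge_inj hq hp e).symm
  have h2 : ∀ v, v ∈ treeEdge pp vt q ↔ v = vt (pp q) ∨ v = vt q := fun v => Sym2.mem_iff
  rw [subtreeEdges, Set.mem_ofPred_eq, and_iff_right (h.treeEdge_mem hq)]
  simp only [h2, forall_eq_or_imp, forall_eq, h.mem_below hp, h1, and_self, h.ps_vt q hq.2]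

/-- In each of the three cases the shore is the symmetric difference of the two sets below the
edges, which are nested in the first two cases and disjoint in the third. Transitivity and
comparability of ancestors at `r` and `x` reduce this to propositional logic. -/
theorem mem_pairShore (h : TreeLayout T pp ps vt) {p q : ℕ} (hp : EdgePos n p)
    (hq : EdgePos n q) (hpq : p ≠ q) (r x : Fin n) :
    x ∈ pairShore T r (treeEdge pp vt p) (treeEdge pp vt q) ↔
      ¬ ((Anc pp p (ps r) ↔ Anc pp p (ps x)) ↔ (Anc pp q (ps r) ↔ Anc pp q (ps x))) := by
  have hr1 : Anc pp p (ps r) → Anc pp q (ps r) → Anc pp p q ∨ Anc pp q p := Anc.comparable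
  have hx1 : Anc pp p (ps x) → Anc pp q (ps x) → Anc pp p q ∨ Anc pp q p := Anc.comparable
  have hr2 : Anc pp p q → Anc pp q (ps r) → Anc pp p (ps r) := Anc.trans
  have hx2 : Anc pp p q → Anc pp q (ps x) → Anc pp p (ps x) := Anc.trans
  have hr3 : Anc pp q p → Anc pp p (ps r) → Anc pp q (ps r) := Anc.trans
  have hx3 : Anc pp q p → Anc pp p (ps x) → Anc pp q (ps x) := Anc.trans
  have hn : ¬ (Anc pp p q ∧ Anc pp q p) := fun ⟨h1, h2⟩ =>
    hpq (le_antisymm (h.anc_le h1 hq.2) (h.anc_le h2 hp.2))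
  have e1 := h.mem_subtreeEdges hp hq hpq r
  have e2 := h.mem_subtreeEdges hq hp hpq.symm r
  have e3 := h.mem_below hp r x
  have e4 := h.mem_below hq r x
  unfold pairShore
  split_ifs with c1 c2
  · rw [e1] at c1
    rw [Set.mem_sdiff, e3, e4]
    clear e1 e2 e3 e4
    by_cases a1 : Anc pp p (ps r) <;> by_cases a2 : Anc pp q (ps r) <;>
      by_cases a3 : Anc pp p (ps x) <;> by_cases a4 : Anc pp q (ps x) <;> 
      simp only [a1, a2, a3, a4, true_implies, iff_true, iff_false, true_iff, false_iff, not_true,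
        not_false_iff, implies_true, false_implies] at * <;> tauto
  · rw [e1] at c1
    rw [e2] at c2
    rw [Set.mem_sdiff, e3, e4]
    clear e1 e2 e3 e4
    by_cases a1 : Anc pp p (ps r) <;> by_cases a2 : Anc pp q (ps r) <;>
      by_cases a3 : Anc pp p (ps x) <;> by_cases a4 : Anc pp q (ps x) <;> 
      simp only [a1, a2, a3, a4, true_implies, iff_true, iff_false, true_iff, false_iff, not_true,
        not_false_iff, implies_true, false_implies] at * <;> tauto
  · rw [e1] at c1
    rw [e2] at c2
    rw [Set.mem_union, e3, e4]
    clear e1 e2 e3 e4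
    by_cases a1 : Anc pp p (ps r) <;> by_cases a2 : Anc pp q (ps r) <;>
      by_cases a3 : Anc pp p (ps x) <;> by_cases a4 : Anc pp q (ps x) <;> 
      simp only [a1, a2, a3, a4, true_implies, iff_true, iff_false, true_iff, false_iff, not_true,
        not_false_iff, implies_true, false_implies] at * <;> tauto

theorem pairShore_comm (h : TreeLayout T pp ps vt) {p q : ℕ} (hp : EdgePos n p)
    (hq : EdgePos n q) (hpq : p ≠ q) (r : Fin n) :
    pairShore T r (treeEdge pp vt p) (treeEdge pp vt q) =
      pairShore T r (treeEdge pp vt q) (treeEdge pp vt p) := by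
  ext x
  rw [h.mem_pairShore hp hq hpq, h.mem_pairShore hq hp hpq.symm, iff_comm (a := _ ↔ _)]

/-- Comparing two vertices `x` and `y` cancels every condition at `r`. This is the reason why the
cut, unlike its shore, is independent of the root. -/
theorem pairShore_cross (h : TreeLayout T pp ps vt) {p q : ℕ} (hp : EdgePos n p)
    (hq : EdgePos n q) (hpq : p ≠ q) (r x y : Fin n) :
    (x ∈ pairShore T r (treeEdge pp vt p) (treeEdge pp vt q) ↔
      y ∈ pairShore T r (treeEdge pp vt p) (treeEdge pp vt q)) ↔
      ((Anc pp p (ps x) ↔ Anc pp p (ps y)) ↔ (Anc pp q (ps x) ↔ Anc pp q (ps y))) := by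
  rw [h.mem_pairShore hp hq hpq, h.mem_pairShore hp hq hpq]
  generalize Anc pp p (ps r) = a
  generalize Anc pp q (ps r) = b
  generalize Anc pp p (ps x) = c
  generalize Anc pp p (ps y) = d
  generalize Anc pp q (ps x) = e
  generalize Anc pp q (ps y) = f
  by_cases ha : a <;> by_cases hb : b <;> by_cases hc : c <;> by_cases hd : d <;>
    by_cases he : e <;> by_cases hf : f <;>
    simp only [ha, hb, hc, hd, he, hf, iff_true, iff_false, not_true,
      not_false_iff]

theorem pairShore_cross_adj (h : TreeLayout T pp ps vt) {p q : ℕ} (hp : EdgePos n p)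
    (hq : EdgePos n q) (hpq : p ≠ q) (r : Fin n) {x y : Fin n} (ha : T.Adj x y) :
    (x ∈ pairShore T r (treeEdge pp vt p) (treeEdge pp vt q) ↔
      y ∈ pairShore T r (treeEdge pp vt p) (treeEdge pp vt q)) ↔
      ¬ (s(x, y) = treeEdge pp vt p ∨ s(x, y) = treeEdge pp vt q) := by
  have key : ∀ {p}, EdgePos n p → (s(x, y) = treeEdge pp vt p ↔
      ¬ (Anc pp p (ps x) ↔ Anc pp p (ps y))) := by
    intro p hp
    refine ⟨fun e => ?_, fun hne => by_contra fun e => hne (h.anc_iff_of_adj ha e)⟩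
    have h1 := h.anc_vt hp
    have h2 := h.not_anc_vt hp
    rcases Sym2.eq_iff.1 e with ⟨rfl, rfl⟩ | ⟨rfl, rfl⟩ <;> tauto
  have hn : ¬ (s(x, y) = treeEdge pp vt p ∧ s(x, y) = treeEdge pp vt q) := fun ⟨h1, h2⟩ =>
    hpq (h.treeEdge_inj hp hq (h1.symm.trans h2))
  rw [h.pairShore_cross hp hq hpq]
  rw [key hp, key hq] at *
  tauto

/-- The edges at the vertex `v` are those at the positions `p` and `q`. -/
def Between (T : SimpleGraph (Fin n)) (pp : ℕ → ℕ) (vt : ℕ → Fin n) (p q : ℕ) (v : Fin n) : Prop :=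
  v ∈ treeEdge pp vt p ∧ v ∈ treeEdge pp vt q ∧
    ∀ a, T.Adj v a → s(v, a) = treeEdge pp vt p ∨ s(v, a) = treeEdge pp vt q

/-- The tree edges across the cut are exactly those at `p` and `q`. If they are all the tree edges
at `v`, then membership in `S` and equality with `v` change along the same tree edges, so by
connectivity `S` is `{v}` or its complement. Conversely, both shores are non-empty; if one of them
is a single vertex, both crossing tree edges contain this vertex and every tree edge at it crosses.
-/
theorem nontrivialShore_iff (h : TreeLayout T pp ps vt) (hT : T.Connected) {p q : ℕ}
    (hp : EdgePos n p) (hq : EdgePos n q) (hpq : p ≠ q) (r : Fin n) :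
    NontrivialShore (pairShore T r (treeEdge pp vt p) (treeEdge pp vt q)) ↔
      ¬ ∃ v, Between T pp vt p q v := by
  have hcross := fun {x y : Fin n} (ha : T.Adj x y) => h.pairShore_cross_adj hp hq hpq r ha
  generalize pairShore T r (treeEdge pp vt p) (treeEdge pp vt q) = S at *
  have hpc : ¬ (vt (pp p) ∈ S ↔ vt p ∈ S) := by
    rw [hcross (h.adj_treeEdge hp)]
    exact fun h => h (Or.inl rfl)
  have hqc : ¬ (vt (pp q) ∈ S ↔ vt q ∈ S) := by
    rw [hcross (h.adj_treeEdge hq)]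
    exact fun h => h (Or.inr rfl)
  have hne : S.Nonempty := by
    by_cases a : vt p ∈ S
    · exact ⟨_, a⟩
    · exact ⟨vt (pp p), by tauto⟩
  have hne' : Sᶜ.Nonempty := by
    by_cases a : vt p ∈ S
    · exact ⟨vt (pp p), by rw [Set.mem_compl_iff]; tauto⟩
    · exact ⟨vt p, a⟩
  have key : ∀ R : Set (Fin n), (∀ x y, (x ∈ R ↔ y ∈ R) ↔ (x ∈ S ↔ y ∈ S)) → R.Nonempty →
      ¬ 2 ≤ R.ncard → ∃ v, Between T pp vt p q v := by
    intro R hR hRn hR2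
    have h1 : R.ncard = 1 := by
      have := (Set.ncard_pos (Set.toFinite R)).2 hRn
      omega
    obtain ⟨v, rfl⟩ := Set.ncard_eq_one.1 h1
    simp only [Set.mem_singleton_iff] at hR
    have hm : ∀ p, ¬ (vt (pp p) ∈ S ↔ vt p ∈ S) → v ∈ treeEdge pp vt p := by
      intro p hpc
      rw [← hR] at hpc
      rw [treeEdge, Sym2.mem_iff]
      by_contra hc
      exact hpc (by
        constructor
        · intro e; exact absurd (Or.inl e.symm) hc
        · intro e; exact absurd (Or.inr e.symm) hc)
    refine ⟨v, hm p hpc, hm q hqc, fun a ha => by_contra fun hc => ?_⟩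
    have := (hcross ha).2 hc
    rw [← hR] at this
    exact ha.ne (this.1 rfl).symm
  constructor
  · rintro ⟨h2, h2'⟩ ⟨v, hv1, hv2, hv⟩
    have hconst : ∀ x y, T.Reachable x y → ((x ∈ S ↔ x = v) ↔ (y ∈ S ↔ y = v)) := by
      rintro x y ⟨w⟩
      induction w with
      | nil => exact Iff.rfl
      | cons ha _ ih =>
        rename_i x y _ _
        rw [← ih]
        have h1 := hcross ha
        have h3 : (x = v ↔ y = v) ↔ ¬ (s(x, y) = treeEdge pp vt p ∨ s(x, y) = treeEdge pp vt q) := by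
          constructor
          · intro he hc
            have hmem : v ∈ s(x, y) := by
              rcases hc with hc | hc <;> rw [hc] <;> assumption
            rcases Sym2.mem_iff.1 hmem with e | e
            · exact ha.ne (e.symm.trans (he.1 e.symm).symm)
            · exact ha.ne ((he.2 e.symm).trans e)
          · intro hc
            constructor
            · rintro rfl
              exact absurd (hv y ha) hc
            · rintro rfl
              refine absurd (hv x ha.symm) ?_
              rwa [Sym2.eq_swap]
        exact iff_iff_comm (h1.trans h3.symm)
    by_cases hvS : v ∈ S
    · have : S ⊆ {v} := fun x hx =>
        ((hconst v x (hT.preconnected v x)).1 (by simp [hvS])).1 hx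
      have := (Set.ncard_le_ncard this).trans (Set.ncard_singleton v).le
      omega
    · have : Sᶜ ⊆ {v} := fun x hx => by
        have := (hconst v x (hT.preconnected v x))
        rw [Set.mem_compl_iff] at hx
        rw [Set.mem_singleton_iff]
        tauto
      have := (Set.ncard_le_ncard this).trans (Set.ncard_singleton v).le
      omega
  · intro hno
    refine ⟨by_contra fun hc => hno (key S (fun _ _ => Iff.rfl) hne hc),
      by_contra fun hc => hno (key Sᶜ (fun x y => ?_) hne' hc)⟩
    simp only [Set.mem_compl_iff]
    tauto

end TreeLayout

end RealRAM

namespace RealRAM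

/-! ## The arrays of an adjacency list -/

section AdjList

variable {n : ℕ}

/-- The arcs of the vertices before `u`. -/
def arcsBefore (A : Fin n → List (Fin n)) (u : ℕ) : List (Fin n × Fin n) :=
  ((List.finRange n).take u).flatMap fun v => (A v).map fun x => (v, x)

theorem arcs_eq (A : Fin n → List (Fin n)) (u : ℕ) : arcs A = arcsBefore A u ++
    ((List.finRange n).drop u).flatMap fun v => (A v).map fun x => (v, x) := by
  rw [arcs, arcsBefore, ← List.flatMap_append, List.take_append_drop]

theorem offset_eq (A : Fin n → List (Fin n)) {u : ℕ} (hu : u ≤ n) :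
    offset A u = (arcsBefore A u).length := by
  rw [offset, if_pos hu, arcs_eq A u, List.countP_append]
  have h1 : (arcsBefore A u).countP (fun a => a.1.val < u) = (arcsBefore A u).length := by
    rw [List.countP_eq_length]
    intro a ha
    obtain ⟨v, hv, ha⟩ := List.mem_flatMap.1 ha
    obtain ⟨x, -, rfl⟩ := List.mem_map.1 ha
    obtain ⟨i, hi, rfl⟩ := List.mem_iff_getElem.1 hv
    simp only [List.length_take, List.length_finRange] at hi
    simp only [List.getElem_take, List.getElem_finRange, decide_eq_true_eq, Fin.val_cast]
    omega
  have h2 : (((List.finRange n).drop u).flatMap fun v => (A v).map fun x => (v, x)).countP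
      (fun a => a.1.val < u) = 0 := by
    rw [List.countP_eq_zero]
    intro a ha
    obtain ⟨v, hv, ha⟩ := List.mem_flatMap.1 ha
    obtain ⟨x, -, rfl⟩ := List.mem_map.1 ha
    obtain ⟨i, hi, rfl⟩ := List.mem_iff_getElem.1 hv
    simp only [List.getElem_drop, List.getElem_finRange, decide_eq_true_eq, Fin.val_cast]
    omega
  rw [h1, h2, add_zero]

theorem arcsBefore_succ (A : Fin n → List (Fin n)) (u : Fin n) :
    arcsBefore A (u + 1) = arcsBefore A u ++ (A u).map fun x => (u, x) := by
  rw [arcsBefore, arcsBefore, List.take_add_one, List.flatMap_append]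
  congr 1
  simp

theorem offset_zero (A : Fin n → List (Fin n)) : offset A 0 = 0 := by
  simp [offset_eq A (Nat.zero_le n), arcsBefore]

theorem offset_succ (A : Fin n → List (Fin n)) (u : Fin n) :
    offset A (u + 1) = offset A u + (A u).length := by
  rw [offset_eq A u.2, offset_eq A u.2.le, arcsBefore_succ]
  simp

theorem offset_mono (A : Fin n → List (Fin n)) (u v : ℕ) (h : u ≤ v) (hv : v ≤ n) :
    offset A u ≤ offset A v := by
  rw [offset, offset, if_pos hv, if_pos (h.trans hv)]
  refine List.countP_mono_left fun a _ ha => ?_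
  simp only [decide_eq_true_eq] at ha ⊢
  omega

theorem offset_last (A : Fin n → List (Fin n)) : offset A n = (arcs A).length := by
  rw [offset_eq A le_rfl, arcsBefore, arcs, List.take_of_length_le (by simp)]

theorem offset_last_eq_sum (A : Fin n → List (Fin n)) : offset A n = ∑ u, (A u).length := by
  rw [offset_last, arcs, List.length_flatMap]
  simp [← List.ofFn_eq_map, List.sum_ofFn]

theorem target_lt (A : Fin n → List (Fin n)) (j : ℕ) (hj : j < offset A n) : target A j < n := by
  rw [offset_last] at hj
  simp [target, List.getElem?_eq_getElem hj]

theorem arcs_getElem? (A : Fin n → List (Fin n)) (u : Fin n) {k : ℕ} (hk : k < (A u).length) :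
    (arcs A)[offset A u + k]? = some (u, (A u)[k]) := by
  have h1 := offset_eq A u.2.le
  rw [arcs_eq A (u + 1), arcsBefore_succ, List.append_assoc, List.getElem?_append_right (by omega),
    h1, Nat.add_sub_cancel_left, List.getElem?_append_left (by simpa using hk)]
  simp [hk]

theorem target_offset (A : Fin n → List (Fin n)) (u : Fin n) {k : ℕ} (hk : k < (A u).length) :
    target A (offset A u + k) = (A u)[k] := by
  rw [target, arcs_getElem? A u hk]
  rfl

theorem arcWeight_offset (A : Fin n → List (Fin n)) (w : Sym2 (Fin n) → ℝ) (u : Fin n) {k : ℕ}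
    (hk : k < (A u).length) : arcWeight A w (offset A u + k) = w s(u, (A u)[k]) := by
  rw [arcWeight, arcs_getElem? A u hk]
  rfl

theorem sum_arcs (A : Fin n → List (Fin n)) (f : ℕ → ℕ → ℝ) (g : Fin n → Fin n → ℝ)
    (h : ∀ u : Fin n, ∀ k (hk : k < (A u).length), f u (offset A u + k) = g u (A u)[k]) :
    ∑ u ∈ Finset.range n, ∑ j ∈ Finset.Ico (offset A u) (offset A (u + 1)), f u j =
      ∑ u, ((A u).map (g u)).sum := by
  rw [Finset.sum_range]
  refine Finset.sum_congr rfl fun u _ => ?_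
  rw [offset_succ, Finset.sum_Ico_eq_sum_range, Nat.add_sub_cancel_left, Finset.sum_range,
    ← List.sum_ofFn]
  congr 1
  refine List.ext_getElem (by simp) fun i h1 h2 => ?_
  simp [h u i (by simpa using h1)]

open Classical in
theorem IsAdjList.sum_map {G : SimpleGraph (Fin n)} {A : Fin n → List (Fin n)} (hA : IsAdjList G A)
    (u : Fin n) (g : Fin n → ℝ) : ((A u).map g).sum = ∑ v, if G.Adj u v then g v else 0 := by
  rw [← List.sum_toFinset _ (hA u).1, ← Finset.sum_filter]
  refine Finset.sum_congr ?_ fun _ _ => rfl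
  ext v
  simp [(hA u).2]

theorem IsAdjList.arcRel {G : SimpleGraph (Fin n)} {A : Fin n → List (Fin n)} (hA : IsAdjList G A)
    (u v : Fin n) : ArcRel (offset A) (target A) u v ↔ G.Adj u v := by
  rw [← (hA u).2]
  constructor
  · rintro ⟨j, h1, h2, h3⟩
    rw [offset_succ] at h2
    obtain ⟨k, rfl⟩ := Nat.exists_eq_add_of_le h1
    rw [target_offset A u (by omega)] at h3
    rw [← Fin.ext h3]
    exact List.getElem_mem _
  · intro h
    obtain ⟨k, hk, e⟩ := List.mem_iff_getElem.1 h
    exact ⟨offset A u + k, by omega, by rw [offset_succ]; omega, by rw [target_offset A u hk, e]⟩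

open Classical in
theorem IsAdjList.offset_last {G : SimpleGraph (Fin n)} {A : Fin n → List (Fin n)}
    (hA : IsAdjList G A) : offset A n = 2 * G.edgeSet.ncard := by
  rw [offset_last_eq_sum, ← SimpleGraph.coe_edgeFinset, Set.ncard_coe_finset,
    ← G.sum_degrees_eq_twice_card_edges]
  refine Finset.sum_congr rfl fun u _ => ?_
  rw [← List.toFinset_card_of_nodup (hA u).1, ← G.card_neighborFinset_eq_degree]
  congr 1
  ext v
  simp [(hA u).2]

end AdjList

end RealRAM

namespace RealRAM

/-! ## The cost matrix and the graph on the tree edges -/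

section Cuts

variable {n : ℕ}

-- Pairs with the first vertex in `S` and the second outside correspond bijectively to the edges of
-- the cut, and so do the reversed pairs.
open Classical in
theorem sum_cross_eq_two_mul_cutWeight (G : SimpleGraph (Fin n)) (w : Sym2 (Fin n) → ℝ)
    (S : Set (Fin n)) : ∑ u, ∑ v, (if G.Adj u v ∧ ¬ (u ∈ S ↔ v ∈ S) then w s(u, v) else 0) =
      2 * cutWeight G w S := by
  have h1 : cutWeight G w S =
      ∑ u, ∑ v, (if G.Adj u v ∧ u ∈ S ∧ v ∉ S then w s(u, v) else 0) := by
    rw [← Finset.sum_product' (f := fun u v => if G.Adj u v ∧ u ∈ S ∧ v ∉ S then w s(u, v) else 0),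
      ← Finset.sum_filter, cutWeight]
    rw [← Finset.sum_image (f := w) (g := fun x : Fin n × Fin n => s(x.1, x.2))]
    · refine Finset.sum_congr ?_ fun _ _ => rfl
      ext e
      rw [Finset.mem_filter, Finset.mem_image]
      constructor
      · rintro ⟨-, he, u, hu, v, hv, rfl⟩
        exact ⟨(u, v), Finset.mem_filter.2 ⟨by simp, he, hu, hv⟩, rfl⟩
      · rintro ⟨⟨u, v⟩, h, rfl⟩
        obtain ⟨-, he, hu, hv⟩ := Finset.mem_filter.1 h
        exact ⟨Finset.mem_univ _, he, u, hu, v, hv, rfl⟩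
    · rintro ⟨u, v⟩ h ⟨u', v'⟩ h' e
      have h := (Finset.mem_filter.1 h).2
      have h' := (Finset.mem_filter.1 h').2
      rcases Sym2.eq_iff.1 e with ⟨rfl, rfl⟩ | ⟨rfl, rfl⟩
      · rfl
      · exact absurd h'.2.1 h.2.2
  have h2 : cutWeight G w S =
      ∑ u, ∑ v, (if G.Adj u v ∧ u ∉ S ∧ v ∈ S then w s(u, v) else 0) := by
    rw [h1, Finset.sum_comm]
    refine Finset.sum_congr rfl fun u _ => Finset.sum_congr rfl fun v _ => ?_
    rw [G.adj_comm, Sym2.eq_swap]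
    congr 1
    exact propext (and_congr_right fun _ => and_comm)
  rw [two_mul]
  nth_rewrite 1 [h1]
  rw [h2, ← Finset.sum_add_distrib]
  refine Finset.sum_congr rfl fun u _ => ?_
  rw [← Finset.sum_add_distrib]
  refine Finset.sum_congr rfl fun v _ => ?_
  by_cases ha : G.Adj u v <;> by_cases hu : u ∈ S <;> by_cases hv : v ∈ S <;> simp [ha, hu, hv]

theorem cutWeight_nonneg {G : SimpleGraph (Fin n)} {w : Sym2 (Fin n) → ℝ}
    (hw : ∀ e ∈ G.edgeSet, 0 < w e) (S : Set (Fin n)) : 0 ≤ cutWeight G w S := by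
  classical
  unfold cutWeight
  refine Finset.sum_nonneg fun e he => (hw e ?_).le
  exact (Finset.mem_filter.1 he).2.1

variable {T : SimpleGraph (Fin n)} {pp : ℕ → ℕ} {ps : Fin n → ℕ} {vt : ℕ → Fin n}

-- The two signs of an arc differ iff exactly one of the edges at `p`, `q` separates its endpoints,
-- that is, iff the arc crosses the cut.
open Classical in
theorem TreeLayout.arcTerm_eq (h : TreeLayout T pp ps vt) {p q : ℕ} (hp : EdgePos n p)
    (hq : EdgePos n q) (hpq : p ≠ q) (r u v : Fin n) (c : ℝ) :
    arcTerm pp c (ps u) (ps v) p q = -c + 2 *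
      if ¬ (u ∈ pairShore T r (treeEdge pp vt p) (treeEdge pp vt q) ↔
        v ∈ pairShore T r (treeEdge pp vt p) (treeEdge pp vt q)) then c else 0 := by
  have h3 := h.pairShore_cross hp hq hpq r u v
  rw [arcTerm, sepI, sepI]
  by_cases h1 : Anc pp p (ps u) ↔ Anc pp p (ps v) <;>
    by_cases h2 : Anc pp q (ps u) ↔ Anc pp q (ps v) <;>
    simp only [h1, h2, iff_true, iff_false, not_true] at h3 <;>
    simp [h1, h2, h3] <;> ring

-- A crossing arc contributes `w` instead of `-w`, a gain of `2 w`, and every edge of the cut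
-- appears as two arcs; hence the factor 4.
open Classical in
theorem TreeLayout.arcs_sum_eq (h : TreeLayout T pp ps vt) {p q : ℕ} (hp : EdgePos n p)
    (hq : EdgePos n q) (hpq : p ≠ q) (r : Fin n) {G : SimpleGraph (Fin n)} {w : Sym2 (Fin n) → ℝ}
    {A : Fin n → List (Fin n)} (hA : IsAdjList G A) (pos : ℕ → ℕ) (hps : ∀ v : Fin n, pos v = ps v) :
    ∑ u ∈ Finset.range n, ∑ j ∈ Finset.Ico (offset A u) (offset A (u + 1)),
        arcTerm pp (arcWeight A w j) (pos u) (pos (target A j)) p q =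
      4 * cutWeight G w (pairShore T r (treeEdge pp vt p) (treeEdge pp vt q)) -
      ∑ u ∈ Finset.range n, ∑ j ∈ Finset.Ico (offset A u) (offset A (u + 1)), arcWeight A w j := by
  rw [sum_arcs A (fun u j => arcTerm pp (arcWeight A w j) (pos u) (pos (target A j)) p q)
    (fun u v => arcTerm pp (w s(u, v)) (ps u) (ps v) p q) (fun u k hk => by
      rw [arcWeight_offset A w u hk, target_offset A u hk, hps, hps])]
  rw [sum_arcs A (fun _ j => arcWeight A w j) (fun u v => w s(u, v)) (fun u k hk => by
      rw [arcWeight_offset A w u hk])]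
  simp only [hA.sum_map]
  have h4 : 4 * cutWeight G w (pairShore T r (treeEdge pp vt p) (treeEdge pp vt q)) =
      2 * (2 * cutWeight G w (pairShore T r (treeEdge pp vt p) (treeEdge pp vt q))) := by ring
  rw [h4, ← sum_cross_eq_two_mul_cutWeight, eq_sub_iff_add_eq, ← Finset.sum_add_distrib,
    Finset.mul_sum]
  refine Finset.sum_congr rfl fun u _ => ?_
  rw [← Finset.sum_add_distrib, Finset.mul_sum]
  refine Finset.sum_congr rfl fun v _ => ?_
  rw [h.arcTerm_eq hp hq hpq r]
  by_cases ha : G.Adj u v <;> simp [ha]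

-- Away from the diagonal, the tensor square of the indicator of the two edge positions at `u` is
-- supported on this pair in both orders. At a vertex that lies between `p` and `q` the tree degree
-- is two, because these two edges are distinct and are all its tree edges; so the test on the
-- degree loses nothing.
open Classical in
theorem TreeLayout.degreeTwoTerm_eq (h : TreeLayout T pp ps vt) {p q : ℕ} (hp : EdgePos n p)
    (hq : EdgePos n q) (hpq : p ≠ q) {B : Fin n → List (Fin n)} (hB : IsAdjList T B)
    (par pos : ℕ → ℕ) (κ : ℝ)
    (hep : ∀ u a : Fin n, T.Adj u a →
      EdgePos n (edgePos par pos u a) ∧ treeEdge pp vt (edgePos par pos u a) = s(u, a))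
    (u : Fin n) : degreeTwoTerm (offset B) (target B) par pos κ u p q =
      if TreeLayout.Between T pp vt p q u then κ else 0 := by
  rw [degreeTwoTerm, offset_succ, Nat.add_sub_cancel_left]
  by_cases h2 : (B u).length = 2
  · have t0 := target_offset B u (k := 0) (by omega)
    have t1 := target_offset B u (k := 1) (by omega)
    rw [add_zero] at t0
    rw [if_pos h2, t0, t1]
    obtain ⟨a, b, hab⟩ := List.length_eq_two.1 h2
    have hnd := (hB u).1
    have hadj : ∀ x, T.Adj u x ↔ x = a ∨ x = b := fun x => by
      rw [← (hB u).2, hab]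
      simp
    simp only [hab, List.getElem_cons_zero, List.getElem_cons_succ]
    have hne : a ≠ b := by
      rw [hab] at hnd
      simpa using hnd
    obtain ⟨ha1, ha2⟩ := hep u a ((hadj a).2 (Or.inl rfl))
    obtain ⟨hb1, hb2⟩ := hep u b ((hadj b).2 (Or.inr rfl))
    generalize edgePos par pos u a = x at *
    generalize edgePos par pos u b = y at *
    have hxy : x ≠ y := by
      rintro rfl
      exact hne (Sym2.congr_right.1 (ha2.symm.trans hb2))
    have hbet : TreeLayout.Between T pp vt p q u ↔ (p = x ∧ q = y) ∨ (p = y ∧ q = x) := by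
      constructor
      · rintro ⟨-, -, hall⟩
        have e1 := hall a ((hadj a).2 (Or.inl rfl))
        have e2 := hall b ((hadj b).2 (Or.inr rfl))
        rw [← ha2] at e1
        rw [← hb2] at e2
        rcases e1 with e1 | e1 <;> rcases e2 with e2 | e2
        · exact absurd ((h.treeEdge_inj ha1 hp e1).trans (h.treeEdge_inj hb1 hp e2).symm) hxy
        · exact Or.inl ⟨(h.treeEdge_inj ha1 hp e1).symm, (h.treeEdge_inj hb1 hq e2).symm⟩
        · exact Or.inr ⟨(h.treeEdge_inj hb1 hp e2).symm, (h.treeEdge_inj ha1 hq e1).symm⟩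
        · exact absurd ((h.treeEdge_inj ha1 hq e1).trans (h.treeEdge_inj hb1 hq e2).symm) hxy
      · rintro (⟨rfl, rfl⟩ | ⟨rfl, rfl⟩)
        · refine ⟨by rw [ha2]; simp, by rw [hb2]; simp, fun c hc => ?_⟩
          rw [ha2, hb2]
          rcases (hadj c).1 hc with rfl | rfl
          · exact Or.inl rfl
          · exact Or.inr rfl
        · refine ⟨by rw [hb2]; simp, by rw [ha2]; simp, fun c hc => ?_⟩
          rw [ha2, hb2]
          rcases (hadj c).1 hc with rfl | rfl
          · exact Or.inr rfl
          · exact Or.inl rfl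
    simp only [hbet, pairInd]
    by_cases p1 : p = x
    · subst p1
      by_cases q2 : q = y
      · simp [q2, hxy, hxy.symm]
      · simp [q2, hpq.symm, hxy]
    · by_cases p2 : p = y
      · subst p2
        by_cases q1 : q = x
        · simp [q1, hxy, hxy.symm]
        · simp [q1, hpq.symm, hxy.symm]
      · simp [p1, p2]
  · rw [if_neg h2, if_neg]
    rintro ⟨hu1, hu2, hall⟩
    have hother : ∀ p, EdgePos n p → u ∈ treeEdge pp vt p → ∃ a, T.Adj u a ∧
        s(u, a) = treeEdge pp vt p := by
      intro p hp hu
      refine ⟨Sym2.Mem.other hu, ?_, Sym2.other_spec hu⟩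
      rw [← SimpleGraph.mem_edgeSet, Sym2.other_spec hu]
      exact h.treeEdge_mem hp
    obtain ⟨a, ha, ea⟩ := hother p hp hu1
    obtain ⟨b, hb, eb⟩ := hother q hq hu2
    refine h2 ?_
    rw [← List.toFinset_card_of_nodup (hB u).1]
    have : (B u).toFinset = {a, b} := by
      ext c
      rw [List.mem_toFinset, (hB u).2, Finset.mem_insert, Finset.mem_singleton]
      constructor
      · intro hc
        rcases hall c hc with e | e
        · exact Or.inl (Sym2.congr_right.1 (e.trans ea.symm))
        · exact Or.inr (Sym2.congr_right.1 (e.trans eb.symm))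
      · rintro (rfl | rfl) <;> assumption
    rw [this, Finset.card_pair]
    rintro rfl
    exact hpq (h.treeEdge_inj hp hq (ea.symm.trans eb))

/-- After cancellation of the total arc weight the inequality compares four times the cut weight
plus penalties with `4β`. One penalty alone exceeds `4β`, and the cut weight is non-negative since
the edge weights are positive, so trivial cuts fail; for the other pairs no penalty is present. -/
theorem TreeLayout.costMatrix_le_iff (h : TreeLayout T pp ps vt) (hT : T.Connected) {p q : ℕ}
    (hp : EdgePos n p) (hq : EdgePos n q) (hpq : p ≠ q) (r : Fin n) {G : SimpleGraph (Fin n)}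
    {w : Sym2 (Fin n) → ℝ} (hw : ∀ e ∈ G.edgeSet, 0 < w e) (β : ℝ)
    {A B : Fin n → List (Fin n)} (hA : IsAdjList G A) (hB : IsAdjList T B) (par pos : ℕ → ℕ)
    (hps : ∀ v : Fin n, pos v = ps v)
    (hep : ∀ u a : Fin n, T.Adj u a →
      EdgePos n (edgePos par pos u a) ∧ treeEdge pp vt (edgePos par pos u a) = s(u, a)) :
    costMatrix n (offset A) (target A) (arcWeight A w) (offset B) (target B) par pos pp (penalty β)
        p q ≤ 4 * β - ∑ u ∈ Finset.range n,
          ∑ j ∈ Finset.Ico (offset A u) (offset A (u + 1)), arcWeight A w j ↔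
      cutWeight G w (pairShore T r (treeEdge pp vt p) (treeEdge pp vt q)) ≤ β ∧
        NontrivialShore (pairShore T r (treeEdge pp vt p) (treeEdge pp vt q)) := by
  classical
  rw [costMatrix, h.arcs_sum_eq hp hq hpq r hA pos hps, h.nontrivialShore_iff hT hp hq hpq,
    Finset.sum_range (fun u => degreeTwoTerm (offset B) (target B) par pos (penalty β) u p q)]
  simp only [h.degreeTwoTerm_eq hp hq hpq hB par pos (penalty β) hep]
  have hc := cutWeight_nonneg hw (pairShore T r (treeEdge pp vt p) (treeEdge pp vt q))
  have h1 := penalty_pos β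
  have h2 := lt_penalty β
  by_cases hb : ∃ v, TreeLayout.Between T pp vt p q v
  · obtain ⟨v, hv⟩ := hb
    have h3 : penalty β ≤ ∑ u : Fin n, if TreeLayout.Between T pp vt p q u then penalty β else 0 := by
      refine le_trans ?_ (Finset.single_le_sum (f := fun u : Fin n =>
        if TreeLayout.Between T pp vt p q u then penalty β else 0) (fun u _ => ?_)
        (Finset.mem_univ v))
      · simp only [if_pos hv]; exact le_rfl
      · split_ifs
        · exact h1.le
        · exact le_rfl
    constructor
    · intro hle; linarith
    · intro hle; exact absurd ⟨v, hv⟩ hle.2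
  · rw [Finset.sum_eq_zero fun u _ => if_neg fun hu => hb ⟨u, hu⟩]
    constructor
    · intro hle; exact ⟨by linarith, hb⟩
    · rintro ⟨hle, -⟩; linarith

end Cuts

end RealRAM

namespace RealRAM

/-! ## The output of the program -/

section Output

variable {n : ℕ}

/-- The search ensures only that every link from a vertex to its parent is an edge of `T`. Parents
have smaller positions, so the `n - 1` links are distinct edges; as a tree has `n - 1` edges, there
are no others. -/
theorem Layout.treeLayout [NeZero n] {par pos vert hd pp : ℕ → ℕ}
    (hL : Layout n par pos vert hd pp) {T : SimpleGraph (Fin n)} (hT : T.IsTree)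
    {B : Fin n → List (Fin n)} (hB : IsAdjList T B)
    (hpar : ∀ v < n, v ≠ 0 → ArcRel (offset B) (target B) (par v) v) :
    TreeLayout T pp (fun v => pos v) (fun p => Fin.ofNat n (vert p)) := by
  classical
  obtain ⟨sz, hP⟩ := hL.tree
  have hv : ∀ p < n, vert p % n = vert p := fun p hp => Nat.mod_eq_of_lt (hL.vert_lt p hp)
  have hpos0 : ∀ v < n, v ≠ 0 → pos v ≠ 0 := fun v hvn h0 h => by
    have := hL.vert_pos v hvn
    rw [h, ← hL.pos_zero, hL.vert_pos 0 (by omega)] at this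
    exact h0 this.symm
  have hadj : ∀ u v : Fin n, v.val ≠ 0 → par v = u → T.Adj u v := fun u v h0 e => by
    have := hpar v v.2 h0
    rw [e] at this
    exact (hB.arcRel u v).1 this
  have hlt : ∀ v < n, v ≠ 0 → pos (par v) < pos v := fun v hvn h0 => by
    rw [← hL.pp_pos v hvn]
    exact hP.lt _ (by have := hpos0 v hvn h0; omega) (hL.pos_lt v hvn)
  refine ⟨fun v => hL.pos_lt v v.2, fun v => Fin.ext ?_, fun p hp => ?_, hP.lt, fun u v => ?_⟩
  · simp [hL.vert_pos v v.2]
  · simp [hv p hp, hL.pos_vert p hp]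
  · let f : Fin n → Sym2 (Fin n) := fun v => s(⟨par v, hL.par_lt v v.2⟩, v)
    have hinj : Set.InjOn f (Finset.univ.erase (0 : Fin n)) := by
      intro x hx y hy e
      have hx0 : x.val ≠ 0 := fun h => Finset.ne_of_mem_erase hx (Fin.ext (by simpa using h))
      have hy0 : y.val ≠ 0 := fun h => Finset.ne_of_mem_erase hy (Fin.ext (by simpa using h))
      rcases Sym2.eq_iff.1 e with ⟨-, e⟩ | ⟨e1, e2⟩
      · exact e
      · have h1 := hlt x x.2 hx0
        have h2 := hlt y y.2 hy0
        rw [Fin.ext_iff] at e1 e2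
        simp only at e1 e2
        rw [e1] at h1
        rw [← e2] at h2
        omega
    have himg : (Finset.univ.erase (0 : Fin n)).image f = T.edgeFinset := by
      refine Finset.eq_of_subset_of_card_le (fun e he => ?_) ?_
      · obtain ⟨x, hx, rfl⟩ := Finset.mem_image.1 he
        have hx0 : x.val ≠ 0 := fun h => Finset.ne_of_mem_erase hx (Fin.ext (by simpa using h))
        rw [SimpleGraph.mem_edgeFinset, SimpleGraph.mem_edgeSet]
        exact hadj _ _ hx0 rfl
      · rw [Finset.card_image_of_injOn hinj, Finset.card_erase_of_mem (Finset.mem_univ _),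
          Finset.card_univ, ← hT.card_edgeFinset, Nat.add_sub_cancel]
    have key : ∀ u v : Fin n, v.val ≠ 0 ∧ par v = u ↔ pos v ≠ 0 ∧ pp (pos v) = pos u := by
      intro u v
      rw [hL.pp_pos v v.2]
      refine and_congr ⟨hpos0 v v.2, fun h e => h ?_⟩ ⟨fun e => by rw [e], fun e => ?_⟩
      · rw [e, hL.pos_zero]
      · rw [← hL.vert_pos _ (hL.par_lt v v.2), e, hL.vert_pos u u.2]
    rw [← key u v, ← key v u]
    constructor
    · intro h
      have : s(u, v) ∈ T.edgeFinset := by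
        rw [SimpleGraph.mem_edgeFinset]; exact h
      rw [← himg] at this
      obtain ⟨x, hx, e⟩ := Finset.mem_image.1 this
      have hx0 : x.val ≠ 0 := fun h => Finset.ne_of_mem_erase hx (Fin.ext (by simpa using h))
      rcases Sym2.eq_iff.1 e with ⟨rfl, rfl⟩ | ⟨rfl, rfl⟩
      · exact Or.inl ⟨hx0, rfl⟩
      · exact Or.inr ⟨hx0, rfl⟩
    · rintro (⟨h0, e⟩ | ⟨h0, e⟩)
      · exact hadj u v h0 e
      · exact (hadj v u h0 e).symm

/-- The lower endpoint of a tree edge is recognised by its parent being the other endpoint. The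
convention `par 0 = 0` causes no confusion, since a vertex is not adjacent to itself. -/
theorem Layout.treeEdge_edgePos [NeZero n] {par pos vert hd pp : ℕ → ℕ}
    (hL : Layout n par pos vert hd pp) {T : SimpleGraph (Fin n)}
    (h : TreeLayout T pp (fun v => pos v) (fun p => Fin.ofNat n (vert p))) (u a : Fin n)
    (ha : T.Adj u a) : EdgePos n (edgePos par pos u a) ∧
      treeEdge pp (fun p => Fin.ofNat n (vert p)) (edgePos par pos u a) = s(u, a) := by
  have hinj : ∀ x < n, ∀ y < n, pos x = pos y → x = y := fun x hx y hy e => by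
    rw [← hL.vert_pos x hx, e, hL.vert_pos y hy]
  unfold edgePos
  split_ifs with e
  · have h1 : pp (pos u) = pos a := by rw [hL.pp_pos u u.2, e]
    have h0 : pos u ≠ 0 := by
      intro h0
      have h2 : u.val = 0 := hinj u u.2 0 (by have := u.2; omega) (h0.trans hL.pos_zero.symm)
      rw [h2, hL.par_zero] at e
      exact ha.ne (Fin.ext (h2.trans e))
    exact ⟨⟨by omega, hL.pos_lt u u.2⟩, by
      rw [Sym2.eq_swap]; exact (h.treeEdge_of_adj (u := a) (v := u) h1).symm⟩
  · rcases (h.adj u a).1 ha with ⟨h0, h1⟩ | ⟨h0, h1⟩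
    · exact ⟨⟨by omega, hL.pos_lt a a.2⟩, (h.treeEdge_of_adj h1).symm⟩
    · rw [hL.pp_pos u u.2] at h1
      exact absurd (hinj _ (hL.par_lt u u.2) _ a.2 h1) e

/-- The spanning forest on positions becomes a spanning forest on the edges of the tree. -/
theorem exists_spanningForest {T : SimpleGraph (Fin n)} {H : SimpleGraph T.edgeSet}
    {E : ℕ → Sym2 (Fin n)} (hE : ∀ p, EdgePos n p → E p ∈ T.edgeSet)
    (hsurj : ∀ e ∈ T.edgeSet, ∃ p, EdgePos n p ∧ e = E p)
    (hinj : ∀ p q, EdgePos n p → EdgePos n q → E p = E q → p = q) {P : ℕ → ℕ → Prop}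
    (hP : ∀ p q (hp : EdgePos n p) (hq : EdgePos n q), p ≠ q →
      (P p q ↔ H.Adj ⟨E p, hE p hp⟩ ⟨E q, hE q hq⟩))
    {po : List (Sym2 ℕ)} {col : ℕ → ℕ} (hF : Forest n P po col)
    (hcol : ∀ e x, EdgePos n e → EdgePos n x → P e x → col x = col e) {s : State}
    (hlen : s.intVar 1 = po.length) (hout : ∀ i (h : i < po.length), outputPair s i =
      Sym2.map (fun p => Sym2.map Fin.val (E p)) po[i]) :
    ∃ F : SimpleGraph T.edgeSet, IsSpanningForest H F ∧ Outputs s F := by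
  choose! φ hφ using hsurj
  let g : T.edgeSet → ℕ := fun e => φ e.1
  have hg : ∀ e : T.edgeSet, EdgePos n (g e) := fun e => (hφ e.1 e.2).1
  have hEg : ∀ e : T.edgeSet, E (g e) = e.1 := fun e => (hφ e.1 e.2).2.symm
  have hgE : ∀ p (hp : EdgePos n p), g ⟨E p, hE p hp⟩ = p := fun p hp =>
    hinj _ _ (hg _) hp (hEg _)
  have hginj : Function.Injective g := fun e f h => Subtype.ext (by rw [← hEg e, h, hEg f])
  have hPg : ∀ e f : T.edgeSet, e ≠ f → (P (g e) (g f) ↔ H.Adj e f) := fun e f hne => by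
    rw [hP _ _ (hg e) (hg f) fun h => hne (hginj h)]
    simp only [hEg]
  have hpo : ∀ z ∈ po, ∃ a b : T.edgeSet, a ≠ b ∧ z = s(g a, g b) ∧ H.Adj a b := by
    intro z hz
    obtain ⟨a, b, rfl, ha, ha', hb, hb', hab, hPab⟩ := hF.mem z hz
    refine ⟨⟨E a, hE a ⟨ha, ha'⟩⟩, ⟨E b, hE b ⟨hb, hb'⟩⟩, fun h => hab ?_, ?_, ?_⟩
    · exact hinj _ _ ⟨ha, ha'⟩ ⟨hb, hb'⟩ (Subtype.ext_iff.1 h)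
    · rw [hgE a ⟨ha, ha'⟩, hgE b ⟨hb, hb'⟩]
    · exact (hP a b ⟨ha, ha'⟩ ⟨hb, hb'⟩ hab).1 hPab
  let F : SimpleGraph T.edgeSet := (listGraph po).comap g
  have hFadj : ∀ e f, F.Adj e f ↔ s(g e, g f) ∈ po := fun e f => by
    rw [SimpleGraph.comap_adj, listGraph, SimpleGraph.fromEdgeSet_adj]
    refine ⟨fun h => h.1, fun h => ⟨h, ?_⟩⟩
    obtain ⟨a, b, hab, he, -⟩ := hpo _ h
    rcases Sym2.eq_iff.1 he with ⟨e1, e2⟩ | ⟨e1, e2⟩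
    · rw [e1, e2]; exact fun h => hab (hginj h)
    · rw [e1, e2]; exact fun h => hab (hginj h).symm
  -- All listed pairs consist of positions of tree edges, so a walk that starts at such a position
  -- never leaves them and lifts to `F`.
  have hreach : ∀ x y, (listGraph po).Reachable x y → ∀ e, g e = x → ∃ f, g f = y ∧ F.Reachable e f := by
    rintro x y ⟨w⟩
    induction w with
    | nil => exact fun e he => ⟨e, he, .refl _⟩
    | cons ha _ ih =>
      rintro e rfl
      have hz := ((SimpleGraph.fromEdgeSet_adj _).1 ha).1
      obtain ⟨a, b, hab, he, -⟩ := hpo _ hz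
      obtain ⟨f, hf⟩ : ∃ f, g f = _ := by
        rcases Sym2.eq_iff.1 he with ⟨-, e2⟩ | ⟨-, e2⟩
        · exact ⟨b, e2.symm⟩
        · exact ⟨a, e2.symm⟩
      obtain ⟨f', h1, h2⟩ := ih f hf
      refine ⟨f', h1, SimpleGraph.Reachable.trans (SimpleGraph.Adj.reachable ?_) h2⟩
      rw [hFadj, hf]
      exact hz
  refine ⟨F, ⟨fun e f h => ?_, ?_, fun e f h => ?_⟩, ?_, ?_, ?_⟩
  · rw [hFadj] at h
    obtain ⟨a, b, hab, he, hH⟩ := hpo _ h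
    rcases Sym2.eq_iff.1 he with ⟨e1, e2⟩ | ⟨e1, e2⟩
    · rw [hginj e1, hginj e2]; exact hH
    · rw [hginj e1, hginj e2]; exact hH.symm
  · exact hF.acyclic.comap (SimpleGraph.Hom.comap g _) hginj
  -- Colours are constant along walks in `H`, and positions of equal colour are connected in the
  -- forest.
  · have hc : col (g e) = col (g f) := by
      obtain ⟨w⟩ := h
      induction w with
      | nil => rfl
      | cons ha _ ih =>
        rw [← ih]
        exact (hcol _ _ (hg _) (hg _) ((hPg _ _ ha.ne).2 ha)).symm
    obtain ⟨f', h1, h2⟩ := hreach _ _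
      (hF.complete _ _ (hg e).1 (hg e).2 (hg f).1 (hg f).2 hc) e rfl
    rwa [hginj h1] at h2
  · intro i hi
    rw [Set.mem_Iio, hlen] at hi
    obtain ⟨a, b, hab, he, hH⟩ := hpo _ (List.getElem_mem hi)
    refine ⟨s(a, b), ?_, ?_⟩
    · rw [SimpleGraph.mem_edgeSet, hFadj, ← he]
      exact List.getElem_mem hi
    · rw [hout i hi, he]
      simp [hEg]
  · intro i hi j hj h
    rw [Set.mem_Iio, hlen] at hi hj
    obtain ⟨a, b, hab, he, -⟩ := hpo _ (List.getElem_mem hi)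
    obtain ⟨c, d, hcd, he', -⟩ := hpo _ (List.getElem_mem hj)
    rw [hout i hi, hout j hj, he, he'] at h
    simp only [Sym2.map_mk, hEg] at h
    refine (hF.nodup.getElem_inj_iff (hi := hi) (hj := hj)).1 ?_
    rw [he, he']
    have hval : Function.Injective (fun e : T.edgeSet => Sym2.map Fin.val e.1) :=
      fun e f h => Subtype.ext (Sym2.map.injective Fin.val_injective h)
    rcases Sym2.eq_iff.1 h with ⟨e1, e2⟩ | ⟨e1, e2⟩
    · rw [hval e1, hval e2]
    · rw [hval e1, hval e2, Sym2.eq_swap]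
  · rintro _ ⟨z, hz, rfl⟩
    induction z with
    | _ e f =>
      rw [SimpleGraph.mem_edgeSet, hFadj] at hz
      obtain ⟨i, hi, h⟩ := List.mem_iff_getElem.1 hz
      refine ⟨i, by rw [Set.mem_Iio, hlen]; exact hi, ?_⟩
      rw [hout i hi, h]
      simp [hEg]

end Output

end RealRAM

namespace RealRAM

/-! ## Resource bounds -/

theorem arcEvents_le_sq {n : ℕ} (hn : 1 ≤ n) : arcEvents n ≤ 169 * (n * n) := by
  have h1 := Nat.log_le_self 2 n
  have h2 : 8 * Nat.log 2 n + 5 ≤ 13 * n := by omega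
  calc arcEvents n ≤ (13 * n) * (13 * n) := Nat.mul_le_mul h2 h2
    _ = 169 * (n * n) := by ring

/-- The number `N = 2 ^ (Nat.log 2 n + 1)` exceeds `n` and is at least 2, so `N ^ 14 ≥ 2 ^ 10 * n ^
4`. The left side is at most `(169 + 676 + 1 + 20 + 60) * n ^ 4 = 926 * n ^ 4`. -/
theorem word_bound {n m wordLength : ℕ} (hn : 1 ≤ n) (hm : m ≤ n * n)
    (hw : 14 * (Nat.log 2 n + 1) ≤ wordLength) :
    (m + 4) * arcEvents n + n * n + 20 * n + 60 ≤ 2 ^ wordLength := by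
  have h1 : n < 2 ^ (Nat.log 2 n + 1) := Nat.lt_pow_succ_log_self (by omega) n
  have h2 : 2 ≤ 2 ^ (Nat.log 2 n + 1) := by
    rw [pow_succ]
    have := Nat.one_le_two_pow (n := Nat.log 2 n)
    omega
  have h3 : (2 ^ (Nat.log 2 n + 1)) ^ 14 ≤ 2 ^ wordLength := by
    rw [← pow_mul, mul_comm]
    exact Nat.pow_le_pow_right (by omega) hw
  generalize 2 ^ (Nat.log 2 n + 1) = N at *
  have h4 : n ^ 4 * 2 ^ 10 ≤ N ^ 14 := by
    rw [show N ^ 14 = N ^ 4 * N ^ 10 by ring]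
    exact Nat.mul_le_mul (Nat.pow_le_pow_left h1.le 4) (Nat.pow_le_pow_left h2 10)
  have h5 : n ≤ n ^ 4 := Nat.le_self_pow (by omega) n
  have h6 : n * n ≤ n ^ 4 := by
    rw [← sq]
    exact Nat.pow_le_pow_right hn (by omega)
  have h7 : (m + 4) * arcEvents n ≤ (n * n + 4) * (169 * (n * n)) :=
    Nat.mul_le_mul (by omega) (arcEvents_le_sq hn)
  have h8 : (n * n + 4) * (169 * (n * n)) = 169 * n ^ 4 + 676 * (n * n) := by ring
  omega

/-- Both `Nat.log 2 n` and `1` are at most `Real.log n / Real.log 2`, and `2 / Real.log 2 < 3`. -/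
theorem log_succ_le {n : ℕ} (hn : 2 ≤ n) : ((Nat.log 2 n + 1 : ℕ) : ℝ) ≤ 3 * Real.log n := by
  have h1 : (2 : ℝ) ^ Nat.log 2 n ≤ n := by exact_mod_cast Nat.pow_log_le_self 2 (by omega)
  have h2 : Nat.log 2 n * Real.log 2 ≤ Real.log n := by
    rw [← Real.log_pow]
    exact Real.log_le_log (by positivity) h1
  have h3 : Real.log 2 ≤ Real.log n := Real.log_le_log (by norm_num) (by exact_mod_cast hn)
  have h4 := Real.log_two_gt_d9
  push_cast
  nlinarith

/-- With `n ≤ 2 m` every term is at most a multiple of `m * l ^ 3`, where `l = Nat.log 2 n + 1`, and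
one factor `l` is left to spare. The change to the natural logarithm costs `3 ^ 4 = 81`, and `81 *
400000` is below the constant in the claim. -/
theorem time_bound {n m t : ℕ} (hn : 2 ≤ n) (hm : n ≤ m + 1)
    (ht : t ≤ 900 * (Nat.log 2 n + 2) * (2 * m * arcEvents n + 17 * n) +
        900 * (Nat.log 2 n + 2) * (n * Nat.log 2 n) + 4000 * n + 1000) :
    (t : ℝ) ≤ 40000000 * (m * Real.log n ^ 4) := by
  have h1 : t ≤ 400000 * (m * (Nat.log 2 n + 1) ^ 4) := by
    have h2 : arcEvents n ≤ 64 * ((Nat.log 2 n + 1) * (Nat.log 2 n + 1)) := by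
      have : 8 * Nat.log 2 n + 5 ≤ 8 * (Nat.log 2 n + 1) := by omega
      calc arcEvents n ≤ _ := Nat.mul_le_mul this this
        _ = _ := by ring
    have hl : Nat.log 2 n + 2 ≤ 2 * (Nat.log 2 n + 1) := by omega
    have hl' : Nat.log 2 n ≤ Nat.log 2 n + 1 := by omega
    have hl1 : 1 ≤ Nat.log 2 n + 1 := by omega
    have hnm : n ≤ 2 * m := by omega
    have hm1 : 1 ≤ m := by omega
    refine ht.trans ?_
    have h3 : 900 * (Nat.log 2 n + 2) * (2 * m * arcEvents n + 17 * n) ≤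
        900 * (2 * (Nat.log 2 n + 1)) *
          (2 * m * (64 * ((Nat.log 2 n + 1) * (Nat.log 2 n + 1))) + 17 * (2 * m)) := by
      gcongr
    have h4 : 900 * (Nat.log 2 n + 2) * (n * Nat.log 2 n) ≤
        900 * (2 * (Nat.log 2 n + 1)) * (2 * m * (Nat.log 2 n + 1)) := by
      gcongr
    generalize Nat.log 2 n + 1 = l at *
    have p0 : m ≤ m * l ^ 4 := Nat.le_mul_of_pos_right _ (by positivity)
    have p1 : m * l ≤ m * l ^ 4 := Nat.mul_le_mul_left _ (Nat.le_self_pow (by omega) l)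
    have p2 : m * l ^ 2 ≤ m * l ^ 4 := Nat.mul_le_mul_left _ (Nat.pow_le_pow_right hl1 (by omega))
    have p3 : m * l ^ 3 ≤ m * l ^ 4 := Nat.mul_le_mul_left _ (Nat.pow_le_pow_right hl1 (by omega))
    have e3 : 900 * (2 * l) * (2 * m * (64 * (l * l)) + 17 * (2 * m)) =
      230400 * (m * l ^ 3) + 61200 * (m * l) := by ring
    have e4 : 900 * (2 * l) * (2 * m * l) = 3600 * (m * l ^ 2) := by ring
    omega
  have h2 : (t : ℝ) ≤ 400000 * (m * ((Nat.log 2 n + 1 : ℕ) : ℝ) ^ 4) := by exact_mod_cast h1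
  have h3 : ((Nat.log 2 n + 1 : ℕ) : ℝ) ^ 4 ≤ (3 * Real.log n) ^ 4 :=
    pow_le_pow_left₀ (by positivity) (log_succ_le hn) 4
  have h4 : (m : ℝ) * ((Nat.log 2 n + 1 : ℕ) : ℝ) ^ 4 ≤ m * (3 * Real.log n) ^ 4 :=
    mul_le_mul_of_nonneg_left h3 (by positivity)
  have h5 : 0 ≤ (m : ℝ) * Real.log n ^ 4 := by positivity
  nlinarith

end RealRAM


/-! ### The analysis of the program combined with the description of the cuts. -/

theorem mainTheorem2 :
    ∃ (P : RealRAM.Cmd) (k : ℕ) (C : ℝ),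
      ∀ (n : ℕ) (G T : SimpleGraph (Fin n)) (w : Sym2 (Fin n) → ℝ) (β : ℝ)
        (A B : Fin n → List (Fin n)),
        G.Connected → (∀ e ∈ G.edgeSet, 0 < w e) →
        T ≤ G → T.IsTree →
        RealRAM.IsAdjList G A → RealRAM.IsAdjList T B →
        ∀ wordLength : ℕ, k * (Nat.log 2 n + 1) ≤ wordLength →
        ∃ (s : RealRAM.State) (t : ℕ),
          RealRAM.Run (2 ^ wordLength) P (RealRAM.inputState A w B β) s t ∧
          (2 ≤ n → (t : ℝ) ≤ C * (G.edgeSet.ncard * Real.log n ^ 4)) ∧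
          ∀ r : Fin n, ∃ F : SimpleGraph T.edgeSet,
            IsSpanningForest (pairCutGraph G T w β r) F ∧ RealRAM.Outputs s F := by
  refine ⟨RealRAM.spanningForestProgram, 14, 40000000, ?_⟩
  intro n G T w β A B hG hw hTG hT hA hB wordLength hk
  have hn : 1 ≤ n := by
    obtain ⟨v⟩ := hG.nonempty
    exact Nat.one_le_of_lt v.2
  have : NeZero n := ⟨by omega⟩
  have hcard : T.edgeSet.ncard + 1 = n := by
    classical
    rw [← SimpleGraph.coe_edgeFinset, Set.ncard_coe_finset, hT.card_edgeFinset, Fintype.card_fin]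
  have hoB : RealRAM.offset B n = 2 * T.edgeSet.ncard := hB.offset_last
  have hoA : RealRAM.offset A n = 2 * G.edgeSet.ncard := hA.offset_last
  have hoA' : RealRAM.offset A n ≤ n * n := by
    rw [RealRAM.offset_last_eq_sum]
    calc ∑ u, (A u).length ≤ ∑ _u : Fin n, n := Finset.sum_le_sum fun u _ => by
          simpa using (hA u).1.length_le_card
      _ = n * n := by simp
  have hTG' : T.edgeSet.ncard ≤ G.edgeSet.ncard :=
    Set.ncard_le_ncard (SimpleGraph.edgeSet_mono hTG)
  have hconn : ∀ C : ℕ → Prop, C 0 →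
      (∀ u < n, C u → ∀ v, RealRAM.ArcRel (RealRAM.offset B) (RealRAM.target B) u v → C v) →
      ∀ u < n, C u := by
    intro C h0 hC u hu
    obtain ⟨p⟩ := hT.connected.preconnected (0 : Fin n) ⟨u, hu⟩
    have key : ∀ x y : Fin n, T.Walk x y → C x → C y := by
      intro x y p
      induction p with
      | nil => exact id
      | cons ha _ ih => exact fun hx => ih (hC _ (Fin.is_lt _) hx _ ((hB.arcRel _ _).2 ha))
    exact key _ _ p (by simpa using h0)
  obtain ⟨s, t, hrun, ht, par, pos, vert, hd, pp, hL, hpar, P, hP, po, col, hF, hlen, hout, hcol⟩ :=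
    RealRAM.spanningForestProgram_spec (W := 2 ^ wordLength) (RealRAM.inputState A w B β) n
      (RealRAM.offset A) (RealRAM.target A) (RealRAM.offset B) (RealRAM.target B)
      (RealRAM.arcWeight A w) β hn rfl rfl rfl rfl rfl rfl rfl (RealRAM.offset_zero A) (RealRAM.offset_mono A)
      (RealRAM.target_lt A) (RealRAM.offset_zero B) (RealRAM.offset_mono B) (RealRAM.target_lt B)
      hconn (by omega) (RealRAM.word_bound hn hoA' hk)
      (fun a ha => by
        match a, ha with
        | a + 8, _ => rfl)
      (fun a ha => by
        match a, ha with
        | a + 1, _ => rfl)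
      (fun x hx => if_neg (by omega)) (fun x hx => if_neg (by omega))
  refine ⟨s, t, hrun, fun hn2 => RealRAM.time_bound hn2 (by omega) (by rwa [hoA] at ht),
    fun r => ?_⟩
  -- The run does not depend on `r`: its single output serves every choice of the root.
  have hTL := hL.treeLayout hT hB hpar
  refine RealRAM.exists_spanningForest (E := RealRAM.treeEdge pp fun p => Fin.ofNat n (vert p))
    (fun p hp => hTL.treeEdge_mem hp) (fun e he => hTL.exists_treeEdge he)
    (fun p q hp hq => hTL.treeEdge_inj hp hq) (fun p q hp hq hpq => ?_) hF hcol hlen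
    (fun i hi => ?_)
  · rw [hP, hTL.costMatrix_le_iff hT.connected hp hq hpq r hw β hA hB par pos (fun _ => rfl)
      (hL.treeEdge_edgePos hTL), pairCutGraph, SimpleGraph.fromRel_adj]
    have hne : (⟨_, hTL.treeEdge_mem hp⟩ : T.edgeSet) ≠ ⟨_, hTL.treeEdge_mem hq⟩ := fun h =>
      hpq (hTL.treeEdge_inj hp hq (Subtype.ext_iff.1 h))
    rw [and_iff_right hne]
    simp only
    -- The shore is symmetric in the two tree edges, so the symmetrisation in `fromRel` adds no
    -- pairs.
    rw [hTL.pairShore_comm hq hp hpq.symm, or_self]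
  · rw [hout i hi]
    obtain ⟨a, b, he, ha, ha', hb, hb', -⟩ := hF.mem _ (List.getElem_mem hi)
    have key : ∀ p, RealRAM.EdgePos n p → s(par (vert p), vert p) =
        Sym2.map Fin.val (RealRAM.treeEdge pp (fun p => Fin.ofNat n (vert p)) p) := by
      intro p hp
      have hv := hL.vert_lt p hp.2
      have h1 : pp p = pos (par (vert p)) := by rw [← hL.pp_pos _ hv, hL.pos_vert p hp.2]
      rw [RealRAM.treeEdge, h1, Sym2.map_mk]
      simp only [Fin.val_ofNat, hL.vert_pos _ (hL.par_lt _ hv), Nat.mod_eq_of_lt hv,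
        Nat.mod_eq_of_lt (hL.par_lt _ hv)]
    rw [he, Sym2.map_mk, Sym2.map_mk, key a ⟨ha, ha'⟩, key b ⟨hb, hb'⟩]
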